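/- Let $G$ be a simple simply-connected complex algebraic group, $B\subset G$ a Borel subgroup, $N$ its unipotent radical, $T\subset B$ a maximal torus, with Lie algebras $\mathfrak g,\mathfrak b,\mathfrak n,\mathfrak t$. Let $P$ be the weight lattice, $Q\subset P$ the root lattice, $(\alpha_i)_{i\in I}$ the simple roots, and $\mathfrak t^*_{\mathbb R}=P\otimes\mathbb R$. Fix a nonzero root vector $\dot e_i\in\mathfrak n$ of weight $\alpha_i$ for each $i\in I$, and put $\dot e=\sum_{i}\dot e_i$. Let $\mathfrak t^{\mathrm{reg}}\subset\mathfrak t$ be the set of regular elements (those $x$ with $\dim C_G(x)=\dim T$). For a sequence $\mathbf i=(i_1,\dots,i_p)$ in $I$ let $\beta^{\mathbf i}_k=\alpha_{i_1}+\dots+\alpha_{i_k}$ ($0\le k\le p$), let $D_{\mathbf i}$ be the push-forward of Lebesgue measure on the standard $p$-simplex $\{c_k\ge0,\ c_0+\dots+c_p=1\}$ (normalized to have total mass $1/p!$) under $(c_0,\dots,c_p)\mapsto-\sum_k c_k\beta^{\mathbf i}_k\in\mathfrak t^*_{\mathbb R}$, and let $\dot e_{\mathbf i}=\dot e_{i_1}\cdots\dot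 e_{i_p}\in U(\mathfrak n)$. For $f\in\mathbb C[N]$ put $D(f)=\sum_{\mathbf i}\langle\dot e_{\mathbf i},f\rangle D_{\mathbf i}$, where $\langle a,f\rangle=(a\cdot f)(1)$ and $\mathfrak n$ acts on $\mathbb C[N]$ by differentiating $(n\cdot f)(m)=f(mn)$. For a compactly supported complex measure $\mu$ on $\mathfrak t^*_{\mathbb R}$ put $FT(\mu)(x)=\int e^{\langle\beta,x\rangle}d\mu(\beta)$, $x\in\mathfrak t$. Let $$C=\{(x,b)\in\mathfrak t\times B\mid \mathrm{Ad}_b(x+\dot e)=x+\dot e\},$$ and consider the maps from $C$ to $\mathfrak t$, $T$ and $N$ sending $(x,b)$, with $b=tn$, $t\in T$, $n\in N$, to $x$, $t$ and $n$ respectively; denote the last one by $\psi$. For each $x\in\mathfrak t^{\mathrm{reg}}$ there is a unique $n_x\in N$ with $\mathrm{Ad}_{n_x}(x)=x+\dot e$, and the following hold. 1. For $(x,b)\in C$ with $x\in\mathfrak t^{\mathrm{reg}}$, the factorization $b=tn$ exists and is unique, and the map $(x,tn)\mapsto(x,t)$ is an isomorphism of varieties $C\times_{\mathfrak t}\mathfrak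 t^{\mathrm{reg}}\to\mathfrak t^{\mathrm{reg}}\times T$. 2. Under this isomorphism, $\psi$ becomes the map $\psi_{\mathrm{reg}}:\mathfrak t^{\mathrm{reg}}\times T\to N$, $(x,t)\mapsto t^{-1}n_xtn_x^{-1}$. 3. For every $f\in\mathbb C[N]$ the sum defining $D(f)$ has finitely many nonzero terms, and $FT(D(f))$ is given by a rational function on $\mathfrak t\times T$ in the following sense: there are $p\in\mathbb C[\mathfrak t\times T]$ and $s$ in the multiplicative subset of $\mathbb C[\mathfrak t]$ generated by $Q\setminus\{0\}$ with $s(x)\,FT(D(f))(x)=p(x,\exp x)$ for all $x\in\mathfrak t$ (each exponential $x\mapsto e^{\langle\beta,x\rangle}$, $\beta\in P$, is regarded as the function $t\mapsto t^\beta$ on $T$). Moreover $f\circ\psi_{\mathrm{reg}}\in\mathbb C[\mathfrak t^{\mathrm{reg}}\times T]$, and whenever $p\in\mathbb C[\mathfrak t\times T]$ and $0\neq s\in\mathbb C[\mathfrak t]$ satisfy $s(x)\,FT(D(f))(x)=p(x,\exp x)$ for all $x\in\mathfrak t$, one has $$p(x,t)=s(x)\,f(t^{-1}n_xtn_x^{-1})\qquad\text{for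 all }(x,t)\in\mathfrak t^{\mathrm{reg}}\times T.$$ That is, the rational function $FT\circ D(f)=p/s$ can be evaluated at every point $(x,t)$ of $\mathfrak t^{\mathrm{reg}}\times T$, its value there is $f(t^{-1}n_xtn_x^{-1})$, and $FT\circ D=\psi_{\mathrm{reg}}^*$. -/

import Mathlib

open scoped Matrix MatrixGroups

namespace LinAlgGroup

noncomputable section

/-! ### Linear algebraic groups over `ℂ`, as Zariski closed subgroups of `GL_n(ℂ)` -/

/-- The value at a matrix of a polynomial in the matrix entries. -/
def evalAt {n : ℕ} (A : Matrix (Fin n) (Fin n) ℂ) (p : MvPolynomial (Fin n × Fin n) ℂ) : ℂ :=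
  MvPolynomial.eval (fun ij => A ij.1 ij.2) p

/-- The polynomial `p` in the matrix entries vanishes on `H`. -/
def VanishesOn {n : ℕ} (p : MvPolynomial (Fin n × Fin n) ℂ) (H : Subgroup (GL (Fin n) ℂ)) : Prop :=
  ∀ h ∈ H, evalAt (h : Matrix (Fin n) (Fin n) ℂ) p = 0

/-- `H` is Zariski closed in `GL_n(ℂ)`. -/
def IsZariskiClosed {n : ℕ} (H : Subgroup (GL (Fin n) ℂ)) : Prop :=
  ∀ g : GL (Fin n) ℂ,
    (∀ p, VanishesOn p H → evalAt (g : Matrix (Fin n) (Fin n) ℂ) p = 0) → g ∈ H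

/-- Connectedness of a linear algebraic group: no proper closed subgroup of finite index. -/
def IsZariskiConnected {n : ℕ} (H : Subgroup (GL (Fin n) ℂ)) : Prop :=
  ∀ K : Subgroup (GL (Fin n) ℂ), IsZariskiClosed K → K ≤ H → K.relIndex H ≠ 0 → K = H

/-- The Lie algebra of `H`: the tangent space at the identity. -/
def lieAlg {n : ℕ} (H : Subgroup (GL (Fin n) ℂ)) : Submodule ℂ (Matrix (Fin n) (Fin n) ℂ) where
  carrier := {X | ∀ p, VanishesOn p H →
    ∑ ij : Fin n × Fin n, X ij.1 ij.2 * evalAt 1 (MvPolynomial.pderiv ij p) = 0}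
  zero_mem' := by intro p _; simp
  add_mem' := by
    intro X Y hX hY p hp
    have h1 := hX p hp
    have h2 := hY p hp
    simp only [Matrix.add_apply, add_mul, Finset.sum_add_distrib, h1, h2, add_zero]
  smul_mem' := by
    intro c X hX p hp
    have h1 := hX p hp
    simp only [Matrix.smul_apply, smul_eq_mul, mul_assoc, ← Finset.mul_sum, h1, mul_zero]

/-- The exponential of a matrix, as an element of `GL_n(ℂ)`. -/
def glExp {n : ℕ} (X : Matrix (Fin n) (Fin n) ℂ) : GL (Fin n) ℂ :=
  (Matrix.isUnit_exp X).unit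

theorem hasDerivAt_evalAt {n : ℕ} {γ : ℂ → Matrix (Fin n) (Fin n) ℂ}
    {γ' : Matrix (Fin n) (Fin n) ℂ} {s : ℂ}
    (hγ : ∀ i j, HasDerivAt (fun u => γ u i j) (γ' i j) s)
    (p : MvPolynomial (Fin n × Fin n) ℂ) :
    HasDerivAt (fun u : ℂ => evalAt (γ u) p)
      (∑ ij : Fin n × Fin n, γ' ij.1 ij.2 * evalAt (γ s) (MvPolynomial.pderiv ij p)) s := by
  induction p using MvPolynomial.induction_on with
  | C a => simpa [evalAt] using hasDerivAt_const s a
  | add p q hp hq =>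
    simp only [evalAt, map_add, mul_add, Finset.sum_add_distrib] at hp hq ⊢
    exact hp.add hq
  | mul_X p kl hp =>
    simp only [evalAt, map_mul, MvPolynomial.eval_X] at hp ⊢
    refine (hp.mul (hγ kl.1 kl.2)).congr_deriv ?_
    simp only [Derivation.leibniz, smul_eq_mul, MvPolynomial.pderiv_X, map_add, map_mul,
      MvPolynomial.eval_X, mul_add, Finset.sum_add_distrib, Finset.sum_mul]
    rw [add_comm]
    congr 1
    · rw [Finset.sum_eq_single kl]
      · simp [mul_comm]
      · intro b _ hb
        simp [hb.symm]
      · simp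
    · exact Finset.sum_congr rfl fun _ _ => by ring

/-- The left invariant vector field defined by the matrix `X`. -/
def leftInvField {n : ℕ} (X : Matrix (Fin n) (Fin n) ℂ) (p : MvPolynomial (Fin n × Fin n) ℂ) :
    MvPolynomial (Fin n × Fin n) ℂ :=
  ∑ ij : Fin n × Fin n, (∑ k, MvPolynomial.X (ij.1, k) * MvPolynomial.C (X k ij.2)) *
    MvPolynomial.pderiv ij p

theorem evalAt_leftInvField {n : ℕ} (A X : Matrix (Fin n) (Fin n) ℂ)
    (p : MvPolynomial (Fin n × Fin n) ℂ) :
    evalAt A (leftInvField X p) =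
      ∑ ij : Fin n × Fin n, (A * X) ij.1 ij.2 * evalAt A (MvPolynomial.pderiv ij p) := by
  simp [evalAt, leftInvField, Matrix.mul_apply]

theorem evalAt_bind₁_mul {n : ℕ} (M A : Matrix (Fin n) (Fin n) ℂ)
    (p : MvPolynomial (Fin n × Fin n) ℂ) :
    evalAt A (MvPolynomial.bind₁
      (fun ij => ∑ k, MvPolynomial.C (M ij.1 k) * MvPolynomial.X (k, ij.2)) p) =
      evalAt (M * A) p := by
  unfold evalAt
  induction p using MvPolynomial.induction_on with
  | C a => simp
  | add p q hp hq => rw [map_add, map_add, map_add, hp, hq]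
  | mul_X p kl hp =>
    rw [map_mul, map_mul, map_mul, hp, MvPolynomial.bind₁_X_right, MvPolynomial.eval_X]
    simp [Matrix.mul_apply]

theorem evalAt_leftInvField_eq {n : ℕ} (M X : Matrix (Fin n) (Fin n) ℂ)
    {p q : MvPolynomial (Fin n × Fin n) ℂ} (hq : ∀ A, evalAt A q = evalAt (M * A) p) :
    evalAt M (leftInvField X p) =
      ∑ ij : Fin n × Fin n, X ij.1 ij.2 * evalAt 1 (MvPolynomial.pderiv ij q) := by
  have h1 := hasDerivAt_evalAt (γ := fun u => 1 + u • X) (γ' := X) (s := 0)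
    (fun i j => by
      simpa using ((hasDerivAt_id (0 : ℂ)).mul_const (X i j)).const_add
        ((1 : Matrix (Fin n) (Fin n) ℂ) i j)) q
  have h2 := hasDerivAt_evalAt (γ := fun u => M + u • (M * X)) (γ' := M * X) (s := 0)
    (fun i j => by
      simpa using ((hasDerivAt_id (0 : ℂ)).mul_const ((M * X) i j)).const_add (M i j)) p
  have h3 : (fun u : ℂ => evalAt (1 + u • X) q) = fun u => evalAt (M + u • (M * X)) p := by
    funext u
    rw [hq, mul_add, mul_one, mul_smul_comm]
  rw [h3] at h1
  have h4 := h2.unique h1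
  rw [evalAt_leftInvField]
  simpa only [zero_smul, add_zero] using h4

theorem leftInvField_vanishesOn {n : ℕ} {H : Subgroup (GL (Fin n) ℂ)}
    {X : Matrix (Fin n) (Fin n) ℂ} (hX : X ∈ lieAlg H)
    {p : MvPolynomial (Fin n × Fin n) ℂ} (hp : VanishesOn p H) :
    VanishesOn (leftInvField X p) H := by
  intro h hh
  have hq := fun A => evalAt_bind₁_mul (h : Matrix (Fin n) (Fin n) ℂ) A p
  rw [evalAt_leftInvField_eq _ X hq]
  exact hX _ fun g hg => (hq _).trans (hp (h * g) (H.mul_mem hh hg))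

theorem hasDerivAt_evalAt_exp {n : ℕ} (X : Matrix (Fin n) (Fin n) ℂ)
    (p : MvPolynomial (Fin n × Fin n) ℂ) (s : ℂ) :
    HasDerivAt (fun u : ℂ => evalAt (NormedSpace.exp (u • X)) p)
      (evalAt (NormedSpace.exp (s • X)) (leftInvField X p)) s := by
  rw [evalAt_leftInvField]
  refine hasDerivAt_evalAt (γ := fun u : ℂ => NormedSpace.exp (u • X)) (fun i j => ?_) p
  let : NormedRing (Matrix (Fin n) (Fin n) ℂ) := Matrix.linftyOpNormedRing
  let : NormedAlgebra ℂ (Matrix (Fin n) (Fin n) ℂ) := Matrix.linftyOpNormedAlgebra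
  have h := hasDerivAt_exp_smul_const (𝕂 := ℂ) X s
  exact hasDerivAt_pi.1 (hasDerivAt_pi.1 h i) j

theorem glExp_mem {n : ℕ} {H : Subgroup (GL (Fin n) ℂ)} (hH : IsZariskiClosed H)
    {X : Matrix (Fin n) (Fin n) ℂ} (hX : X ∈ lieAlg H) : glExp X ∈ H := by
  refine hH _ fun p hp => ?_
  let F : ℂ → ℂ := fun u => evalAt (NormedSpace.exp (u • X)) p
  have hd : ∀ k, iteratedDeriv k F =
      fun u : ℂ => evalAt (NormedSpace.exp (u • X)) ((leftInvField X)^[k] p) := by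
    intro k
    induction k with
    | zero => simp [F]
    | succ k ih =>
      rw [iteratedDeriv_succ, ih]
      funext u
      rw [(hasDerivAt_evalAt_exp X _ u).deriv, Function.iterate_succ_apply']
  have hv : ∀ k, VanishesOn ((leftInvField X)^[k] p) H := by
    intro k
    induction k with
    | zero => exact hp
    | succ k ih =>
      rw [Function.iterate_succ_apply']
      exact leftInvField_vanishesOn hX ih
  have hdiff : Differentiable ℂ F := fun u => (hasDerivAt_evalAt_exp X p u).differentiableAt
  have h1 := Complex.taylorSeries_eq_of_entire' (c := 0) (z := 1) hdiff
  have h2 : ∀ k, iteratedDeriv k F 0 = 0 := by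
    intro k
    rw [hd]
    simpa using hv k 1 H.one_mem
  simp only [h2, mul_zero, zero_mul, tsum_zero] at h1
  simpa [F, glExp] using h1.symm

/-- The exponential map `Lie H → H` of a closed subgroup `H`. -/
def lieExp {n : ℕ} {H : Subgroup (GL (Fin n) ℂ)} (hH : IsZariskiClosed H) (X : lieAlg H) : H :=
  ⟨glExp (X : Matrix (Fin n) (Fin n) ℂ), glExp_mem hH X.2⟩

/-- The adjoint action of `GL_n(ℂ)` on matrices. -/
def Ad {n : ℕ} (g : GL (Fin n) ℂ) (X : Matrix (Fin n) (Fin n) ℂ) : Matrix (Fin n) (Fin n) ℂ :=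
  (g : Matrix (Fin n) (Fin n) ℂ) * X * ((g⁻¹ : GL (Fin n) ℂ) : Matrix (Fin n) (Fin n) ℂ)

/-- The centralizer `C_G(y) = {g ∈ G | Ad_g y = y}`. -/
def centralizerIn {n : ℕ} (G : Subgroup (GL (Fin n) ℂ)) (y : Matrix (Fin n) (Fin n) ℂ) :
    Subgroup (GL (Fin n) ℂ) where
  carrier := {g | g ∈ G ∧ Ad g y = y}
  one_mem' := ⟨G.one_mem, by simp [Ad]⟩
  mul_mem' := by
    rintro a b ⟨ha, ha'⟩ ⟨hb, hb'⟩
    refine ⟨G.mul_mem ha hb, ?_⟩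
    have h : Ad (a * b) y = Ad a (Ad b y) := by
      simp only [Ad, mul_inv_rev, Units.val_mul, mul_assoc]
    rw [h, hb', ha']
  inv_mem' := by
    rintro a ⟨ha, ha'⟩
    refine ⟨G.inv_mem ha, ?_⟩
    have h : Ad a⁻¹ (Ad a y) = y := by
      simp only [Ad, inv_inv, mul_assoc, Units.inv_mul, mul_one, Units.inv_mul_cancel_left]
    rwa [ha'] at h

/-- The dimension of a linear algebraic group over `ℂ`. Such a group is smooth, so this is the
dimension of its tangent space at the identity. -/
def dimension {n : ℕ} (H : Subgroup (GL (Fin n) ℂ)) : ℕ := Module.finrank ℂ (lieAlg H)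

/-- A simple linear algebraic group: closed, connected, not commutative, with no closed connected
normal subgroup besides `1` and `G`. -/
structure IsSimpleAlgebraicGroup {n : ℕ} (G : Subgroup (GL (Fin n) ℂ)) : Prop where
  closed : IsZariskiClosed G
  connected : IsZariskiConnected G
  noncomm : ∃ g ∈ G, ∃ h ∈ G, g * h ≠ h * g
  simple : ∀ K : Subgroup (GL (Fin n) ℂ), K ≤ G → IsZariskiClosed K → IsZariskiConnected K →
    (K.subgroupOf G).Normal → K = ⊥ ∨ K = G

/-- A closed connected solvable subgroup of `G`. -/
structure IsConnectedSolvable {n : ℕ} (B G : Subgroup (GL (Fin n) ℂ)) : Prop where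
  le : B ≤ G
  closed : IsZariskiClosed B
  connected : IsZariskiConnected B
  solvable : Group.IsSolvable B

/-- A Borel subgroup of `G`: a maximal closed connected solvable subgroup. -/
structure IsBorel {n : ℕ} (B G : Subgroup (GL (Fin n) ℂ)) : Prop
    extends IsConnectedSolvable B G where
  maximal : ∀ K : Subgroup (GL (Fin n) ℂ), IsConnectedSolvable K G → B ≤ K → K = B

/-- An algebraic torus: closed, connected and diagonalizable. -/
structure IsTorus {n : ℕ} (T : Subgroup (GL (Fin n) ℂ)) : Prop where
  closed : IsZariskiClosed T
  connected : IsZariskiConnected T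
  diagonalizable : ∃ P : GL (Fin n) ℂ, ∀ t ∈ T, (Ad P (t : Matrix (Fin n) (Fin n) ℂ)).IsDiag

/-- A maximal torus of `B`. -/
structure IsMaximalTorus {n : ℕ} (T B : Subgroup (GL (Fin n) ℂ)) : Prop extends IsTorus T where
  le : T ≤ B
  maximal : ∀ K : Subgroup (GL (Fin n) ℂ), IsTorus K → K ≤ B → T ≤ K → K = T

/-- A closed connected normal subgroup of `B` that consists of unipotent matrices. -/
structure IsNormalUnipotent {n : ℕ} (N B : Subgroup (GL (Fin n) ℂ)) : Prop where
  le : N ≤ B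
  closed : IsZariskiClosed N
  connected : IsZariskiConnected N
  normal : (N.subgroupOf B).Normal
  unipotent : ∀ g ∈ N, IsNilpotent ((g : Matrix (Fin n) (Fin n) ℂ) - 1)

/-- The unipotent radical of `B`: the largest closed connected normal unipotent subgroup. -/
structure IsUnipotentRadical {n : ℕ} (N B : Subgroup (GL (Fin n) ℂ)) : Prop
    extends IsNormalUnipotent N B where
  largest : ∀ K : Subgroup (GL (Fin n) ℂ), IsNormalUnipotent K B → K ≤ N

/-! ### Regular functions -/

/-- The algebra `ℂ[H]` of regular functions on a closed subgroup `H` of `GL_n(ℂ)`. -/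
def coordRing {n : ℕ} (H : Subgroup (GL (Fin n) ℂ)) : Subalgebra ℂ (H → ℂ) :=
  Algebra.adjoin ℂ
    {F | ∃ i j, F = (fun h : H => ((h : GL (Fin n) ℂ) : Matrix (Fin n) (Fin n) ℂ) i j) ∨
      F = (fun h : H => (((h⁻¹ : H) : GL (Fin n) ℂ) : Matrix (Fin n) (Fin n) ℂ) i j)}

/-- The algebra `ℂ[V]` of polynomial functions on a vector space `V`. -/
def polyRing (V : Type*) [AddCommGroup V] [Module ℂ V] : Subalgebra ℂ (V → ℂ) :=
  Algebra.adjoin ℂ {F | ∃ φ : Module.Dual ℂ V, F = φ}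

/-- The algebra `ℂ[V × H] = ℂ[V] ⊗ ℂ[H]`. -/
def prodRing (V : Type*) [AddCommGroup V] [Module ℂ V] {n : ℕ} (H : Subgroup (GL (Fin n) ℂ)) :
    Subalgebra ℂ (V × H → ℂ) :=
  Algebra.adjoin ℂ ({F | ∃ p ∈ polyRing V, F = fun z => p z.1} ∪
    {F | ∃ q ∈ coordRing H, F = fun z => q z.2})

/-- Let `U` be a Zariski open subset of the vector space `V`, so that
`ℂ[U] = {p / q | p, q ∈ ℂ[V], q without zero on U}`, and let `Y` be a closed subvariety of `U × H`,
with projections `a : Y → U ⊆ V` and `b : Y → H`. This is the algebra `ℂ[Y]` of regular functions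
on `Y`, namely the image of `ℂ[U] ⊗ ℂ[H]`. -/
def regularRing {V : Type*} [AddCommGroup V] [Module ℂ V] (U : Set V) {n : ℕ}
    {H : Subgroup (GL (Fin n) ℂ)} {Y : Type*} (a : Y → V) (b : Y → H) : Subalgebra ℂ (Y → ℂ) :=
  Algebra.adjoin ℂ ({F | ∃ p ∈ polyRing V, F = fun y => p (a y)} ∪
    {F | ∃ q ∈ polyRing V, (∀ u ∈ U, q u ≠ 0) ∧ F = fun y => (q (a y))⁻¹} ∪
    {F | ∃ q ∈ coordRing H, F = fun y => q (b y)})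

/-! ### Weights and roots -/

/-- The function `t ↦ χ(t)` on `T` attached to a homomorphism `χ : T → ℂˣ`. -/
def charFun {n : ℕ} {T : Subgroup (GL (Fin n) ℂ)} (χ : T →* ℂˣ) : T → ℂ := fun t => (χ t : ℂ)

/-- The pull back of a regular function by the inversion of the group is regular. -/
theorem comp_inv_mem_coordRing {n : ℕ} {H : Subgroup (GL (Fin n) ℂ)} {F : H → ℂ}
    (hF : F ∈ coordRing H) : (fun h => F h⁻¹) ∈ coordRing H := by
  induction hF using Algebra.adjoin_induction with
  | mem F hF =>
    obtain ⟨i, j, rfl | rfl⟩ := hF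
    · exact Algebra.subset_adjoin ⟨i, j, Or.inr rfl⟩
    · exact Algebra.subset_adjoin ⟨i, j, Or.inl (by simp)⟩
  | algebraMap r => exact (coordRing H).algebraMap_mem r
  | add F G _ _ hF hG => exact add_mem hF hG
  | mul F G _ _ hF hG => exact mul_mem hF hG

/-- The character lattice `P` of `T` (the group law is written multiplicatively). -/
def weightLattice {n : ℕ} (T : Subgroup (GL (Fin n) ℂ)) : Subgroup (T →* ℂˣ) where
  carrier := {χ | charFun χ ∈ coordRing T}
  one_mem' := by
    have h : charFun (1 : T →* ℂˣ) = 1 := by funext t; simp [charFun]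
    change charFun (1 : T →* ℂˣ) ∈ coordRing T
    rw [h]
    exact one_mem _
  mul_mem' := by
    intro χ η hχ hη
    have h : charFun (χ * η) = charFun χ * charFun η := by funext t; simp [charFun]
    change charFun (χ * η) ∈ coordRing T
    rw [h]
    exact mul_mem hχ hη
  inv_mem' := by
    intro χ hχ
    have h : charFun χ⁻¹ = fun t => charFun χ t⁻¹ := by funext t; simp [charFun]
    change charFun χ⁻¹ ∈ coordRing T
    rw [h]
    exact comp_inv_mem_coordRing hχ

/-- The differential of a weight `χ ∈ P`, as a function `x ↦ ⟨χ, x⟩` on `Lie T`. -/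
def differential {n : ℕ} {T : Subgroup (GL (Fin n) ℂ)} (hT : IsZariskiClosed T)
    (χ : weightLattice T) : lieAlg T → ℂ :=
  fun x => deriv (fun s : ℂ => charFun (χ : T →* ℂˣ) (lieExp hT (s • x))) 0

/-- `X` is a root vector (a nonzero weight vector) of weight `χ` for the adjoint action of `T`. -/
def IsRootVector {n : ℕ} {T : Subgroup (GL (Fin n) ℂ)} (χ : weightLattice T)
    (X : Matrix (Fin n) (Fin n) ℂ) : Prop :=
  X ≠ 0 ∧ ∀ t : T, Ad (t : GL (Fin n) ℂ) X = ((χ : T →* ℂˣ) t : ℂ) • X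

/-- `(α_i)` is the family of simple roots attached to `T` and `N`: with the positive roots being the
weights of `T` on `Lie N`, the `α_i` are positive roots, they are linearly independent, and each
positive root is a combination of them with coefficients in `ℕ`. -/
structure IsSimpleSystem {n : ℕ} (T N : Subgroup (GL (Fin n) ℂ)) {I : Type*} [Fintype I]
    (α : I → weightLattice T) : Prop where
  root : ∀ i, ∃ X ∈ lieAlg N, IsRootVector (α i) X
  indep : ∀ m : I → ℤ, ∏ i, α i ^ m i = 1 → m = 0
  generate : ∀ χ : weightLattice T, (∃ X ∈ lieAlg N, IsRootVector χ X) →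
    ∃ m : I → ℕ, χ = ∏ i, α i ^ m i

/-- The set of regular elements of `Lie T`; an element `y` of `Lie G` is regular if
`dim C_G(y)` is the rank of `G`, that is, the dimension of `T`. -/
def regularSet {n : ℕ} (G T : Subgroup (GL (Fin n) ℂ)) : Set (lieAlg T) :=
  {x | dimension (centralizerIn G (x : Matrix (Fin n) (Fin n) ℂ)) = dimension T}

/-- The real form `𝔱_ℝ^* = P ⊗ ℝ` of the dual of `𝔱 = Lie T`: the real span of the
(differentials of the) weights, in the space of functions on `𝔱`. -/
def realDual {n : ℕ} {T : Subgroup (GL (Fin n) ℂ)} (hT : IsZariskiClosed T) :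
    Submodule ℝ (lieAlg T → ℂ) :=
  Submodule.span ℝ (Set.range (differential hT))

/-- A weight, as an element of `𝔱_ℝ^*`. -/
def weightVec {n : ℕ} {T : Subgroup (GL (Fin n) ℂ)} (hT : IsZariskiClosed T)
    (χ : weightLattice T) : realDual hT :=
  ⟨differential hT χ, Submodule.subset_span ⟨χ, rfl⟩⟩

/-- The multiplicative set in `ℂ[𝔱]` generated by the nonzero elements of the root lattice `Q`. -/
def rootDenominators {n : ℕ} {T : Subgroup (GL (Fin n) ℂ)} (hT : IsZariskiClosed T)
    {I : Type*} [Fintype I] (α : I → weightLattice T) : Submonoid (lieAlg T → ℂ) :=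
  Submonoid.closure {F | ∃ m : I → ℤ, m ≠ 0 ∧ F = ∑ i, m i • differential hT (α i)}

/-! ### The pairing of `U(𝔫)` and `ℂ[N]` -/

/-- The action `f ↦ X · f` of `X ∈ Lie N` on functions on `N`, obtained by differentiating
`n · f = f(? n)`. -/
def lieAct {n : ℕ} {N : Subgroup (GL (Fin n) ℂ)} (hN : IsZariskiClosed N) (X : lieAlg N)
    (f : N → ℂ) : N → ℂ :=
  fun g => deriv (fun s : ℂ => f (g * lieExp hN (s • X))) 0

/-- The pairing `⟨e_{i_1} ⋯ e_{i_p}, f⟩ = (e_{i_1} · (⋯ · (e_{i_p} · f)))(1)` of a monomial in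
`U(Lie N)` with a function `f`. -/
def monomialPairing {n : ℕ} {N : Subgroup (GL (Fin n) ℂ)} (hN : IsZariskiClosed N) {I : Type*}
    (e : I → lieAlg N) (l : List I) (f : N → ℂ) : ℂ :=
  l.foldr (fun i F => lieAct hN (e i) F) f 1

/-! ### The measures `D_𝐢`, the map `D` and the Fourier transform -/

/-- The points `(c_1, …, c_p)` such that `(1 - ∑ c_k, c_1, …, c_p)` is in the standard simplex. -/
def cornerSimplex (p : ℕ) : Set (Fin p → ℝ) := {c | (∀ k, 0 ≤ c k) ∧ ∑ k, c k ≤ 1}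

/-- Lebesgue measure on the standard `p`-simplex
`{(c_0, …, c_p) | c_k ≥ 0, c_0 + ⋯ + c_p = 1}`, normalized to have total mass `1 / p!`. -/
def simplexMeasure (p : ℕ) : MeasureTheory.Measure (Fin (p + 1) → ℝ) :=
  (MeasureTheory.volume.restrict (cornerSimplex p)).map
    (fun c : Fin p → ℝ => (Fin.cons (1 - ∑ k, c k) c : Fin (p + 1) → ℝ))

instance (p : ℕ) : MeasureTheory.IsFiniteMeasure (simplexMeasure p) := by
  have h : MeasureTheory.volume (cornerSimplex p) < ⊤ := by
    refine lt_of_le_of_lt (MeasureTheory.measure_mono (t := Set.Icc 0 1) ?_)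
      isCompact_Icc.measure_lt_top
    rintro c ⟨h0, h1⟩
    exact ⟨h0, fun k => (Finset.single_le_sum (fun i _ => h0 i) (Finset.mem_univ k)).trans h1⟩
  have : Fact (MeasureTheory.volume (cornerSimplex p) < ⊤) := ⟨h⟩
  unfold simplexMeasure
  infer_instance

/-- `β_k = α_{i_1} + ⋯ + α_{i_k}` for a sequence `(i_1, …, i_p)` and `0 ≤ k ≤ p`. -/
def partialSum {n : ℕ} {T : Subgroup (GL (Fin n) ℂ)} (hT : IsZariskiClosed T) {I : Type*}
    (α : I → weightLattice T) (l : List I) (k : ℕ) : realDual hT :=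
  ((l.take k).map (fun i => weightVec hT (α i))).sum

/-- The linear map `(c_0, …, c_p) ↦ - ∑ c_k β_k`. -/
def simplexMap {n : ℕ} {T : Subgroup (GL (Fin n) ℂ)} (hT : IsZariskiClosed T) {I : Type*}
    (α : I → weightLattice T) (l : List I) (c : Fin (l.length + 1) → ℝ) : realDual hT :=
  -∑ k, c k • partialSum hT α l k

/-- The measure `D_𝐢` on `𝔱_ℝ^*` attached to a sequence `𝐢`. -/
def seqMeasure {n : ℕ} {T : Subgroup (GL (Fin n) ℂ)} (hT : IsZariskiClosed T) {I : Type*}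
    (α : I → weightLattice T) (l : List I) : MeasureTheory.Measure (realDual hT) :=
  (simplexMeasure l.length).map (simplexMap hT α l)

instance {n : ℕ} {T : Subgroup (GL (Fin n) ℂ)} (hT : IsZariskiClosed T) {I : Type*}
    (α : I → weightLattice T) (l : List I) : MeasureTheory.IsFiniteMeasure (seqMeasure hT α l) := by
  unfold seqMeasure
  infer_instance

/-- `D(f) = ∑_𝐢 ⟨e_𝐢, f⟩ D_𝐢`, a complex measure on `𝔱_ℝ^*`. -/
def measD {n : ℕ} {T N : Subgroup (GL (Fin n) ℂ)} (hT : IsZariskiClosed T)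
    (hN : IsZariskiClosed N) {I : Type*} (α : I → weightLattice T) (e : I → lieAlg N)
    (f : N → ℂ) : MeasureTheory.ComplexMeasure (realDual hT) :=
  ∑ᶠ l : List I, monomialPairing hN e l f • (seqMeasure hT α l).toSignedMeasure.toComplexMeasure 0

/-- The Fourier transform `x ↦ ∫ e^{⟨β, x⟩} dμ(β)` of a complex measure on `𝔱_ℝ^*`. -/
def measFourier {n : ℕ} {T : Subgroup (GL (Fin n) ℂ)} {hT : IsZariskiClosed T}
    (μ : MeasureTheory.ComplexMeasure (realDual hT)) (x : lieAlg T) : ℂ :=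
  μ.integral (fun β : realDual hT => Complex.exp ((β : lieAlg T → ℂ) x))
    (ContinuousLinearMap.mul ℝ ℂ)

/-- The function `Φ` on `𝔱`, a combination of exponentials of weights with rational coefficients,
is given by the rational function `p / s` on `𝔱 × T` (where `p ∈ ℂ[𝔱 × T]` and `s ∈ ℂ[𝔱]`) if each
exponential `x ↦ e^{⟨β, x⟩}` is regarded as the regular function `t ↦ t^β` on `T`. Since
`e^{⟨β, x⟩}` is the value of this function at `t = exp x`, this means `Φ(x) = p(x, exp x) / s(x)`. -/
def IsRationalForm {n : ℕ} {T : Subgroup (GL (Fin n) ℂ)} (hT : IsZariskiClosed T)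
    (Φ : lieAlg T → ℂ) (s : lieAlg T → ℂ) (p : lieAlg T × T → ℂ) : Prop :=
  s ∈ polyRing (lieAlg T) ∧ s ≠ 0 ∧ p ∈ prodRing (lieAlg T) T ∧ ∀ x, s x * Φ x = p (x, lieExp hT x)

/-! ### The universal centralizer -/

/-- The universal centralizer space over the subset `U` of `𝔱`:
`{(x, b) ∈ U × B | b ∈ C_G(x + e)}`. For `U = 𝔱` it is the universal centralizer space `C`, and for
`U = 𝔱^reg` it is `C ×_𝔱 𝔱^reg`. -/
def univCentralizer {n : ℕ} (G B T : Subgroup (GL (Fin n) ℂ)) (e : Matrix (Fin n) (Fin n) ℂ)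
    (U : Set (lieAlg T)) : Set (lieAlg T × B) :=
  {z | z.1 ∈ U ∧
    (z.2 : GL (Fin n) ℂ) ∈ centralizerIn G ((z.1 : Matrix (Fin n) (Fin n) ℂ) + e)}

/-- The algebra `ℂ[𝔱^reg × T]`. -/
def regTorusRing {n : ℕ} (G T : Subgroup (GL (Fin n) ℂ)) :
    Subalgebra ℂ (regularSet G T × T → ℂ) :=
  regularRing (regularSet G T) (fun y => (y.1 : lieAlg T)) (fun y => y.2)

/-- The algebra of regular functions on `C ×_𝔱 𝔱^reg`, a closed subvariety of `𝔱^reg × B`. -/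
def regCentralizerRing {n : ℕ} (G B T : Subgroup (GL (Fin n) ℂ)) (e : Matrix (Fin n) (Fin n) ℂ) :
    Subalgebra ℂ (univCentralizer G B T e (regularSet G T) → ℂ) :=
  regularRing (regularSet G T) (fun z => z.1.1) (fun z => z.1.2)

/-- The map `C ×_𝔱 𝔱^reg → 𝔱^reg × T` with components `(x, b) ↦ x` and a given `τ`. -/
def toRegTorus {n : ℕ} {G B T : Subgroup (GL (Fin n) ℂ)} {e : Matrix (Fin n) (Fin n) ℂ}
    (τ : univCentralizer G B T e (regularSet G T) → T)
    (z : univCentralizer G B T e (regularSet G T)) : regularSet G T × T :=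
  (⟨z.1.1, z.2.1⟩, τ z)

end

end LinAlgGroup

open LinAlgGroup

open LinAlgGroup
open scoped Matrix MatrixGroups

namespace LinAlgGroup

open MvPolynomial Filter Topology

/-! ### Lie algebras of closed subgroups -/

/-! The argument takes place in a basis, given by a matrix `P`, in which B is upper triangular, T is
diagonal and N is the unitriangular part of B. Lie's theorem, with a basis adapted to the
diagonalizable algebra Lie T, produces `P` for Lie algebras. It passes to groups because a connected
closed group has no proper closed subgroup with the same Lie algebra (`eq_of_lieAlg_le`): leading
forms at the identity and Krull's intersection theorem show that a closed subgroup with full Lie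
algebra has finite index.

For regular x, Lie C_G(x) equals Lie T by dimension. Hence ad x is injective on Lie N, since an
element of the kernel is both diagonal and strictly triangular, and δ(x) = det(ad x | Lie N) is
nonzero. The element n_x is found by successive approximation along the superdiagonals, each step
solving [x, Z] = E by Cramer's rule, so its entries are polynomial in x and 1/δ(x). It is unique
because the logarithm of a unipotent element of N that fixes x lies in the kernel of ad x on Lie N.
The same injectivity gives Lie B = Lie T + Lie N, hence B = TN and C_B(x) = T. Conjugation by n_x
carries C_B(x) to C_B(x + e), so the elements of the latter are b = n_x t n_x⁻¹ = t · (t⁻¹ n_x t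
n_x⁻¹). This gives both the isomorphism (1) and the formula (2).

For (3), the curve u(s) = exp(-sx) exp(s(x + e)) satisfies u(0) = 1 and u' = (∑ e^{-s α_i(x)} e_i)
u. Repeated integration expands f(u(1)) as the sum over sequences 𝐢 of ⟨e_𝐢, f⟩ times an iterated
integral of exponentials (`evalAt_eq_sum_iterInt`); the sum is finite because N is unipotent. A
shear of the simplex identifies the iterated integral with FT(D_𝐢)(x) (`integral_scaledSimplex`). If
δ(x) ≠ 0, then exp(x + e) = n_x exp(x) n_x⁻¹, so FT(D(f))(x) is the value of f at t⁻¹ n_x t n_x⁻¹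
for t = exp x.

The integrations divide only by nonzero combinations of simple roots with coefficients in ℕ, which
yields a rational form with the required denominator. Its value is forced: a regular function on 𝔱 ×
T that vanishes on the graph of exp is zero (`eq_zero_of_graph_eq_zero`), since distinct weights
have distinct differentials and exponential polynomials with distinct frequencies are independent.
So every rational form agrees with f ∘ ψ on {δ ≠ 0} × T, which contains 𝔱^reg × T. -/

theorem glExp_coe {n : ℕ} (X : Matrix (Fin n) (Fin n) ℂ) :
    ((glExp X : GL (Fin n) ℂ) : Matrix (Fin n) (Fin n) ℂ) = NormedSpace.exp X := rfl

theorem glExp_zero {n : ℕ} : glExp (0 : Matrix (Fin n) (Fin n) ℂ) = 1 := by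
  ext1; simp [glExp_coe]

theorem glExp_add {n : ℕ} {X Y : Matrix (Fin n) (Fin n) ℂ} (h : Commute X Y) :
    glExp (X + Y) = glExp X * glExp Y := by
  ext1; simp [glExp_coe, Matrix.exp_add_of_commute X Y h]

theorem glExp_neg {n : ℕ} (X : Matrix (Fin n) (Fin n) ℂ) : glExp (-X) = (glExp X)⁻¹ := by
  rw [eq_inv_iff_mul_eq_one, ← glExp_add (Commute.neg_left (Commute.refl X)), neg_add_cancel,
    glExp_zero]

theorem Ad_mul {n : ℕ} (a b : GL (Fin n) ℂ) (y : Matrix (Fin n) (Fin n) ℂ) :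
    Ad (a * b) y = Ad a (Ad b y) := by
  simp only [Ad, mul_inv_rev, Units.val_mul, mul_assoc]

theorem Ad_one {n : ℕ} (y : Matrix (Fin n) (Fin n) ℂ) : Ad 1 y = y := by simp [Ad]

theorem Ad_add {n : ℕ} (a : GL (Fin n) ℂ) (y z : Matrix (Fin n) (Fin n) ℂ) :
    Ad a (y + z) = Ad a y + Ad a z := by simp [Ad, mul_add, add_mul]

theorem Ad_sub {n : ℕ} (a : GL (Fin n) ℂ) (y z : Matrix (Fin n) (Fin n) ℂ) :
    Ad a (y - z) = Ad a y - Ad a z := by simp [Ad, mul_sub, sub_mul]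

theorem Ad_smul {n : ℕ} (a : GL (Fin n) ℂ) (c : ℂ) (y : Matrix (Fin n) (Fin n) ℂ) :
    Ad a (c • y) = c • Ad a y := by simp [Ad]

theorem Ad_matmul {n : ℕ} (a : GL (Fin n) ℂ) (y z : Matrix (Fin n) (Fin n) ℂ) :
    Ad a (y * z) = Ad a y * Ad a z := by
  simp only [Ad, mul_assoc, Units.inv_mul_cancel_left]

theorem Ad_inv_eq {n : ℕ} {a : GL (Fin n) ℂ} {y z : Matrix (Fin n) (Fin n) ℂ} :
    Ad a⁻¹ y = z ↔ y = Ad a z := by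
  constructor
  · rintro rfl; rw [← Ad_mul, mul_inv_cancel, Ad_one]
  · rintro rfl; rw [← Ad_mul, inv_mul_cancel, Ad_one]

theorem Ad_coe {n : ℕ} (a b : GL (Fin n) ℂ) :
    Ad a (b : Matrix (Fin n) (Fin n) ℂ) = ((a * b * a⁻¹ : GL (Fin n) ℂ) : Matrix _ _ ℂ) := by
  simp [Ad]

theorem Ad_eq_self_iff {n : ℕ} (a : GL (Fin n) ℂ) (y : Matrix (Fin n) (Fin n) ℂ) :
    Ad a y = y ↔ (a : Matrix (Fin n) (Fin n) ℂ) * y = y * a := by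
  constructor
  · intro h
    have := congrArg (fun z => z * (a : Matrix (Fin n) (Fin n) ℂ)) h
    simpa [Ad, mul_assoc] using this
  · intro h
    rw [Ad, h, mul_assoc, Units.mul_inv, mul_one]

theorem glExp_Ad {n : ℕ} (a : GL (Fin n) ℂ) (y : Matrix (Fin n) (Fin n) ℂ) :
    glExp (Ad a y) = a * glExp y * a⁻¹ := by
  ext1
  simpa [glExp_coe, Ad] using Matrix.exp_units_conj a y

theorem hasDerivAt_exp_smul_apply {n : ℕ} (X : Matrix (Fin n) (Fin n) ℂ) (s : ℂ) (i j : Fin n) :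
    HasDerivAt (fun u : ℂ => NormedSpace.exp (u • X) i j) ((NormedSpace.exp (s • X) * X) i j) s := by
  let : NormedRing (Matrix (Fin n) (Fin n) ℂ) := Matrix.linftyOpNormedRing
  let : NormedAlgebra ℂ (Matrix (Fin n) (Fin n) ℂ) := Matrix.linftyOpNormedAlgebra
  have h := hasDerivAt_exp_smul_const (𝕂 := ℂ) X s
  exact hasDerivAt_pi.1 (hasDerivAt_pi.1 h i) j

theorem hasDerivAt_matrix_mul {n : ℕ} {γ η : ℂ → Matrix (Fin n) (Fin n) ℂ}
    {γ' η' : Matrix (Fin n) (Fin n) ℂ} {s : ℂ}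
    (hγ : ∀ i j, HasDerivAt (fun u => γ u i j) (γ' i j) s)
    (hη : ∀ i j, HasDerivAt (fun u => η u i j) (η' i j) s) (i j : Fin n) :
    HasDerivAt (fun u => (γ u * η u) i j) ((γ' * η s + γ s * η') i j) s := by
  simp only [Matrix.mul_apply, Matrix.add_apply, ← Finset.sum_add_distrib]
  exact HasDerivAt.fun_sum fun k _ => (hγ i k).mul (hη k j)

/-- The polynomial ℓ - c vanishes on H, and its differential is ℓ. This is how linear conditions on
a group (triangular, diagonal, unitriangular) pass to its Lie algebra. -/
theorem vanishing_linear_of_mem_lieAlg {n : ℕ} {H : Subgroup (GL (Fin n) ℂ)}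
    {X : Matrix (Fin n) (Fin n) ℂ} (hX : X ∈ lieAlg H)
    (ℓ : Matrix (Fin n) (Fin n) ℂ →ₗ[ℂ] ℂ) (c : ℂ)
    (hℓ : ∀ h ∈ H, ℓ ((h : GL (Fin n) ℂ) : Matrix (Fin n) (Fin n) ℂ) = c) : ℓ X = 0 := by
  have key : ∀ A : Matrix (Fin n) (Fin n) ℂ,
      ℓ A = ∑ ij : Fin n × Fin n, A ij.1 ij.2 * ℓ (Matrix.single ij.1 ij.2 1) := by
    intro A
    conv_lhs => rw [Matrix.matrix_eq_sum_single A]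
    simp only [map_sum, Fintype.sum_prod_type]
    refine Finset.sum_congr rfl fun i _ => Finset.sum_congr rfl fun j _ => ?_
    rw [← smul_eq_mul, ← map_smul, Matrix.smul_single, smul_eq_mul, mul_one]
  let p : MvPolynomial (Fin n × Fin n) ℂ :=
    ∑ ij : Fin n × Fin n, C (ℓ (Matrix.single ij.1 ij.2 1)) * MvPolynomial.X ij - C c
  have hp : VanishesOn p H := by
    intro h hh
    have := hℓ h hh
    rw [key] at this
    simp only [evalAt, p, map_sub, map_sum, map_mul, eval_C, eval_X, ← this]
    rw [sub_eq_zero]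
    exact Finset.sum_congr rfl fun _ _ => mul_comm _ _
  rw [key, ← hX p hp]
  refine Finset.sum_congr rfl fun ij _ => ?_
  congr 1
  simp only [p, evalAt, map_sub, map_sum, pderiv_C, sub_zero, pderiv_C_mul, pderiv_X,
    map_mul, eval_C]
  rw [Finset.sum_eq_single ij]
  · simp
  · intro b _ hb
    simp [hb]
  · simp

/-- Differentiate p(exp(sX)) = 0 at s = 0. Closedness of H is needed only for the converse, so this
direction also applies to groups not known to be closed. -/
theorem mem_lieAlg_of_glExp_mem {n : ℕ} {H : Subgroup (GL (Fin n) ℂ)}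
    {X : Matrix (Fin n) (Fin n) ℂ} (h : ∀ s : ℂ, glExp (s • X) ∈ H) : X ∈ lieAlg H := by
  intro p hp
  have h1 := hasDerivAt_evalAt_exp X p 0
  have h2 : (fun u : ℂ => evalAt (NormedSpace.exp (u • X)) p) = fun _ => 0 := by
    funext u
    have := hp _ (h u)
    rwa [glExp_coe] at this
  rw [h2] at h1
  have := h1.unique (hasDerivAt_const _ _)
  rw [evalAt_leftInvField] at this
  simpa using this

theorem mem_lieAlg_iff {n : ℕ} {H : Subgroup (GL (Fin n) ℂ)} (hH : IsZariskiClosed H)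
    {X : Matrix (Fin n) (Fin n) ℂ} : X ∈ lieAlg H ↔ ∀ s : ℂ, glExp (s • X) ∈ H :=
  ⟨fun h s => glExp_mem hH ((lieAlg H).smul_mem s h), mem_lieAlg_of_glExp_mem⟩

theorem lieAlg_mono {n : ℕ} {H K : Subgroup (GL (Fin n) ℂ)} (h : H ≤ K) : lieAlg H ≤ lieAlg K :=
  fun _ hX p hp => hX p fun g hg => hp g (h hg)

theorem Ad_mem_lieAlg {n : ℕ} {H : Subgroup (GL (Fin n) ℂ)} (hH : IsZariskiClosed H)
    {g : GL (Fin n) ℂ} (hg : ∀ h ∈ H, g * h * g⁻¹ ∈ H) {X : Matrix (Fin n) (Fin n) ℂ}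
    (hX : X ∈ lieAlg H) : Ad g X ∈ lieAlg H := by
  rw [mem_lieAlg_iff hH] at hX ⊢
  intro s
  rw [← Ad_smul, glExp_Ad]
  exact hg _ (hX s)

/-- Otherwise a linear form that kills W, but not the velocity, would be constant along the curve
with nonzero derivative. -/
theorem mem_of_derivative {n : ℕ} (W : Submodule ℂ (Matrix (Fin n) (Fin n) ℂ))
    {γ : ℂ → Matrix (Fin n) (Fin n) ℂ} {γ' : Matrix (Fin n) (Fin n) ℂ} {s : ℂ}
    (hγ : ∀ i j, HasDerivAt (fun u => γ u i j) (γ' i j) s) (h : ∀ u, γ u ∈ W) : γ' ∈ W := by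
  by_contra hcon
  obtain ⟨ℓ, hℓ, hℓW⟩ := Submodule.exists_le_ker_of_notMem hcon
  have h1 : HasDerivAt (fun u => ℓ (γ u)) (ℓ γ') s := by
    have key : ∀ A : Matrix (Fin n) (Fin n) ℂ,
        ℓ A = ∑ i, ∑ j, A i j * ℓ (Matrix.single i j 1) := by
      intro A
      conv_lhs => rw [Matrix.matrix_eq_sum_single A]
      simp only [map_sum]
      refine Finset.sum_congr rfl fun i _ => Finset.sum_congr rfl fun j _ => ?_
      rw [← smul_eq_mul, ← map_smul, Matrix.smul_single, smul_eq_mul, mul_one]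
    have key' : (fun u => ℓ (γ u)) = fun u => ∑ i, ∑ j, γ u i j * ℓ (Matrix.single i j 1) :=
      funext fun u => key _
    rw [key', key γ']
    exact HasDerivAt.fun_sum fun i _ => HasDerivAt.fun_sum fun j _ => (hγ i j).mul_const _
  have h2 : (fun u => ℓ (γ u)) = fun _ => 0 := by
    funext u; exact hℓW (h u)
  rw [h2] at h1
  exact hℓ (h1.unique (hasDerivAt_const _ _))

theorem hasDerivAt_Ad_exp {n : ℕ} (X Y : Matrix (Fin n) (Fin n) ℂ) (i j : Fin n) :
    HasDerivAt (fun u : ℂ => Ad (glExp (u • X)) Y i j) ((X * Y - Y * X) i j) 0 := by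
  have h1 : ∀ i j, HasDerivAt (fun u : ℂ => (NormedSpace.exp (u • X) * Y) i j) ((X * Y) i j) 0 := by
    intro i j
    have := hasDerivAt_matrix_mul (η' := 0) (hasDerivAt_exp_smul_apply X 0)
      (fun i j => hasDerivAt_const (0 : ℂ) (Y i j)) i j
    refine this.congr_deriv ?_
    simp
  have h2 : ∀ i j, HasDerivAt (fun u : ℂ => NormedSpace.exp (u • (-X)) i j) ((-X) i j) 0 := by
    intro i j
    simpa using hasDerivAt_exp_smul_apply (-X) 0 i j
  have h3 := hasDerivAt_matrix_mul h1 h2 i j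
  have h4 : (fun u : ℂ => Ad (glExp (u • X)) Y i j) =
      fun u => (NormedSpace.exp (u • X) * Y * NormedSpace.exp (u • (-X))) i j := by
    funext u
    rw [Ad, ← glExp_neg, smul_neg]; rfl
  rw [h4]
  refine h3.congr_deriv ?_
  simp [sub_eq_add_neg]

/-- Differentiate the commutator twice: first in b along exp(uY), which puts Ad_a Y - Y in Lie K,
then in a along exp(uX), using that Lie K is a linear subspace. -/
theorem bracket_mem_lieAlg_of_commutator {n : ℕ} {H K : Subgroup (GL (Fin n) ℂ)}
    (hH : IsZariskiClosed H)
    (hHK : ∀ a ∈ H, ∀ b ∈ H, a * b * a⁻¹ * b⁻¹ ∈ K)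
    {X Y : Matrix (Fin n) (Fin n) ℂ} (hX : X ∈ lieAlg H) (hY : Y ∈ lieAlg H) :
    X * Y - Y * X ∈ lieAlg K := by
  have h1 : ∀ a ∈ H, Ad a Y - Y ∈ lieAlg K := by
    intro a ha p hp
    have hd : ∀ i j, HasDerivAt (fun u : ℂ => (NormedSpace.exp (u • Ad a Y) *
        NormedSpace.exp (u • (-Y))) i j) ((Ad a Y - Y) i j) 0 := by
      intro i j
      have := hasDerivAt_matrix_mul (hasDerivAt_exp_smul_apply (Ad a Y) 0)
        (hasDerivAt_exp_smul_apply (-Y) 0) i j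
      refine this.congr_deriv ?_
      simp [sub_eq_add_neg]
    have h2 := hasDerivAt_evalAt hd p
    have h3 : (fun u : ℂ => evalAt (NormedSpace.exp (u • Ad a Y) *
        NormedSpace.exp (u • (-Y))) p) = fun _ => 0 := by
      funext u
      have := hp _ (hHK a ha _ (glExp_mem hH ((lieAlg H).smul_mem u hY)))
      rwa [← glExp_Ad, ← glExp_neg, Ad_smul, ← smul_neg] at this
    rw [h3] at h2
    simpa using h2.unique (hasDerivAt_const _ _)
  refine mem_of_derivative (lieAlg K) (γ := fun u => Ad (glExp (u • X)) Y - Y) (s := 0)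
    (fun i j => ?_) (fun u => h1 _ (glExp_mem hH ((lieAlg H).smul_mem u hX)))
  simpa using (hasDerivAt_Ad_exp X Y i j).sub_const (Y i j)

theorem bracket_mem_lieAlg {n : ℕ} {H : Subgroup (GL (Fin n) ℂ)}
    (hH : IsZariskiClosed H) {X Y : Matrix (Fin n) (Fin n) ℂ} (hX : X ∈ lieAlg H)
    (hY : Y ∈ lieAlg H) : X * Y - Y * X ∈ lieAlg H :=
  bracket_mem_lieAlg_of_commutator hH
    (fun _ ha _ hb => H.mul_mem (H.mul_mem (H.mul_mem ha hb) (H.inv_mem ha)) (H.inv_mem hb)) hX hY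

end LinAlgGroup

namespace LinAlgGroup

open MvPolynomial Filter Topology

/-! ### Closed subgroups with the same Lie algebra -/

theorem evalAt_add {n : ℕ} (A : Matrix (Fin n) (Fin n) ℂ) (p q : MvPolynomial (Fin n × Fin n) ℂ) :
    evalAt A (p + q) = evalAt A p + evalAt A q := map_add _ _ _

theorem evalAt_mul {n : ℕ} (A : Matrix (Fin n) (Fin n) ℂ) (p q : MvPolynomial (Fin n × Fin n) ℂ) :
    evalAt A (p * q) = evalAt A p * evalAt A q := map_mul _ _ _

/-- The ideal of the polynomials `q` such that `q (h - 1) = 0` for all `h ∈ H`. -/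
def centeredIdeal {n : ℕ} (H : Subgroup (GL (Fin n) ℂ)) :
    Ideal (MvPolynomial (Fin n × Fin n) ℂ) where
  carrier := {q | ∀ h ∈ H, evalAt ((h : Matrix (Fin n) (Fin n) ℂ) - 1) q = 0}
  zero_mem' := fun _ _ => map_zero _
  add_mem' := fun {p q} hp hq h hh => by rw [evalAt_add, hp h hh, hq h hh, add_zero]
  smul_mem' := fun c q hq h hh => by rw [smul_eq_mul, evalAt_mul, hq h hh, mul_zero]

/-- Substitution of a matrix of polynomials. -/
theorem evalAt_bind₁ {n : ℕ} (A : Matrix (Fin n) (Fin n) ℂ)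
    (g : Fin n × Fin n → MvPolynomial (Fin n × Fin n) ℂ) (p : MvPolynomial (Fin n × Fin n) ℂ) :
    evalAt A (bind₁ g p) = evalAt (Matrix.of fun i j => evalAt A (g (i, j))) p := by
  unfold evalAt
  induction p using MvPolynomial.induction_on with
  | C a => simp
  | add p q hp hq => rw [map_add, map_add, map_add, hp, hq]
  | mul_X p kl hp => rw [map_mul, map_mul, map_mul, hp]; simp

theorem mem_of_centeredIdeal {n : ℕ} {H : Subgroup (GL (Fin n) ℂ)} (hH : IsZariskiClosed H)
    {g : GL (Fin n) ℂ}
    (hg : ∀ q ∈ centeredIdeal H, evalAt ((g : Matrix (Fin n) (Fin n) ℂ) - 1) q = 0) : g ∈ H := by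
  refine hH g fun p hp => ?_
  have key : ∀ A : Matrix (Fin n) (Fin n) ℂ, evalAt (A - 1)
      (bind₁ (fun ij => X ij + C ((1 : Matrix (Fin n) (Fin n) ℂ) ij.1 ij.2)) p) = evalAt A p := by
    intro A
    rw [evalAt_bind₁]
    congr 1
    ext i j
    simp [evalAt]
  rw [← key]
  exact hg _ fun h hh => (key _).trans (hp h hh)

theorem evalAt_smul_homogeneous {n k : ℕ} {p : MvPolynomial (Fin n × Fin n) ℂ}
    (hp : p.IsHomogeneous k) (u : ℂ) (A : Matrix (Fin n) (Fin n) ℂ) :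
    evalAt (u • A) p = u ^ k * evalAt A p := by
  unfold evalAt
  rw [eval_eq, eval_eq, Finset.mul_sum]
  refine Finset.sum_congr rfl fun d hd => ?_
  have hk := hp (mem_support_iff.1 hd)
  have : (∏ i ∈ d.support, (u • A) i.1 i.2 ^ d i) = u ^ k * ∏ i ∈ d.support, A i.1 i.2 ^ d i := by
    simp only [Matrix.smul_apply, smul_eq_mul, mul_pow, Finset.prod_mul_distrib]
    rw [Finset.prod_pow_eq_pow_sum, ← hk]
    simp [Finsupp.weight_apply, Finsupp.sum]
  rw [this]; ring

/-- The leading form at the identity of an element of the ideal of `H` vanishes on `Lie H`. -/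
theorem evalAt_homogeneousComponent_of_mem {n k : ℕ} {H : Subgroup (GL (Fin n) ℂ)}
    (hH : IsZariskiClosed H) {q : MvPolynomial (Fin n × Fin n) ℂ} (hq : q ∈ centeredIdeal H)
    (hqk : q ∈ idealOfVars (Fin n × Fin n) ℂ ^ k) {Y : Matrix (Fin n) (Fin n) ℂ}
    (hY : Y ∈ lieAlg H) : evalAt Y (homogeneousComponent k q) = 0 := by
  -- `G` is q(uA) / u^k, extended to u = 0 by the leading form. It vanishes at (u, (exp(uY) - 1)/u)
  -- for u ≠ 0, and these points tend to (0, Y).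
  let G : ℂ × (Fin n → Fin n → ℂ) → ℂ := fun z => ∑ d ∈ Finset.range (q.totalDegree + k + 1),
    if k ≤ d then z.1 ^ (d - k) * evalAt (Matrix.of z.2) (homogeneousComponent d q) else 0
  have hG : Continuous G := by
    refine continuous_finsetSum _ fun d _ => ?_
    split_ifs
    · refine (continuous_fst.pow _).mul ?_
      simp only [evalAt]
      exact (MvPolynomial.continuous_eval _).comp (by fun_prop)
    · exact continuous_const
  have hmul : ∀ u (A : Matrix (Fin n) (Fin n) ℂ), evalAt (u • A) q = u ^ k * G (u, A) := by
    intro u A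
    have hsum : q = ∑ d ∈ Finset.range (q.totalDegree + k + 1), homogeneousComponent d q := by
      conv_lhs => rw [← sum_homogeneousComponent q]
      refine Finset.sum_subset (Finset.range_mono (by omega)) fun d _ hd => ?_
      exact homogeneousComponent_eq_zero _ _ (by simpa using hd)
    conv_lhs => rw [hsum]
    simp only [evalAt, map_sum, G, Finset.mul_sum]
    refine Finset.sum_congr rfl fun d _ => ?_
    have h1 := evalAt_smul_homogeneous (homogeneousComponent_isHomogeneous d q) u A
    simp only [evalAt] at h1
    rw [h1]
    split_ifs with hd
    · rw [← mul_assoc, ← pow_add, Nat.add_sub_cancel' hd]; rfl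
    · have : homogeneousComponent d q = 0 := by
        refine homogeneousComponent_eq_zero' _ _ fun c hc hcd => hd ?_
        rw [← hcd]
        exact (mem_pow_idealOfVars_iff k q).1 hqk c hc
      rw [this, map_zero, mul_zero, mul_zero]
  have hG0 : G (0, Y) = evalAt Y (homogeneousComponent k q) := by
    simp only [G]
    rw [Finset.sum_eq_single k]
    · simp; rfl
    · intro d _ hdk
      split_ifs with hd
      · rw [zero_pow (by omega), zero_mul]
      · rfl
    · intro h; simp at h
  let E : ℂ → Fin n → Fin n → ℂ := fun u i j => u⁻¹ * (NormedSpace.exp (u • Y) - 1) i j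
  have hE : Tendsto (fun u => (u, E u)) (𝓝[≠] (0 : ℂ)) (𝓝 (0, Y)) := by
    refine Tendsto.prodMk_nhds (tendsto_id.mono_left nhdsWithin_le_nhds) ?_
    refine tendsto_pi_nhds.2 fun i => tendsto_pi_nhds.2 fun j => ?_
    have h1 := hasDerivAt_iff_tendsto_slope.1 (hasDerivAt_exp_smul_apply Y 0 i j)
    have h2 : (slope (fun u : ℂ => NormedSpace.exp (u • Y) i j) 0) = fun u => E u i j := by
      funext u
      simp [slope, E]
    rw [h2] at h1
    simpa using h1
  have hz : ∀ u ≠ 0, G (u, E u) = 0 := by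
    intro u hu
    have h1 := hq _ (glExp_mem hH ((lieAlg H).smul_mem u hY))
    have h2 : ((glExp (u • Y) : GL (Fin n) ℂ) : Matrix (Fin n) (Fin n) ℂ) - 1
        = u • (Matrix.of (E u)) := by
      ext i j
      simp [E, glExp_coe, hu]
    rw [h2, hmul] at h1
    exact (mul_eq_zero.1 h1).resolve_left (pow_ne_zero _ hu)
  have h1 := (hG.tendsto (0, Y)).comp hE
  have h2 : Tendsto (G ∘ fun u => (u, E u)) (𝓝[≠] (0 : ℂ)) (𝓝 0) := by
    refine tendsto_const_nhds.congr' ?_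
    filter_upwards [self_mem_nhdsWithin] with u hu
    exact (hz u hu).symm
  rw [← hG0]
  exact tendsto_nhds_unique h1 h2

/-- The linear part of a polynomial at the origin. -/
noncomputable def linearPart {n : ℕ} :
    MvPolynomial (Fin n × Fin n) ℂ →ₗ[ℂ] Module.Dual ℂ (Matrix (Fin n) (Fin n) ℂ) :=
  LinearMap.mk₂ ℂ (fun q X => ∑ ij : Fin n × Fin n, X ij.1 ij.2 * evalAt 0 (pderiv ij q))
    (by intro p q X; simp [evalAt, mul_add, Finset.sum_add_distrib])
    (by intro c p X; simp [evalAt, Finset.mul_sum, mul_left_comm])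
    (by intro p X Y; simp [add_mul, Finset.sum_add_distrib])
    (by intro c p X; simp [Finset.mul_sum, mul_assoc])

theorem linearPart_apply {n : ℕ} (q : MvPolynomial (Fin n × Fin n) ℂ)
    (X : Matrix (Fin n) (Fin n) ℂ) :
    linearPart q X = ∑ ij : Fin n × Fin n, X ij.1 ij.2 * evalAt 0 (pderiv ij q) := rfl

theorem pderiv_bind₁_X_sub_C {n : ℕ} (p : MvPolynomial (Fin n × Fin n) ℂ)
    (c : Fin n × Fin n → ℂ) (ij : Fin n × Fin n) :
    pderiv ij (bind₁ (fun kl => X kl - C (c kl)) p) =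
      bind₁ (fun kl => X kl - C (c kl)) (pderiv ij p) := by
  induction p using MvPolynomial.induction_on with
  | C a => simp
  | add p q hp hq => simp [hp, hq]
  | mul_X p kl hp =>
    by_cases h : kl = ij
    · subst h; simp [hp]
    · simp [hp, h]

theorem mem_lieAlg_of_linearPart {n : ℕ} {H : Subgroup (GL (Fin n) ℂ)}
    {Y : Matrix (Fin n) (Fin n) ℂ} (h : ∀ q ∈ centeredIdeal H, linearPart q Y = 0) :
    Y ∈ lieAlg H := by
  intro p hp
  let c : Fin n × Fin n → ℂ := fun kl => -(1 : Matrix (Fin n) (Fin n) ℂ) kl.1 kl.2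
  have key : ∀ (A : Matrix (Fin n) (Fin n) ℂ) (p : MvPolynomial (Fin n × Fin n) ℂ),
      evalAt (A - 1) (bind₁ (fun kl => X kl - C (c kl)) p) = evalAt A p := by
    intro A p
    rw [evalAt_bind₁]
    congr 1
    ext i j
    simp [evalAt, c]
  have h1 := h (bind₁ (fun kl => X kl - C (c kl)) p) fun g hg => (key _ _).trans (hp g hg)
  rw [linearPart_apply] at h1
  rw [← h1]
  refine Finset.sum_congr rfl fun ij _ => ?_
  rw [pderiv_bind₁_X_sub_C, ← key, sub_self]

/-- First order Taylor expansion at the origin, by induction through multiplication by a variable.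
-/
theorem sub_linear_mem_idealOfVars_sq {n : ℕ} (q : MvPolynomial (Fin n × Fin n) ℂ) :
    q - C (evalAt 0 q) - ∑ ij : Fin n × Fin n, C (evalAt 0 (pderiv ij q)) * X ij ∈
      idealOfVars (Fin n × Fin n) ℂ ^ 2 := by
  have hX : ∀ ij, X ij ∈ idealOfVars (Fin n × Fin n) ℂ := fun ij => Ideal.subset_span ⟨ij, rfl⟩
  induction q using MvPolynomial.induction_on with
  | C a => simp [evalAt]
  | add p q hp hq =>
    convert add_mem hp hq using 1
    simp only [evalAt, map_add, add_mul, Finset.sum_add_distrib]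
    ring
  | mul_X p kl hp =>
    have h1 : p - C (evalAt 0 p) ∈ idealOfVars (Fin n × Fin n) ℂ := by
      have := add_mem (Ideal.pow_le_self two_ne_zero hp)
        (Ideal.sum_mem _ (t := Finset.univ) fun ij _ =>
          Ideal.mul_mem_left _ (C (evalAt 0 (pderiv ij p))) (hX ij))
      simpa using this
    rw [pow_two]
    convert Ideal.mul_mem_mul h1 (hX kl) using 1
    rw [Finset.sum_eq_single kl]
    · simp [evalAt]; ring
    · intro b _ hb
      simp [evalAt, pderiv_X_of_ne hb.symm]
    · simp

/-- Linear forms as polynomials. -/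
noncomputable def linearForm {n : ℕ} (ℓ : Module.Dual ℂ (Matrix (Fin n) (Fin n) ℂ)) :
    MvPolynomial (Fin n × Fin n) ℂ :=
  ∑ ij : Fin n × Fin n, C (ℓ (Matrix.single ij.1 ij.2 1)) * X ij

theorem linearForm_linearPart_sub_mem {n : ℕ} {q : MvPolynomial (Fin n × Fin n) ℂ}
    (hq : evalAt 0 q = 0) :
    linearForm (linearPart q) - q ∈ idealOfVars (Fin n × Fin n) ℂ ^ 2 := by
  have h := sub_linear_mem_idealOfVars_sq q
  rw [hq, map_zero, sub_zero] at h
  rw [← neg_mem_iff, neg_sub]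
  convert h using 3
  refine Finset.sum_congr rfl fun ij _ => ?_
  congr 2
  rw [linearPart_apply, Finset.sum_eq_single ij]
  · simp
  · rintro ⟨k, l⟩ _ hb
    have : ¬ (ij.1 = k ∧ ij.2 = l) := fun h => hb (Prod.ext h.1.symm h.2.symm)
    rw [Matrix.single_apply_of_ne _ _ _ _ _ this, zero_mul]
  · simp

/-- Lie H is the common kernel of the linear parts of the ideal of H. By finite dimensional duality,
a form that kills Lie H is such a linear part, so it differs from an element of the ideal by terms
of order two. -/
theorem linearForm_mem {n : ℕ} {H : Subgroup (GL (Fin n) ℂ)}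
    {ℓ : Module.Dual ℂ (Matrix (Fin n) (Fin n) ℂ)} (hℓ : ∀ Y ∈ lieAlg H, ℓ Y = 0) :
    linearForm ℓ ∈ centeredIdeal H ⊔ idealOfVars (Fin n × Fin n) ℂ ^ 2 := by
  let Λ : Submodule ℂ (Module.Dual ℂ (Matrix (Fin n) (Fin n) ℂ)) :=
    ((centeredIdeal H).restrictScalars ℂ).map linearPart
  have h1 : ℓ ∈ Λ := by
    rw [← Subspace.dualCoannihilator_dualAnnihilator_eq (W := Λ), Submodule.mem_dualAnnihilator]
    intro Y hY
    rw [Submodule.mem_dualCoannihilator] at hY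
    exact hℓ Y (mem_lieAlg_of_linearPart fun q hq => hY _ ⟨q, hq, rfl⟩)
  obtain ⟨q, hq, rfl⟩ := h1
  have hq0 : evalAt 0 q = 0 := by simpa using hq 1 H.one_mem
  have hq' : q ∈ centeredIdeal H := hq
  have := add_mem (Submodule.mem_sup_left (T := idealOfVars (Fin n × Fin n) ℂ ^ 2) hq')
    (Submodule.mem_sup_right (linearForm_linearPart_sub_mem hq0))
  simpa using this

/-- A substitution that is the identity to first order modulo J changes a polynomial of order k only
modulo J and order k + 1. The product rule ab - g(a)g(b) = a(b - g(b)) + g(b)(a - g(a)) drives the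
induction. -/
theorem sub_bind₁_mem {n : ℕ} {J : Ideal (MvPolynomial (Fin n × Fin n) ℂ)}
    {g : Fin n × Fin n → MvPolynomial (Fin n × Fin n) ℂ}
    (hg0 : ∀ ij, g ij ∈ idealOfVars (Fin n × Fin n) ℂ)
    (hg : ∀ ij, X ij - g ij ∈ J ⊔ idealOfVars (Fin n × Fin n) ℂ ^ 2) (k : ℕ) :
    ∀ q ∈ idealOfVars (Fin n × Fin n) ℂ ^ k,
      q - bind₁ g q ∈ J ⊔ idealOfVars (Fin n × Fin n) ℂ ^ (k + 1) := by
  set M := idealOfVars (Fin n × Fin n) ℂ with hM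
  have hmul : ∀ {a b : ℕ} {p q : MvPolynomial (Fin n × Fin n) ℂ}, p ∈ M ^ a → q ∈ J ⊔ M ^ b →
      p * q ∈ J ⊔ M ^ (a + b) := by
    intro a b p q hp hq
    obtain ⟨j, hj, m, hm, rfl⟩ := Submodule.mem_sup.1 hq
    rw [mul_add, pow_add]
    exact add_mem (Submodule.mem_sup_left (J.mul_mem_left _ hj))
      (Submodule.mem_sup_right (Ideal.mul_mem_mul hp hm))
  have hX : ∀ ij, X ij ∈ M := fun ij => Ideal.subset_span ⟨ij, rfl⟩
  have hzero : ∀ q : MvPolynomial (Fin n × Fin n) ℂ, q - bind₁ g q ∈ J ⊔ M ^ 1 := by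
    intro q
    refine Submodule.mem_sup_right ?_
    rw [pow_one]
    induction q using MvPolynomial.induction_on with
    | C a => simp
    | add p q hp hq => convert add_mem hp hq using 1; rw [map_add]; ring
    | mul_X p kl _ =>
      rw [map_mul, bind₁_X_right]
      exact sub_mem (Ideal.mul_mem_left _ _ (hX kl)) (Ideal.mul_mem_left _ _ (hg0 kl))
  have hgM : ∀ q ∈ M, bind₁ g q ∈ M := by
    intro q hq
    have h1 : M ≤ M.comap (bind₁ g : _ →ₐ[ℂ] _) := by
      refine Ideal.span_le.2 ?_
      rintro _ ⟨ij, rfl⟩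
      simpa using hg0 ij
    exact h1 hq
  have hone : ∀ q ∈ M, q - bind₁ g q ∈ J ⊔ M ^ 2 := by
    intro q hq
    induction hq using Submodule.span_induction with
    | mem x hx => obtain ⟨ij, rfl⟩ := hx; simpa using hg ij
    | zero => simp
    | add x y _ _ hx hy => convert add_mem hx hy using 1; rw [map_add]; ring
    | smul a x hx hx' =>
      have h1 : a * (x - bind₁ g x) ∈ J ⊔ M ^ 2 := Ideal.mul_mem_left _ _ hx'
      have hgx : bind₁ g x ∈ M ^ 1 := by
        rw [pow_one]
        exact hgM x hx
      have h2 := hmul hgx (hzero a)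
      convert add_mem h1 h2 using 1
      rw [smul_eq_mul, map_mul]; ring
  induction k with
  | zero => intro q _; exact hzero q
  | succ k ih =>
    intro q hq
    rw [pow_succ] at hq
    induction hq using Submodule.mul_induction_on' with
    | mem_mul_mem a ha b hb =>
      have h1 := hmul ha (hone b hb)
      have h2 := hmul (a := 1) (by rw [pow_one]; exact hgM b hb) (ih a ha)
      rw [add_comm 1] at h2
      convert add_mem h1 h2 using 1
      rw [map_mul]; ring
    | add x _ y _ hx hy => convert add_mem hx hy using 1; rw [map_add]; ring

/-- Modulo every power of the maximal ideal of the identity, an equation of H is an equation of K.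
The remainder of order k still vanishes on H, so its leading form F vanishes on Lie H, which
contains Lie K. Substituting a projection onto Lie K therefore kills F, while changing it only
modulo the ideal of K and order k + 1. -/
theorem mem_centeredIdeal_sup_pow {n : ℕ} {H K : Subgroup (GL (Fin n) ℂ)}
    (hH : IsZariskiClosed H) (hle : H ≤ K) (h : lieAlg K ≤ lieAlg H)
    {q : MvPolynomial (Fin n × Fin n) ℂ} (hq : q ∈ centeredIdeal H) (k : ℕ) :
    q ∈ centeredIdeal K ⊔ idealOfVars (Fin n × Fin n) ℂ ^ k := by
  induction k with
  | zero => simp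
  | succ k ih =>
    obtain ⟨j, hj, m, hm, rfl⟩ := Submodule.mem_sup.1 ih
    refine add_mem (Submodule.mem_sup_left hj) ?_
    have hmH : m ∈ centeredIdeal H := by
      have : j ∈ centeredIdeal H := fun h hh => hj h (hle hh)
      simpa using sub_mem hq this
    obtain ⟨W, hW⟩ := Submodule.exists_isCompl (lieAlg K)
    let P : Matrix (Fin n) (Fin n) ℂ →ₗ[ℂ] Matrix (Fin n) (Fin n) ℂ :=
      (lieAlg K).subtype ∘ₗ Submodule.projectionOnto _ _ hW
    have hP : ∀ A, P A ∈ lieAlg K := fun A => (Submodule.projectionOnto _ _ hW A).2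
    have hPW : ∀ A ∈ lieAlg K, P A = A := fun A hA => by
      exact congrArg Subtype.val (Submodule.projectionOnto_apply_left hW ⟨A, hA⟩)
    let ent : Fin n × Fin n → Module.Dual ℂ (Matrix (Fin n) (Fin n) ℂ) :=
      fun ij => Matrix.entryLinearMap ℂ ℂ ij.1 ij.2
    let g : Fin n × Fin n → MvPolynomial (Fin n × Fin n) ℂ := fun ij => linearForm (ent ij ∘ₗ P)
    have hform0 : ∀ ℓ : Module.Dual ℂ (Matrix (Fin n) (Fin n) ℂ),
        linearForm ℓ ∈ idealOfVars (Fin n × Fin n) ℂ := fun ℓ =>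
      Ideal.sum_mem _ fun ij _ => Ideal.mul_mem_left _ _ (Ideal.subset_span ⟨ij, rfl⟩)
    have hform : ∀ (ℓ : Module.Dual ℂ (Matrix (Fin n) (Fin n) ℂ)) A,
        evalAt A (linearForm ℓ) = ℓ A := by
      intro ℓ A
      conv_rhs => rw [Matrix.matrix_eq_sum_single A]
      simp only [linearForm, evalAt, map_sum, Fintype.sum_prod_type]
      refine Finset.sum_congr rfl fun i _ => Finset.sum_congr rfl fun j _ => ?_
      rw [map_mul, eval_C, eval_X, mul_comm, ← smul_eq_mul, ← map_smul, Matrix.smul_single,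
        smul_eq_mul, mul_one]
    have hg : ∀ ij, X ij - g ij ∈ centeredIdeal K ⊔ idealOfVars (Fin n × Fin n) ℂ ^ 2 := by
      intro ij
      have h1 : X ij - g ij = linearForm (ent ij - ent ij ∘ₗ P) := by
        refine MvPolynomial.funext fun v => ?_
        have h2 := hform (ent ij - ent ij ∘ₗ P) (Matrix.of fun i j => v (i, j))
        have h3 := hform (ent ij ∘ₗ P) (Matrix.of fun i j => v (i, j))
        simp only [evalAt, Matrix.of_apply, Prod.mk.eta] at h2 h3
        rw [map_sub, eval_X, h2, LinearMap.sub_apply, h3]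
        simp [ent]
      rw [h1]
      refine linearForm_mem fun Y hY => ?_
      rw [LinearMap.sub_apply, LinearMap.comp_apply, hPW Y hY, sub_self]
    set F := homogeneousComponent k m with hF
    have hFk : F ∈ idealOfVars (Fin n × Fin n) ℂ ^ k := by
      rw [mem_pow_idealOfVars_iff']
      intro d hd
      rw [hF, coeff_homogeneousComponent, if_neg hd.ne]
    have hmF : m - F ∈ idealOfVars (Fin n × Fin n) ℂ ^ (k + 1) := by
      rw [mem_pow_idealOfVars_iff']
      intro d hd
      rw [coeff_sub, hF, coeff_homogeneousComponent]
      split_ifs with hdk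
      · exact sub_self _
      · rw [sub_zero]
        exact (mem_pow_idealOfVars_iff' k m).1 hm d (by omega)
    have hbF : bind₁ g F = 0 := by
      refine MvPolynomial.funext fun v => ?_
      have h1 := evalAt_bind₁ (Matrix.of fun i j => v (i, j)) g F
      have h2 : (Matrix.of fun i j => evalAt (Matrix.of fun i j => v (i, j)) (g (i, j))) =
          P (Matrix.of fun i j => v (i, j)) := by
        ext i j
        simp only [Matrix.of_apply, g, hform]
        rfl
      rw [h2, evalAt_homogeneousComponent_of_mem hH hmH hm (h (hP _))] at h1
      simpa [evalAt] using h1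
    have h1 := sub_bind₁_mem (fun ij => hform0 _) hg k F hFk
    rw [hbF, sub_zero] at h1
    simpa using add_mem (Submodule.mem_sup_right (S := centeredIdeal K) hmF) h1

/-- Krull's intersection theorem in the coordinate ring of K: an element of all powers of the ideal
M satisfies r q = q for some r in M, so 1 - r kills q and equals 1 at the identity. -/
theorem exists_mul_mem_centeredIdeal {n : ℕ} {H K : Subgroup (GL (Fin n) ℂ)}
    (hH : IsZariskiClosed H) (hle : H ≤ K) (h : lieAlg K ≤ lieAlg H)
    {q : MvPolynomial (Fin n × Fin n) ℂ} (hq : q ∈ centeredIdeal H) :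
    ∃ r, evalAt 0 r = 1 ∧ r * q ∈ centeredIdeal K := by
  let M := idealOfVars (Fin n × Fin n) ℂ
  have hM0 : ∀ r ∈ M, evalAt 0 r = 0 := by
    intro r hr
    induction hr using Submodule.span_induction with
    | mem x hx => obtain ⟨ij, rfl⟩ := hx; simp [evalAt]
    | zero => simp [evalAt]
    | add x y _ _ hx hy => rw [evalAt_add, hx, hy, add_zero]
    | smul a x _ hx => rw [smul_eq_mul, evalAt_mul, hx, mul_zero]
  have h1 : Ideal.Quotient.mk (centeredIdeal K) q ∈
      (⨅ i : ℕ, M ^ i • ⊤ : Submodule (MvPolynomial (Fin n × Fin n) ℂ)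
        (MvPolynomial (Fin n × Fin n) ℂ ⧸ centeredIdeal K)) := by
    rw [Submodule.mem_iInf]
    intro k
    obtain ⟨j, hj, m, hm, rfl⟩ := Submodule.mem_sup.1 (mem_centeredIdeal_sup_pow hH hle h hq k)
    rw [map_add, Ideal.Quotient.eq_zero_iff_mem.2 hj, zero_add]
    have := Submodule.smul_mem_smul hm (Submodule.mem_top
      (x := (1 : MvPolynomial (Fin n × Fin n) ℂ ⧸ centeredIdeal K)))
    convert this using 1
    change _ = Ideal.Quotient.mk (centeredIdeal K) (m • 1)
    rw [smul_eq_mul, mul_one]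
  obtain ⟨⟨r, hr⟩, hrq⟩ := (Ideal.mem_iInf_smul_pow_eq_bot_iff M _).1 h1
  refine ⟨1 - r, ?_, ?_⟩
  · have hr0 := hM0 r hr
    unfold evalAt at hr0 ⊢
    rw [map_sub, hr0, map_one, sub_zero]
  · rw [← Ideal.Quotient.eq_zero_iff_mem, sub_mul, one_mul, map_sub, sub_eq_zero, ← hrq]
    rfl

/-- H contains a Zariski neighbourhood of 1 in K, namely {Q ≠ 0}. Its translates cover K, and
finitely many suffice because the polynomial ring is noetherian; each selected translate lies in one
coset of H. -/
theorem relIndex_ne_zero_of_lieAlg_le {n : ℕ} {H K : Subgroup (GL (Fin n) ℂ)}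
    (hH : IsZariskiClosed H) (hle : H ≤ K) (h : lieAlg K ≤ lieAlg H) : H.relIndex K ≠ 0 := by
  obtain ⟨S, hS⟩ := (isNoetherianRing_iff_ideal_fg _).1 inferInstance (centeredIdeal H)
  have hSm : ∀ q ∈ S, q ∈ centeredIdeal H := fun q hq => hS ▸ Ideal.subset_span hq
  choose! r hr0 hr using fun q hq => exists_mul_mem_centeredIdeal hH hle h (hSm q hq)
  -- Where the product of the multipliers is nonzero, all generators of the ideal of H vanish.
  set Q := ∏ q ∈ S, r q with hQ
  have hQ0 : evalAt 0 Q = 1 := by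
    simp only [evalAt, hQ, map_prod]
    exact Finset.prod_eq_one fun q hq => hr0 q hq
  have hnbhd : ∀ k ∈ K, evalAt ((k : Matrix (Fin n) (Fin n) ℂ) - 1) Q ≠ 0 → k ∈ H := by
    intro k hk hkQ
    refine mem_of_centeredIdeal hH fun p hp => ?_
    rw [← hS] at hp
    induction hp using Submodule.span_induction with
    | mem q hq =>
      have h1 := hr q hq k hk
      rw [evalAt_mul] at h1
      refine (mul_eq_zero.1 h1).resolve_left fun h0 => hkQ ?_
      simp only [evalAt, hQ, map_prod] at h0 ⊢
      exact Finset.prod_eq_zero hq h0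
    | zero => exact map_zero _
    | add x y _ _ hx hy => rw [evalAt_add, hx, hy, add_zero]
    | smul a x _ hx => rw [smul_eq_mul, evalAt_mul, hx, mul_zero]
  let tr : K → MvPolynomial (Fin n × Fin n) ℂ := fun k =>
    bind₁ (fun ij => ∑ l, C (((k⁻¹ : K) : GL (Fin n) ℂ) ij.1 l) * X (l, ij.2) -
      C ((1 : Matrix (Fin n) (Fin n) ℂ) ij.1 ij.2)) Q
  have htr : ∀ (k : K) (A : Matrix (Fin n) (Fin n) ℂ), evalAt A (tr k) =
      evalAt ((((k⁻¹ : K) : GL (Fin n) ℂ) : Matrix (Fin n) (Fin n) ℂ) * A - 1) Q := by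
    intro k A
    rw [evalAt_bind₁]
    congr 1
    ext i j
    simp [evalAt, Matrix.mul_apply]
  -- If all members of a finite generating set of the translates vanished at y, so would `tr y`,
  -- whose value at y is Q at the identity, that is, 1.
  obtain ⟨s, hs, hspan⟩ := (Submodule.fg_span_iff_fg_span_finset_subset
    (R := MvPolynomial (Fin n × Fin n) ℂ) (Set.range tr)).1
    ((isNoetherianRing_iff_ideal_fg _).1 inferInstance (Ideal.span (Set.range tr)))
  have : ∀ q ∈ s, ∃ k, tr k = q := fun q hq => hs hq
  choose! κ hκ using this
  have hcover : ∀ y : K, ∃ q ∈ s, ((κ q)⁻¹ * y : K) ∈ H.subgroupOf K := by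
    intro y
    by_contra! hcon
    have h1 : evalAt ((y : GL (Fin n) ℂ) : Matrix (Fin n) (Fin n) ℂ) (tr y) = 0 := by
      have hy : tr y ∈ Submodule.span (MvPolynomial (Fin n × Fin n) ℂ)
          (s : Set (MvPolynomial (Fin n × Fin n) ℂ)) := hspan ▸ Submodule.subset_span ⟨y, rfl⟩
      generalize tr y = q' at hy
      induction hy using Submodule.span_induction with
      | mem q hq =>
        by_contra hne
        refine hcon q hq ?_
        rw [Subgroup.mem_subgroupOf]
        refine hnbhd _ (Subtype.property _) ?_
        rw [← hκ q hq, htr] at hne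
        simpa using hne
      | zero => exact map_zero _
      | add x y _ _ hx hy => rw [evalAt_add, hx, hy, add_zero]
      | smul a x _ hx => rw [smul_eq_mul, evalAt_mul, hx, mul_zero]
    rw [htr] at h1
    simp [hQ0] at h1
  rw [Subgroup.relIndex]
  have : Finite (K ⧸ H.subgroupOf K) := by
    refine Set.finite_univ_iff.1 ((s.finite_toSet.image
      fun q => (QuotientGroup.mk (κ q) : K ⧸ H.subgroupOf K)).subset fun x _ => ?_)
    induction x using QuotientGroup.induction_on with
    | H y =>
      obtain ⟨q, hq, hqy⟩ := hcover y
      exact ⟨q, hq, QuotientGroup.eq.2 hqy⟩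
  exact Subgroup.index_ne_zero_of_finite

/-- A connected group is determined by its Lie algebra. -/
theorem eq_of_lieAlg_le {n : ℕ} {H K : Subgroup (GL (Fin n) ℂ)}
    (hH : IsZariskiClosed H) (hK : IsZariskiConnected K) (hle : H ≤ K)
    (h : lieAlg K ≤ lieAlg H) : H = K :=
  hK H hH hle (relIndex_ne_zero_of_lieAlg_le hH hle h)

end LinAlgGroup

namespace LinAlgGroup

/-! ### Bases adapted to a solvable Lie algebra and a diagonalizable subset -/

/-- Lie's theorem on the dual gives an eigenform φ, whose kernel W is an invariant hyperplane. Since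
joint eigenvectors of S span V, one of them, v, lies outside W; it is the first basis vector and W
supplies the others by induction. -/
theorem exists_adapted_basis {L : Type*} [LieRing L] [LieAlgebra ℂ L] [LieAlgebra.IsSolvable L]
    (S : Set L) (d : ℕ) : ∀ (V : Type) [AddCommGroup V] [Module ℂ V] [FiniteDimensional ℂ V]
    [LieRingModule L V] [LieModule ℂ L V], Module.finrank ℂ V = d →
    Submodule.span ℂ {v : V | ∀ x ∈ S, ∃ c : ℂ, ⁅x, v⁆ = c • v} = ⊤ →
    ∃ b : Module.Basis (Fin d) ℂ V, (∀ (X : L) (i j : Fin d), i < j → b.repr ⁅X, b j⁆ i = 0) ∧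
      ∀ x ∈ S, ∀ i j : Fin d, i ≠ j → b.repr ⁅x, b j⁆ i = 0 := by
  induction d with
  | zero =>
    intro V _ _ _ _ _ hV _
    exact ⟨Module.finBasisOfFinrankEq ℂ V hV, fun _ i => i.elim0, fun _ _ i => i.elim0⟩
  | succ d ih =>
    intro V _ _ _ _ _ hV hspan
    have hV' : Nontrivial V := Module.nontrivial_of_finrank_pos (R := ℂ) (by omega)
    obtain ⟨χ, hχ⟩ := LieModule.exists_nontrivial_weightSpace_of_isSolvable ℂ L (V →ₗ[ℂ] ℂ)
    obtain ⟨⟨φ, hφ⟩, hφ0⟩ := exists_ne (0 : LieModule.weightSpace (V →ₗ[ℂ] ℂ) χ)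
    rw [LieModule.mem_weightSpace] at hφ
    have hφ0 : φ ≠ 0 := fun h => hφ0 (Subtype.ext h)
    have hφX : ∀ (X : L) (v : V), φ ⁅X, v⁆ = -(χ X * φ v) := by
      intro X v
      have := LinearMap.congr_fun (hφ X) v
      rw [Module.Dual.lie_apply] at this
      rw [← neg_neg (φ ⁅X, v⁆), this]; rfl
    let W : LieSubmodule ℂ L V :=
      { LinearMap.ker φ with
        lie_mem := by
          intro X v hv
          change φ v = 0 at hv
          change φ ⁅X, v⁆ = 0
          rw [hφX, hv, mul_zero, neg_zero] }
    have hWmem : ∀ v, v ∈ W ↔ φ v = 0 := fun v => Iff.rfl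
    obtain ⟨v, hv, hφv⟩ : ∃ v, (∀ x ∈ S, ∃ c : ℂ, ⁅x, v⁆ = c • v) ∧ φ v ≠ 0 := by
      by_contra! hcon
      refine hφ0 (LinearMap.ext fun w => ?_)
      have hw : w ∈ Submodule.span ℂ {v : V | ∀ x ∈ S, ∃ c : ℂ, ⁅x, v⁆ = c • v} := hspan ▸ trivial
      exact (Submodule.span_le (p := LinearMap.ker φ)).2 hcon hw
    -- The projection onto W along v maps joint S-eigenvectors to joint S-eigenvectors: any of them
    -- outside W has the same eigenvalue as v, since φ determines it. So such eigenvectors also span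
    -- W.
    let pr : V →ₗ[ℂ] W := LinearMap.codRestrict W.toSubmodule
      (LinearMap.id - (φ v)⁻¹ • φ.smulRight v) (by
        intro w
        change φ _ = 0
        simp [hφv, mul_comm])
    have hpr : ∀ w, (pr w : V) = w - ((φ v)⁻¹ * φ w) • v := fun w => by
      change w - (φ v)⁻¹ • (φ w • v) = _
      rw [smul_smul]
    have hWspan : Submodule.span ℂ {w : W | ∀ x ∈ S, ∃ c : ℂ, ⁅x, w⁆ = c • w} = ⊤ := by
      rw [eq_top_iff]
      rintro w -
      have h1 : ∀ z ∈ Submodule.span ℂ {v : V | ∀ x ∈ S, ∃ c : ℂ, ⁅x, v⁆ = c • v},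
          pr z ∈ Submodule.span ℂ {w : W | ∀ x ∈ S, ∃ c : ℂ, ⁅x, w⁆ = c • w} := by
        intro z hz
        suffices h : Submodule.span ℂ {v : V | ∀ x ∈ S, ∃ c : ℂ, ⁅x, v⁆ = c • v} ≤
            (Submodule.span ℂ {w : W | ∀ x ∈ S, ∃ c : ℂ, ⁅x, w⁆ = c • w}).comap pr from h hz
        refine Submodule.span_le.2 fun u hu => ?_
        refine Submodule.subset_span fun x hx => ?_
        obtain ⟨c, hc⟩ := hu x hx
        refine ⟨c, Subtype.ext ?_⟩
        change ⁅x, (pr u : V)⁆ = c • (pr u : V)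
        rw [hpr, lie_sub, lie_smul, hc, smul_sub]
        congr 1
        by_cases h0 : φ u = 0
        · simp [h0]
        · obtain ⟨c', hc'⟩ := hv x hx
          have e1 := hφX x u
          have e2 := hφX x v
          rw [hc, map_smul, smul_eq_mul] at e1
          rw [hc', map_smul, smul_eq_mul] at e2
          have e3 : c = -χ x := mul_right_cancel₀ h0 (by linear_combination e1)
          have e4 : c' = -χ x := mul_right_cancel₀ hφv (by linear_combination e2)
          rw [hc', e3, e4, smul_comm]
      have h2 : pr w = w := Subtype.ext (by
        rw [hpr, (hWmem _).1 w.2]; simp)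
      rw [← h2]
      exact h1 _ (hspan ▸ trivial)
    have hWdim : Module.finrank ℂ W = d := by
      have := Module.Dual.finrank_ker_add_one_of_ne_zero hφ0
      rw [hV] at this
      exact Nat.succ_injective this
    obtain ⟨b, hb, hbS⟩ := ih W hWdim hWspan
    let b' : Module.Basis (Fin (d + 1)) ℂ V := Module.Basis.mkFinCons (N := W.toSubmodule) v b
      (by
        intro c x hx hcx
        have := congrArg φ hcx
        rw [map_add, map_smul, (hWmem x).1 hx, smul_eq_mul, add_zero, map_zero] at this
        exact (mul_eq_zero.1 this).resolve_right hφv)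
      (by
        intro z
        refine ⟨-((φ v)⁻¹ * φ z), ?_⟩
        change φ _ = 0
        rw [map_add, map_smul, smul_eq_mul]
        field_simp
        ring)
    have hb'0 : b' 0 = v := by simp [b']
    have hb's : ∀ j : Fin d, b' j.succ = b j := fun j => by simp [b']
    have hreprW : ∀ w : W, b'.repr (w : V) 0 = 0 ∧ ∀ i : Fin d, b'.repr (w : V) i.succ = b.repr w i := by
      intro w
      have h1 : (w : V) = ∑ j, Fin.cons (α := fun _ => ℂ) 0 (fun i => b.repr w i) j • b' j := by
        rw [Fin.sum_univ_succ]
        have h2 := congrArg (LieSubmodule.toSubmodule W).subtype (b.sum_repr w)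
        rw [map_sum] at h2
        simp only [Fin.cons_zero, zero_smul, zero_add, Fin.cons_succ, hb's]
        exact h2.symm
      rw [h1]
      simp only [Module.Basis.repr_sum_self]
      exact ⟨rfl, fun i => rfl⟩
    have hsucc : ∀ (X : L) (j : Fin d), ⁅X, b' j.succ⁆ = ((⁅X, b j⁆ : W) : V) := by
      intro X j
      rw [hb's]; rfl
    refine ⟨b', ?_, ?_⟩
    · intro X i j hij
      obtain ⟨j, rfl⟩ := Fin.exists_succ_eq.2 (Fin.ne_zero_of_lt hij)
      rw [hsucc]
      refine Fin.cases (fun _ => (hreprW _).1) (fun i hi => ?_) i hij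
      rw [(hreprW _).2]
      exact hb X i j (Fin.succ_lt_succ_iff.1 hi)
    · intro x hx i j hij
      refine Fin.cases (fun hij => ?_) (fun j hij => ?_) j hij
      · obtain ⟨c, hc⟩ := hv x hx
        rw [hb'0, hc, map_smul, ← hb'0, Module.Basis.repr_self]
        simp [hij]
      · rw [hsucc]
        refine Fin.cases (fun _ => (hreprW _).1) (fun i hi => ?_) i hij
        rw [(hreprW _).2]
        exact hbS x hx i j fun h => hi (congrArg Fin.succ h)

end LinAlgGroup

/-! ### Closed subgroups and the triangular form of a solvable Lie algebra -/

namespace LinAlgGroup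

open MvPolynomial

/-! ### Regular functions on the general linear group and Zariski closures -/

theorem exists_det_polynomial (n : ℕ) : ∃ D : MvPolynomial (Fin n × Fin n) ℂ,
    ∀ A : Matrix (Fin n) (Fin n) ℂ, evalAt A D = A.det := by
  refine ⟨(Matrix.of fun i j => (X (i, j) : MvPolynomial (Fin n × Fin n) ℂ)).det, fun A => ?_⟩
  rw [evalAt, RingHom.map_det]
  congr 1
  ext i j
  simp

/-- The algebra of regular functions on `GL_n(ℂ)`. -/
noncomputable def regularGL (n : ℕ) : Subalgebra ℂ (GL (Fin n) ℂ → ℂ) where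
  carrier := {F | ∃ (k : ℕ) (p : MvPolynomial (Fin n × Fin n) ℂ), ∀ g : GL (Fin n) ℂ,
    (g : Matrix (Fin n) (Fin n) ℂ).det ^ k * F g = evalAt (g : Matrix (Fin n) (Fin n) ℂ) p}
  mul_mem' := by
    rintro F F' ⟨k, p, h⟩ ⟨k', p', h'⟩
    refine ⟨k + k', p * p', fun g => ?_⟩
    rw [evalAt_mul, ← h, ← h', Pi.mul_apply]
    ring
  add_mem' := by
    rintro F F' ⟨k, p, h⟩ ⟨k', p', h'⟩
    obtain ⟨D, hD⟩ := exists_det_polynomial n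
    refine ⟨k + k', D ^ k' * p + D ^ k * p', fun g => ?_⟩
    have hpow : ∀ l, evalAt (g : Matrix (Fin n) (Fin n) ℂ) (D ^ l) =
        (g : Matrix (Fin n) (Fin n) ℂ).det ^ l := fun l => by
      rw [← hD, evalAt, evalAt, map_pow]
    rw [evalAt_add, evalAt_mul, evalAt_mul, ← h, ← h', hpow, hpow, Pi.add_apply]
    ring
  algebraMap_mem' c := ⟨0, C c, fun g => by simp [evalAt]⟩

theorem entry_mem_regularGL {n : ℕ} (i j : Fin n) :
    (fun g : GL (Fin n) ℂ => (g : Matrix (Fin n) (Fin n) ℂ) i j) ∈ regularGL n :=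
  ⟨0, X (i, j), fun g => by simp [evalAt]⟩

theorem inv_entry_mem_regularGL {n : ℕ} (i j : Fin n) :
    (fun g : GL (Fin n) ℂ => ((g⁻¹ : GL (Fin n) ℂ) : Matrix (Fin n) (Fin n) ℂ) i j) ∈
      regularGL n := by
  refine ⟨1, (Matrix.of fun i j => (X (i, j) : MvPolynomial (Fin n × Fin n) ℂ)).adjugate i j,
    fun g => ?_⟩
  have h1 : evalAt (g : Matrix (Fin n) (Fin n) ℂ)
      ((Matrix.of fun i j => (X (i, j) : MvPolynomial (Fin n × Fin n) ℂ)).adjugate i j) =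
      (g : Matrix (Fin n) (Fin n) ℂ).adjugate i j := by
    have := congrFun (congrFun (RingHom.map_adjugate
      (eval fun ij : Fin n × Fin n => (g : Matrix (Fin n) (Fin n) ℂ) ij.1 ij.2)
      (Matrix.of fun i j => (X (i, j) : MvPolynomial (Fin n × Fin n) ℂ))) i) j
    rw [RingHom.mapMatrix_apply, Matrix.map_apply] at this
    rw [evalAt, this]
    congr 2
    ext i j
    simp
  have hdet : (g : Matrix (Fin n) (Fin n) ℂ).det ≠ 0 :=
    ((Matrix.isUnit_iff_isUnit_det _).1 g.isUnit).ne_zero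
  beta_reduce
  rw [h1, Matrix.coe_units_inv, Matrix.inv_def, pow_one, Ring.inverse_eq_inv']
  simp [hdet]

/-- Polynomial expressions in members of a subalgebra of functions are in this subalgebra. -/
theorem evalAt_mem {n : ℕ} {Y : Type*} (S : Subalgebra ℂ (Y → ℂ))
    {M : Y → Matrix (Fin n) (Fin n) ℂ} (hM : ∀ i j, (fun y => M y i j) ∈ S)
    (p : MvPolynomial (Fin n × Fin n) ℂ) : (fun y => evalAt (M y) p) ∈ S := by
  unfold evalAt
  induction p using MvPolynomial.induction_on with
  | C a => simp only [eval_C]; exact S.algebraMap_mem a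
  | add p q hp hq => simpa using! S.add_mem hp hq
  | mul_X p kl hp => simpa using! S.mul_mem hp (hM kl.1 kl.2)

/-- A negative power of the determinant is a polynomial in the entries of the inverse, so membership
of the entries of φ and of φ⁻¹ suffices. -/
theorem comp_mem_of_regularGL {n : ℕ} {Y : Type*} (S : Subalgebra ℂ (Y → ℂ))
    {φ : Y → GL (Fin n) ℂ} (hφ : ∀ i j, (fun y => (φ y : Matrix (Fin n) (Fin n) ℂ) i j) ∈ S)
    (hφ' : ∀ i j, (fun y => (((φ y)⁻¹ : GL (Fin n) ℂ) : Matrix (Fin n) (Fin n) ℂ) i j) ∈ S)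
    {F : GL (Fin n) ℂ → ℂ} (hF : F ∈ regularGL n) : (fun y => F (φ y)) ∈ S := by
  obtain ⟨k, p, h⟩ := hF
  obtain ⟨D, hD⟩ := exists_det_polynomial n
  have h1 : (fun y => F (φ y)) = (fun y => evalAt (φ y : Matrix (Fin n) (Fin n) ℂ) p) *
      (fun y => evalAt (((φ y)⁻¹ : GL (Fin n) ℂ) : Matrix (Fin n) (Fin n) ℂ) D) ^ k := by
    funext y
    have hdet : (φ y : Matrix (Fin n) (Fin n) ℂ).det *
        (((φ y)⁻¹ : GL (Fin n) ℂ) : Matrix (Fin n) (Fin n) ℂ).det = 1 := by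
      rw [← Matrix.det_mul, Units.mul_inv, Matrix.det_one]
    rw [Pi.mul_apply, Pi.pow_apply, hD, ← h, mul_right_comm, ← mul_pow, hdet, one_pow, one_mul]
  rw [h1]
  exact S.mul_mem (evalAt_mem S hφ p) (S.pow_mem (evalAt_mem S hφ' D) k)

theorem matrix_mul_entry_mem {n : ℕ} {Y : Type*} (S : Subalgebra ℂ (Y → ℂ))
    {M M' : Y → Matrix (Fin n) (Fin n) ℂ} (hM : ∀ i j, (fun y => M y i j) ∈ S)
    (hM' : ∀ i j, (fun y => M' y i j) ∈ S) (i j : Fin n) : (fun y => (M y * M' y) i j) ∈ S := by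
  have : (fun y => (M y * M' y) i j) = ∑ k, (fun y => M y i k) * (fun y => M' y k j) := by
    funext y; simp [Matrix.mul_apply]
  rw [this]
  exact S.sum_mem fun k _ => S.mul_mem (hM i k) (hM' k j)

theorem matrix_const_entry_mem {n : ℕ} {Y : Type*} (S : Subalgebra ℂ (Y → ℂ))
    (M : Matrix (Fin n) (Fin n) ℂ) (i j : Fin n) : (fun _ : Y => M i j) ∈ S :=
  S.algebraMap_mem (M i j)

theorem regularGL_comp_mul_left {n : ℕ} (a : GL (Fin n) ℂ) {F : GL (Fin n) ℂ → ℂ}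
    (hF : F ∈ regularGL n) : (fun g => F (a * g)) ∈ regularGL n := by
  refine comp_mem_of_regularGL _ (fun i j => ?_) (fun i j => ?_) hF
  · exact matrix_mul_entry_mem _ (matrix_const_entry_mem _ _) entry_mem_regularGL i j
  · simp only [mul_inv_rev, Units.val_mul]
    exact matrix_mul_entry_mem _ inv_entry_mem_regularGL (matrix_const_entry_mem _ _) i j

theorem regularGL_comp_mul_right {n : ℕ} (a : GL (Fin n) ℂ) {F : GL (Fin n) ℂ → ℂ}
    (hF : F ∈ regularGL n) : (fun g => F (g * a)) ∈ regularGL n := by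
  refine comp_mem_of_regularGL _ (fun i j => ?_) (fun i j => ?_) hF
  · exact matrix_mul_entry_mem _ entry_mem_regularGL (matrix_const_entry_mem _ _) i j
  · simp only [mul_inv_rev, Units.val_mul]
    exact matrix_mul_entry_mem _ (matrix_const_entry_mem _ _) inv_entry_mem_regularGL i j

theorem regularGL_comp_inv {n : ℕ} {F : GL (Fin n) ℂ → ℂ}
    (hF : F ∈ regularGL n) : (fun g => F g⁻¹) ∈ regularGL n := by
  refine comp_mem_of_regularGL _ inv_entry_mem_regularGL (fun i j => ?_) hF
  simpa using entry_mem_regularGL i j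

/-- The Zariski closure of a subgroup of `GL_n(ℂ)`. -/
noncomputable def zariskiClosure {n : ℕ} (H : Subgroup (GL (Fin n) ℂ)) :
    Subgroup (GL (Fin n) ℂ) where
  carrier := {g | ∀ F ∈ regularGL n, (∀ h ∈ H, F h = 0) → F g = 0}
  one_mem' := fun F _ h => h 1 H.one_mem
  mul_mem' := by
    intro a b ha hb F hF h
    -- The usual density argument in two variables: with b fixed in the closure, it suffices to take
    -- the left factor c in H; with c fixed, to take the right factor in H.
    refine ha _ (regularGL_comp_mul_right b hF) fun c hc => ?_
    exact hb _ (regularGL_comp_mul_left c hF) fun d hd => h _ (H.mul_mem hc hd)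
  inv_mem' := by
    intro a ha F hF h
    exact ha _ (regularGL_comp_inv hF) fun c hc => h _ (H.inv_mem hc)

theorem le_zariskiClosure {n : ℕ} (H : Subgroup (GL (Fin n) ℂ)) : H ≤ zariskiClosure H :=
  fun g hg _ _ h => h g hg

theorem evalAt_mem_regularGL {n : ℕ} (p : MvPolynomial (Fin n × Fin n) ℂ) :
    (fun g : GL (Fin n) ℂ => evalAt (g : Matrix (Fin n) (Fin n) ℂ) p) ∈ regularGL n :=
  ⟨0, p, fun g => by simp⟩

theorem isZariskiClosed_zariskiClosure {n : ℕ} (H : Subgroup (GL (Fin n) ℂ)) :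
    IsZariskiClosed (zariskiClosure H) := by
  rintro g hg F ⟨k, p, h⟩ hF
  have h1 := hg p fun a ha => ha _ (evalAt_mem_regularGL p) fun b hb => by
    rw [← h, hF b hb, mul_zero]
  rw [← h] at h1
  have hdet : (g : Matrix (Fin n) (Fin n) ℂ).det ≠ 0 :=
    ((Matrix.isUnit_iff_isUnit_det _).1 g.isUnit).ne_zero
  exact (mul_eq_zero.1 h1).resolve_left (pow_ne_zero _ hdet)

theorem mem_of_regularGL {n : ℕ} {H : Subgroup (GL (Fin n) ℂ)} (hH : IsZariskiClosed H)
    {g : GL (Fin n) ℂ} (hg : ∀ F ∈ regularGL n, (∀ h ∈ H, F h = 0) → F g = 0) : g ∈ H :=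
  hH g fun p hp => hg _ (evalAt_mem_regularGL p) hp

theorem zariskiClosure_le {n : ℕ} {H K : Subgroup (GL (Fin n) ℂ)} (hK : IsZariskiClosed K)
    (h : H ≤ K) : zariskiClosure H ≤ K :=
  fun _ hg => mem_of_regularGL hK fun F hF hFK => hg F hF fun a ha => hFK a (h ha)

theorem isZariskiClosed_of_regularGL {n : ℕ} {H : Subgroup (GL (Fin n) ℂ)}
    (h : ∀ g, (∀ F ∈ regularGL n, (∀ h ∈ H, F h = 0) → F g = 0) → g ∈ H) : IsZariskiClosed H := by
  have : zariskiClosure H = H := le_antisymm (fun g hg => h g hg) (le_zariskiClosure H)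
  rw [← this]
  exact isZariskiClosed_zariskiClosure H

theorem regularGL_comp_commutator_left {n : ℕ} (b : GL (Fin n) ℂ) {F : GL (Fin n) ℂ → ℂ}
    (hF : F ∈ regularGL n) : (fun g => F (g * b * g⁻¹ * b⁻¹)) ∈ regularGL n := by
  refine comp_mem_of_regularGL _ (fun i j => ?_) (fun i j => ?_) hF
  · simp only [Units.val_mul]
    exact matrix_mul_entry_mem _ (matrix_mul_entry_mem _ (matrix_mul_entry_mem _
      entry_mem_regularGL (matrix_const_entry_mem _ _)) inv_entry_mem_regularGL)
      (matrix_const_entry_mem _ _) i j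
  · simp only [mul_inv_rev, Units.val_mul, inv_inv]
    exact matrix_mul_entry_mem _ (matrix_const_entry_mem _ _) (matrix_mul_entry_mem _
      entry_mem_regularGL (matrix_mul_entry_mem _ (matrix_const_entry_mem _ _)
      inv_entry_mem_regularGL)) i j

theorem regularGL_comp_commutator_right {n : ℕ} (a : GL (Fin n) ℂ) {F : GL (Fin n) ℂ → ℂ}
    (hF : F ∈ regularGL n) : (fun g => F (a * g * a⁻¹ * g⁻¹)) ∈ regularGL n := by
  have h := regularGL_comp_commutator_left a (regularGL_comp_inv hF)
  simpa [mul_assoc] using h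

theorem commutator_mem_zariskiClosure {n : ℕ} {H K : Subgroup (GL (Fin n) ℂ)}
    (h : ∀ a ∈ H, ∀ b ∈ H, a * b * a⁻¹ * b⁻¹ ∈ K) :
    ∀ a ∈ zariskiClosure H, ∀ b ∈ zariskiClosure H, a * b * a⁻¹ * b⁻¹ ∈ zariskiClosure K := by
  intro a ha b hb F hF hFK
  refine ha _ (regularGL_comp_commutator_left b hF) fun a' ha' => ?_
  exact hb _ (regularGL_comp_commutator_right a' hF) fun b' hb' => hFK _ (h a' ha' b' hb')

theorem isZariskiClosed_bot {n : ℕ} : IsZariskiClosed (⊥ : Subgroup (GL (Fin n) ℂ)) := by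
  refine isZariskiClosed_of_regularGL fun g hg => ?_
  rw [Subgroup.mem_bot]
  ext i j
  have := hg _ ((regularGL n).sub_mem (entry_mem_regularGL i j)
    ((regularGL n).algebraMap_mem ((1 : Matrix (Fin n) (Fin n) ℂ) i j))) (by simp)
  simpa [sub_eq_zero] using this

theorem lieAlg_bot {n : ℕ} : lieAlg (⊥ : Subgroup (GL (Fin n) ℂ)) = ⊥ := by
  rw [eq_bot_iff]
  intro X hX
  rw [Submodule.mem_bot]
  ext i j
  exact vanishing_linear_of_mem_lieAlg hX (Matrix.entryLinearMap ℂ ℂ i j)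
    ((1 : Matrix (Fin n) (Fin n) ℂ) i j) fun h hh => by
      rw [Subgroup.mem_bot] at hh; subst hh; rfl

/-! ### Triangular form of connected solvable groups -/

attribute [local instance] LieRing.ofAssociativeRing

/-- The Lie algebra of a closed subgroup, as a Lie subalgebra of the matrices. -/
def lieSubalgebra {n : ℕ} {H : Subgroup (GL (Fin n) ℂ)} (hH : IsZariskiClosed H) :
    LieSubalgebra ℂ (Matrix (Fin n) (Fin n) ℂ) :=
  { lieAlg H with lie_mem' := fun hX hY => bracket_mem_lieAlg hH hX hY }

/-- The k-th derived algebra of Lie B lies in the Lie algebra of the Zariski closure of the k-th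
derived group. Passing to closures preserves the commutator relations and makes the bracket lemma
applicable. -/
theorem isSolvable_lieSubalgebra {n : ℕ} {B : Subgroup (GL (Fin n) ℂ)} (hB : IsZariskiClosed B)
    (hs : Group.IsSolvable B) : LieAlgebra.IsSolvable (lieSubalgebra hB) := by
  obtain ⟨m, hm⟩ := (Group.isSolvable_def B).1 hs
  let D : ℕ → Subgroup (GL (Fin n) ℂ) := fun k =>
    zariskiClosure ((derivedSeries B k).map B.subtype)
  have hD : ∀ k, IsZariskiClosed (D k) := fun k => isZariskiClosed_zariskiClosure _
  have hcomm : ∀ k, ∀ a ∈ D k, ∀ b ∈ D k, a * b * a⁻¹ * b⁻¹ ∈ D (k + 1) := by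
    intro k
    refine commutator_mem_zariskiClosure ?_
    rintro _ ⟨a, ha, rfl⟩ _ ⟨b, hb, rfl⟩
    refine ⟨a * b * a⁻¹ * b⁻¹, ?_, rfl⟩
    exact Subgroup.commutator_mem_commutator ha hb
  have key : ∀ k, ∀ X ∈ LieAlgebra.derivedSeries ℂ (lieSubalgebra hB) k,
      (X : Matrix (Fin n) (Fin n) ℂ) ∈ lieAlg (D k) := by
    intro k
    induction k with
    | zero =>
      intro X _
      refine lieAlg_mono ?_ X.2
      intro b hb
      exact le_zariskiClosure _ ⟨⟨b, hb⟩, by simp, rfl⟩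
    | succ k ih =>
      intro X hX
      rw [LieAlgebra.derivedSeries_def, LieAlgebra.derivedSeriesOfIdeal_succ,
        ← LieSubmodule.mem_toSubmodule, LieSubmodule.lieIdeal_oper_eq_linear_span'] at hX
      refine (Submodule.span_le (p := (lieAlg (D (k + 1))).comap
        (lieSubalgebra hB).toSubmodule.subtype)).2 ?_ hX
      rintro _ ⟨Y, hY, Z, hZ, rfl⟩
      exact bracket_mem_lieAlg_of_commutator (hD k) (hcomm k) (ih Y hY) (ih Z hZ)
  refine LieAlgebra.IsSolvable.mk (R := ℂ) (k := m) ?_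
  rw [eq_bot_iff]
  intro X hX
  have h1 := key m X hX
  have h2 : D m ≤ ⊥ := by
    refine zariskiClosure_le isZariskiClosed_bot ?_
    rw [hm, Subgroup.map_bot]
  have h3 := lieAlg_mono h2 h1
  rw [lieAlg_bot, Submodule.mem_bot] at h3
  rw [LieSubmodule.mem_bot]
  exact Subtype.ext h3

theorem isDiag_Ad_of_mem_lieAlg {n : ℕ} {T : Subgroup (GL (Fin n) ℂ)} {P : GL (Fin n) ℂ}
    (hP : ∀ t ∈ T, (Ad P (t : Matrix (Fin n) (Fin n) ℂ)).IsDiag)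
    {x : Matrix (Fin n) (Fin n) ℂ} (hx : x ∈ lieAlg T) : (Ad P x).IsDiag := by
  intro i j hij
  let A : Matrix (Fin n) (Fin n) ℂ →ₗ[ℂ] Matrix (Fin n) (Fin n) ℂ :=
    { toFun := Ad P, map_add' := Ad_add P, map_smul' := Ad_smul P }
  exact vanishing_linear_of_mem_lieAlg hx (Matrix.entryLinearMap ℂ ℂ i j ∘ₗ A) 0
    fun h hh => hP h hh hij

theorem exists_lie_triangular {n : ℕ} {B T : Subgroup (GL (Fin n) ℂ)} (hB : IsZariskiClosed B)
    (hs : Group.IsSolvable B) (hTB : T ≤ B)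
    (hT : ∃ P : GL (Fin n) ℂ, ∀ t ∈ T, (Ad P (t : Matrix (Fin n) (Fin n) ℂ)).IsDiag) :
    ∃ P : GL (Fin n) ℂ, (∀ X ∈ lieAlg B, (Ad P X).BlockTriangular id) ∧
      ∀ x ∈ lieAlg T, (Ad P x).IsDiag := by
  obtain ⟨Q, hQ⟩ := hT
  have := isSolvable_lieSubalgebra hB hs
  let S : Set (lieSubalgebra hB) := {x | (x : Matrix (Fin n) (Fin n) ℂ) ∈ lieAlg T}
  -- The columns of Q⁻¹ are joint eigenvectors of Lie T, and they span.
  have hspan : Submodule.span ℂ {v : Fin n → ℂ | ∀ x ∈ S, ∃ c : ℂ, ⁅x, v⁆ = c • v} = ⊤ := by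
    rw [eq_top_iff]
    intro v _
    have hv : v = (((Q⁻¹ : GL (Fin n) ℂ) : Matrix (Fin n) (Fin n) ℂ)) *ᵥ
        ((Q : Matrix (Fin n) (Fin n) ℂ) *ᵥ v) := by
      rw [Matrix.mulVec_mulVec, Units.inv_mul, Matrix.one_mulVec]
    have hw : ∀ w : Fin n → ℂ, w = ∑ j, w j • Pi.single j (1 : ℂ) := fun w => by
      funext i; simp [Finset.sum_apply, Pi.single_apply]
    rw [hv, hw ((Q : Matrix (Fin n) (Fin n) ℂ) *ᵥ v), Matrix.mulVec_sum]
    refine Submodule.sum_mem _ fun j _ => ?_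
    rw [Matrix.mulVec_smul]
    refine Submodule.smul_mem _ _ (Submodule.subset_span fun x hx => ?_)
    refine ⟨Ad Q (x : Matrix (Fin n) (Fin n) ℂ) j j, ?_⟩
    have hd := isDiag_Ad_of_mem_lieAlg hQ hx
    have h1 : (x : Matrix (Fin n) (Fin n) ℂ) * ((Q⁻¹ : GL (Fin n) ℂ) : Matrix (Fin n) (Fin n) ℂ) =
        ((Q⁻¹ : GL (Fin n) ℂ) : Matrix (Fin n) (Fin n) ℂ) * Ad Q x := by
      rw [Ad, mul_assoc, Units.inv_mul_cancel_left]
    change (x : Matrix (Fin n) (Fin n) ℂ) *ᵥ _ = _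
    rw [Matrix.mulVec_mulVec, h1, ← Matrix.mulVec_mulVec, ← Matrix.mulVec_smul]
    congr 1
    funext i
    rw [Matrix.mulVec_single_one, Matrix.col_apply, Pi.smul_apply, Pi.single_apply]
    split_ifs with h
    · subst h; simp
    · rw [hd h]; simp
  obtain ⟨b', hb', hb'S⟩ := exists_adapted_basis S n (Fin n → ℂ) (by simp) hspan
  -- The adapted basis gives lower triangular matrices; reversing its order makes them upper
  -- triangular.
  let b := b'.reindex Fin.revPerm
  let P : GL (Fin n) ℂ :=
    ⟨b.toMatrix (Pi.basisFun ℂ (Fin n)), (Pi.basisFun ℂ (Fin n)).toMatrix b,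
      Module.Basis.toMatrix_mul_toMatrix_flip _ _, Module.Basis.toMatrix_mul_toMatrix_flip _ _⟩
  have hP : ∀ (X : Matrix (Fin n) (Fin n) ℂ) i j, Ad P X i j = b.repr (X *ᵥ b j) i := by
    intro X i j
    have h1 : Ad P X = LinearMap.toMatrix b b (Matrix.toLin' X) := by
      rw [← basis_toMatrix_mul_linearMap_toMatrix_mul_basis_toMatrix b (Pi.basisFun ℂ (Fin n)) b
        (Pi.basisFun ℂ (Fin n)), LinearMap.toMatrix_eq_toMatrix', LinearMap.toMatrix'_toLin']
      rfl
    rw [h1, LinearMap.toMatrix_apply, Matrix.toLin'_apply]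
  refine ⟨P, fun X hX i j hij => ?_, fun x hx i j hij => ?_⟩
  · rw [hP]
    have := hb' ⟨X, hX⟩ (Fin.rev i) (Fin.rev j) (Fin.rev_lt_rev.2 hij)
    simpa [b] using! this
  · beta_reduce
    rw [hP]
    have := hb'S ⟨x, lieAlg_mono hTB hx⟩ hx (Fin.rev i) (Fin.rev j)
      (fun h => hij (Fin.rev_injective h))
    simpa [b] using! this

end LinAlgGroup

/-! ### Unitriangular matrices and the decomposition of triangular groups -/

namespace LinAlgGroup

open MvPolynomial

/-! ### The filtration by superdiagonals -/

/-- The matrices `X` such that `P X P⁻¹` vanishes below the `k`-th superdiagonal. -/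
def superdiag {n : ℕ} (P : GL (Fin n) ℂ) (k : ℕ) : Submodule ℂ (Matrix (Fin n) (Fin n) ℂ) where
  carrier := {X | ∀ i j : Fin n, (j : ℕ) < i + k → Ad P X i j = 0}
  zero_mem' := fun i j _ => by simp [Ad]
  add_mem' := fun hX hY i j h => by rw [Ad_add, Matrix.add_apply, hX i j h, hY i j h, add_zero]
  smul_mem' := fun c X hX i j h => by rw [Ad_smul, Matrix.smul_apply, hX i j h, smul_zero]

theorem superdiag_antitone {n : ℕ} (P : GL (Fin n) ℂ) {k l : ℕ} (h : k ≤ l) :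
    superdiag P l ≤ superdiag P k := fun _ hX i j hij => hX i j (by omega)

theorem mul_mem_superdiag {n : ℕ} {P : GL (Fin n) ℂ} {k l : ℕ} {X Y : Matrix (Fin n) (Fin n) ℂ}
    (hX : X ∈ superdiag P k) (hY : Y ∈ superdiag P l) : X * Y ∈ superdiag P (k + l) := by
  intro i j hij
  rw [Ad_matmul, Matrix.mul_apply]
  refine Finset.sum_eq_zero fun m _ => ?_
  by_cases h : (m : ℕ) < i + k
  · rw [hX i m h, zero_mul]
  · rw [hY m j (by omega), mul_zero]

theorem eq_zero_of_mem_superdiag {n : ℕ} {P : GL (Fin n) ℂ} {X : Matrix (Fin n) (Fin n) ℂ}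
    (hX : X ∈ superdiag P n) : X = 0 := by
  have h : Ad P X = 0 := by
    ext i j
    exact hX i j (by omega)
  rw [← Ad_one X, ← inv_mul_cancel P, Ad_mul, h]
  simp [Ad]

theorem one_mem_superdiag {n : ℕ} (P : GL (Fin n) ℂ) :
    (1 : Matrix (Fin n) (Fin n) ℂ) ∈ superdiag P 0 := by
  intro i j hij
  have : i ≠ j := fun h => by subst h; omega
  simp [Ad, this]

theorem pow_mem_superdiag {n : ℕ} {P : GL (Fin n) ℂ} {k : ℕ} {X : Matrix (Fin n) (Fin n) ℂ}
    (hX : X ∈ superdiag P k) (m : ℕ) : X ^ m ∈ superdiag P (k * m) := by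
  induction m with
  | zero => simpa using one_mem_superdiag P
  | succ m ih => rw [pow_succ, mul_add, mul_one]; exact mul_mem_superdiag ih hX

theorem pow_eq_zero_of_mem_superdiag {n : ℕ} {P : GL (Fin n) ℂ} {X : Matrix (Fin n) (Fin n) ℂ}
    (hX : X ∈ superdiag P 1) : X ^ n = 0 :=
  eq_zero_of_mem_superdiag (P := P) (by simpa using pow_mem_superdiag hX n)

theorem mem_superdiag_zero_iff {n : ℕ} {P : GL (Fin n) ℂ} {X : Matrix (Fin n) (Fin n) ℂ} :
    X ∈ superdiag P 0 ↔ (Ad P X).BlockTriangular id := by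
  constructor
  · intro h i j hij
    exact h i j (by simpa using hij)
  · intro h i j hij
    exact h (by simpa using hij)

theorem Ad_mul_diag_of_mem_superdiag {n : ℕ} {P : GL (Fin n) ℂ} {X Y : Matrix (Fin n) (Fin n) ℂ}
    (hX : X ∈ superdiag P 0) (hY : Y ∈ superdiag P 0) (i : Fin n) :
    Ad P (X * Y) i i = Ad P X i i * Ad P Y i i := by
  rw [Ad_matmul, Matrix.mul_apply]
  refine Finset.sum_eq_single i (fun m _ hm => ?_) (by simp)
  rcases lt_or_gt_of_ne hm with h | h
  · rw [hX i m (by simpa using h), zero_mul]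
  · rw [hY m i (by simpa using h), mul_zero]

theorem mem_superdiag_one_iff {n : ℕ} {P : GL (Fin n) ℂ} {X : Matrix (Fin n) (Fin n) ℂ} :
    X ∈ superdiag P 1 ↔ X ∈ superdiag P 0 ∧ ∀ i, Ad P X i i = 0 := by
  constructor
  · exact fun h => ⟨superdiag_antitone P zero_le_one h, fun i => h i i (by omega)⟩
  · rintro ⟨h0, h1⟩ i j hij
    rcases eq_or_ne i j with rfl | h
    · exact h1 i
    · exact h0 i j (by have : (i : ℕ) ≠ j := fun h' => h (Fin.ext h'); omega)

theorem inv_mem_superdiag {n : ℕ} {P : GL (Fin n) ℂ} {g : GL (Fin n) ℂ}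
    (hg : (g : Matrix (Fin n) (Fin n) ℂ) ∈ superdiag P 0) :
    ((g⁻¹ : GL (Fin n) ℂ) : Matrix (Fin n) (Fin n) ℂ) ∈ superdiag P 0 := by
  rw [mem_superdiag_zero_iff] at hg ⊢
  rw [Ad_coe] at hg ⊢
  have : P * g⁻¹ * P⁻¹ = (P * g * P⁻¹)⁻¹ := by group
  rw [this, Matrix.coe_units_inv]
  have : Invertible ((P * g * P⁻¹ : GL (Fin n) ℂ) : Matrix (Fin n) (Fin n) ℂ) :=
    (P * g * P⁻¹).invertible
  exact Matrix.blockTriangular_inv_of_blockTriangular hg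

theorem exp_eq_sum_of_pow_eq_zero {n m : ℕ} {X : Matrix (Fin n) (Fin n) ℂ} (hX : X ^ m = 0) :
    NormedSpace.exp X = ∑ k ∈ Finset.range m, ((k.factorial : ℂ)⁻¹) • X ^ k := by
  let : NormedRing (Matrix (Fin n) (Fin n) ℂ) := Matrix.linftyOpNormedRing
  let : NormedAlgebra ℂ (Matrix (Fin n) (Fin n) ℂ) := Matrix.linftyOpNormedAlgebra
  rw [NormedSpace.exp_eq_tsum ℂ]
  refine tsum_eq_sum fun k hk => ?_
  rw [pow_eq_zero_of_le (by simpa using hk) hX, smul_zero]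

theorem pow_mem_superdiag_one {n : ℕ} {P : GL (Fin n) ℂ} {k : ℕ} {X : Matrix (Fin n) (Fin n) ℂ}
    (hX : X ∈ superdiag P k) {m : ℕ} (hm : m ≠ 0) : X ^ m ∈ superdiag P k := by
  refine superdiag_antitone P ?_ (pow_mem_superdiag hX m)
  exact Nat.le_mul_of_pos_right k (Nat.pos_of_ne_zero hm)

theorem exp_sub_one_mem_superdiag {n : ℕ} {P : GL (Fin n) ℂ} {X : Matrix (Fin n) (Fin n) ℂ}
    (hX : X ∈ superdiag P 1) : NormedSpace.exp X - 1 ∈ superdiag P 1 := by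
  have h0 : X ^ (n + 1) = 0 := by rw [pow_succ, pow_eq_zero_of_mem_superdiag hX, zero_mul]
  rw [exp_eq_sum_of_pow_eq_zero h0, Finset.sum_range_succ']
  simp only [Nat.factorial_zero, Nat.cast_one, inv_one, pow_zero, one_smul, add_sub_cancel_right]
  exact Submodule.sum_mem _ fun k _ =>
    Submodule.smul_mem _ _ (pow_mem_superdiag_one hX (Nat.succ_ne_zero k))

theorem exp_sub_one_sub_mem_superdiag {n : ℕ} {P : GL (Fin n) ℂ} {k : ℕ}
    {X : Matrix (Fin n) (Fin n) ℂ} (hX : X ∈ superdiag P k) (hk : k ≠ 0) :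
    NormedSpace.exp X - 1 - X ∈ superdiag P (k + 1) := by
  have h0 : X ^ (n + 2) = 0 := by
    rw [pow_add, pow_eq_zero_of_mem_superdiag (superdiag_antitone P (by omega) hX), zero_mul]
  rw [exp_eq_sum_of_pow_eq_zero h0, Finset.sum_range_succ', Finset.sum_range_succ']
  simp only [Nat.factorial_zero, Nat.cast_one, inv_one, pow_zero, one_smul, add_sub_cancel_right,
    zero_add, Nat.factorial_one, pow_one]
  refine Submodule.sum_mem _ fun m _ => Submodule.smul_mem _ _ ?_
  refine superdiag_antitone P ?_ (pow_mem_superdiag hX (m + 1 + 1))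
  have : k * 2 ≤ k * (m + 1 + 1) := Nat.mul_le_mul_left k (by omega)
  omega

/-! ### Unipotent groups -/

/-- The polynomial functions of one variable. -/
noncomputable def polyFun : Subalgebra ℂ (ℂ → ℂ) := (Polynomial.aeval (id : ℂ → ℂ)).range

theorem mem_polyFun {F : ℂ → ℂ} : F ∈ polyFun ↔ ∃ p : Polynomial ℂ, ∀ s, F s = p.eval s := by
  constructor
  · rintro ⟨p, rfl⟩
    refine ⟨p, fun s => ?_⟩
    induction p using Polynomial.induction_on' with
    | add p q hp hq => simp_all
    | monomial k a => simp [Polynomial.aeval_monomial]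
  · rintro ⟨p, hp⟩
    refine ⟨p, funext fun s => ?_⟩
    rw [hp]
    clear hp
    induction p using Polynomial.induction_on' with
    | add p q hp hq => simp_all
    | monomial k a => simp [Polynomial.aeval_monomial]

theorem eq_zero_of_mem_polyFun {F : ℂ → ℂ} (hF : F ∈ polyFun) {m : ℕ} (hm : m ≠ 0)
    (h : ∀ k : ℕ, F ((m * k : ℕ) : ℂ) = 0) (s : ℂ) : F s = 0 := by
  obtain ⟨p, hp⟩ := mem_polyFun.1 hF
  have : p = 0 := by
    refine Polynomial.eq_zero_of_infinite_isRoot p ?_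
    refine Set.infinite_of_injective_forall_mem (f := fun k : ℕ => ((m * k : ℕ) : ℂ)) ?_ ?_
    · intro a b hab
      exact Nat.eq_of_mul_eq_mul_left (Nat.pos_of_ne_zero hm) (Nat.cast_injective hab)
    · intro k
      exact (hp _).symm.trans (h k)
  rw [hp, this, Polynomial.eval_zero]

/-- The complex powers of a unipotent matrix `1 + Z`. -/
noncomputable def unipotentCurve {n : ℕ} (Z : Matrix (Fin n) (Fin n) ℂ) (s : ℂ) :
    Matrix (Fin n) (Fin n) ℂ :=
  ∑ i ∈ Finset.range (n + 1), ((descPochhammer ℂ i).eval s / i.factorial) • Z ^ i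

/-- At s = k the coefficients are binomial coefficients, and the truncation loses nothing because
Z^n = 0. -/
theorem unipotentCurve_natCast {n : ℕ} {Z : Matrix (Fin n) (Fin n) ℂ} (hZ : Z ^ n = 0) (k : ℕ) :
    unipotentCurve Z k = (1 + Z) ^ k := by
  have hch : ∀ i, (descPochhammer ℂ i).eval (k : ℂ) / i.factorial = (k.choose i : ℂ) := by
    intro i
    rw [descPochhammer_eval_eq_descFactorial, Nat.descFactorial_eq_factorial_mul_choose]
    push_cast
    rw [mul_div_cancel_left₀]
    exact_mod_cast i.factorial_ne_zero
  have hz : ∀ i, n ≤ i → (k.choose i : ℂ) • Z ^ i = 0 := fun i hi => by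
    rw [pow_eq_zero_of_le hi hZ, smul_zero]
  rw [unipotentCurve, add_comm 1 Z, (Commute.one_right Z).add_pow]
  simp only [hch, one_pow, mul_one]
  have h1 : ∀ N, n + 1 ≤ N → k + 1 ≤ N → ∑ i ∈ Finset.range (n + 1), (k.choose i : ℂ) • Z ^ i =
      ∑ i ∈ Finset.range N, (k.choose i : ℂ) • Z ^ i := by
    intro N hN _
    refine Finset.sum_subset (Finset.range_mono hN) fun i _ hi => hz i ?_
    simp at hi; omega
  have h2 : ∀ N, k + 1 ≤ N → ∑ i ∈ Finset.range (k + 1), (k.choose i : ℂ) • Z ^ i =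
      ∑ i ∈ Finset.range N, (k.choose i : ℂ) • Z ^ i := by
    intro N hN
    refine Finset.sum_subset (Finset.range_mono hN) fun i _ hi => ?_
    rw [Nat.choose_eq_zero_of_lt (by simp at hi; omega), Nat.cast_zero, zero_smul]
  rw [h1 (n + k + 1) (by omega) (by omega), ← h2 (n + k + 1) (by omega)]
  refine Finset.sum_congr rfl fun i _ => ?_
  rw [← nsmul_eq_mul', Nat.cast_smul_eq_nsmul]

theorem unipotentCurve_entry_mem {n : ℕ} (Z : Matrix (Fin n) (Fin n) ℂ) (i j : Fin n) :
    (fun s => unipotentCurve Z s i j) ∈ polyFun := by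
  have : (fun s => unipotentCurve Z s i j) = ∑ k ∈ Finset.range (n + 1),
      (fun s => (descPochhammer ℂ k).eval s) * (fun _ => (k.factorial : ℂ)⁻¹ * (Z ^ k) i j) := by
    funext s
    rw [unipotentCurve, Matrix.sum_apply, Finset.sum_apply]
    refine Finset.sum_congr rfl fun k _ => ?_
    rw [Matrix.smul_apply, Pi.mul_apply, smul_eq_mul]
    ring
  rw [this]
  exact polyFun.sum_mem fun k _ => polyFun.mul_mem (mem_polyFun.2 ⟨_, fun _ => rfl⟩)
    (polyFun.algebraMap_mem ((k.factorial : ℂ)⁻¹ * (Z ^ k) i j))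

theorem pow_eq_zero_of_isNilpotent {n : ℕ} {Z : Matrix (Fin n) (Fin n) ℂ} (hZ : IsNilpotent Z) :
    Z ^ n = 0 := by
  have := Matrix.isNilpotent_charpoly_sub_pow_of_isNilpotent hZ
  have h1 : Z.charpoly = Polynomial.X ^ n := by
    have h2 := this.eq_zero
    simpa [sub_eq_zero] using h2
  have h3 := Matrix.aeval_self_charpoly Z
  simpa [h1] using h3

/-- Along the complex powers of u the polynomial p becomes a polynomial in s, and it has the
infinitely many roots mk. -/
theorem evalAt_unipotentCurve_eq_zero {n : ℕ} {u : GL (Fin n) ℂ}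
    (hu : IsNilpotent ((u : Matrix (Fin n) (Fin n) ℂ) - 1)) {m : ℕ} (hm : m ≠ 0)
    {p : MvPolynomial (Fin n × Fin n) ℂ}
    (h : ∀ k : ℕ, evalAt ((u ^ (m * k) : GL (Fin n) ℂ) : Matrix (Fin n) (Fin n) ℂ) p = 0) (s : ℂ) :
    evalAt (unipotentCurve ((u : Matrix (Fin n) (Fin n) ℂ) - 1) s) p = 0 := by
  refine eq_zero_of_mem_polyFun (evalAt_mem polyFun (unipotentCurve_entry_mem _) p) hm
    (fun k => ?_) s
  rw [unipotentCurve_natCast (pow_eq_zero_of_isNilpotent hu), add_sub_cancel, ← h k,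
    Units.val_pow_eq_pow_val]

/-- If K has finite index, some power u^m with m > 0 is in K. Equations of K vanish at the powers of
u^m, hence along the whole curve u^s, in particular at s = 1. -/
theorem isZariskiConnected_of_unipotent {n : ℕ} {U : Subgroup (GL (Fin n) ℂ)}
    (hU : ∀ g ∈ U, IsNilpotent ((g : Matrix (Fin n) (Fin n) ℂ) - 1)) : IsZariskiConnected U := by
  intro K hK hKU hidx
  refine le_antisymm hKU fun u hu => ?_
  obtain ⟨m, hm, -, hmem⟩ := Subgroup.exists_pow_mem_of_relIndex_ne_zero hidx hu
  refine hK u fun p hp => ?_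
  have h1 := evalAt_unipotentCurve_eq_zero (hU u hu) (m := m) (p := p) (by omega)
    (fun k => hp _ (by rw [pow_mul]; exact K.pow_mem hmem.1 k)) 1
  have h2 := unipotentCurve_natCast (pow_eq_zero_of_isNilpotent (hU u hu)) 1
  rw [Nat.cast_one, pow_one, add_sub_cancel] at h2
  rwa [h2] at h1

/-- A nontrivial unipotent element produces a nonzero nilpotent element of the Lie algebra. -/
theorem eq_one_of_unipotent {n : ℕ} {H : Subgroup (GL (Fin n) ℂ)} {u : GL (Fin n) ℂ} (hu : u ∈ H)
    (hnil : IsNilpotent ((u : Matrix (Fin n) (Fin n) ℂ) - 1))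
    (hH : ∀ Y ∈ lieAlg H, Y ∈ Algebra.adjoin ℂ {(u : Matrix (Fin n) (Fin n) ℂ) - 1} →
      IsNilpotent Y → Y = 0) : u = 1 := by
  set Z := (u : Matrix (Fin n) (Fin n) ℂ) - 1 with hZ
  suffices h : Z = 0 by
    ext1
    rw [Units.val_one, ← sub_eq_zero, ← hZ, h]
  have hZn := pow_eq_zero_of_isNilpotent hnil
  -- These are the derivatives at s = 0 of the binomial coefficients, so `Y` is the velocity of u^s
  -- at 0, that is, the logarithm of 1 + Z. It equals Z times the invertible matrix 1 + Z R, so Y =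
  -- 0 forces Z = 0. The range n + 2, longer by one zero term than that of the curve, lets two terms
  -- be split off.
  let c : ℕ → ℂ := fun i => (descPochhammer ℂ i).derivative.eval 0 / i.factorial
  let R := ∑ i ∈ Finset.range n, c (i + 2) • Z ^ i
  let Y := ∑ i ∈ Finset.range (n + 2), c i • Z ^ i
  have hY : Y = Z * (1 + Z * R) := by
    simp only [Y, R]
    rw [Finset.sum_range_succ', Finset.sum_range_succ']
    have h0 : c 0 = 0 := by simp [c]
    have h1 : c (0 + 1) = 1 := by simp [c]
    rw [h0, h1, zero_smul, add_zero, one_smul, mul_add, mul_one, zero_add, pow_one, add_comm,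
      Finset.mul_sum, Finset.mul_sum]
    congr 1
    refine Finset.sum_congr rfl fun i _ => ?_
    rw [mul_smul_comm, mul_smul_comm, pow_succ', pow_succ']
  have hZadj : Z ∈ Algebra.adjoin ℂ {Z} := Algebra.subset_adjoin rfl
  have hYadj : Y ∈ Algebra.adjoin ℂ {Z} :=
    Subalgebra.sum_mem _ fun i _ => Subalgebra.smul_mem _ (Subalgebra.pow_mem _ hZadj _) _
  have hcommR : Commute Z R := by
    refine Commute.sum_right _ _ _ fun i _ => ?_
    exact ((Commute.refl Z).pow_right i).smul_right _
  have hZR : IsNilpotent (Z * R) := hcommR.isNilpotent_mul_right hnil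
  have hYnil : IsNilpotent Y := by
    rw [hY]
    exact ((Commute.one_right Z).add_right ((Commute.refl Z).mul_right hcommR)).isNilpotent_mul_right
      hnil
  have hW0 : unipotentCurve Z 0 = 1 := by
    have := unipotentCurve_natCast hZn 0
    simpa using this
  have hd : ∀ i j, HasDerivAt (fun s => unipotentCurve Z s i j) (Y i j) 0 := by
    intro i j
    have h1 : (fun s => unipotentCurve Z s i j) = fun s => ∑ k ∈ Finset.range (n + 2),
        (descPochhammer ℂ k).eval s / k.factorial * (Z ^ k) i j := by
      funext s
      rw [unipotentCurve, Matrix.sum_apply, Finset.sum_range_succ _ (n + 1),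
        pow_eq_zero_of_le (Nat.le_succ n) hZn]
      simp
    rw [h1]
    simp only [Y, Matrix.sum_apply]
    refine HasDerivAt.fun_sum fun k _ => ?_
    rw [Matrix.smul_apply, smul_eq_mul]
    exact (((descPochhammer ℂ k).hasDerivAt 0).div_const _).mul_const _
  have hYH : Y ∈ lieAlg H := by
    intro p hp
    have h1 := hasDerivAt_evalAt hd p
    have hk : ∀ k : ℕ, evalAt ((u ^ (1 * k) : GL (Fin n) ℂ) : Matrix (Fin n) (Fin n) ℂ) p = 0 :=
      fun k => hp (u ^ (1 * k)) (H.pow_mem hu (1 * k))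
    have h2 : (fun s => evalAt (unipotentCurve Z s) p) = fun _ => 0 := by
      funext s
      exact evalAt_unipotentCurve_eq_zero hnil one_ne_zero hk s
    rw [h2, hW0] at h1
    exact h1.unique (hasDerivAt_const _ _)
  have hY0 := hH Y hYH hYadj hYnil
  rw [hY] at hY0
  exact (IsNilpotent.isUnit_one_add hZR).mul_left_eq_zero.1 hY0

/-! ### The structure of a connected solvable group -/

theorem isZariskiClosed_inf {n : ℕ} {H K : Subgroup (GL (Fin n) ℂ)} (hH : IsZariskiClosed H)
    (hK : IsZariskiClosed K) : IsZariskiClosed (H ⊓ K) :=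
  fun g hg => ⟨hH g fun p hp => hg p fun h hh => hp h hh.1,
    hK g fun p hp => hg p fun h hh => hp h hh.2⟩

/-- H ∩ A is closed and has the Lie algebra of H, so it is H by connectedness. -/
theorem le_of_glExp_mem {n : ℕ} {H A : Subgroup (GL (Fin n) ℂ)} (hH : IsZariskiClosed H)
    (hc : IsZariskiConnected H) (hA : IsZariskiClosed A)
    (h : ∀ X ∈ lieAlg H, glExp X ∈ A) : H ≤ A := by
  have hHA := isZariskiClosed_inf hH hA
  have h1 : H ⊓ A = H := eq_of_lieAlg_le hHA hc inf_le_left fun X hX => by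
    rw [mem_lieAlg_iff hHA]
    have hs := fun s : ℂ => (lieAlg H).smul_mem s hX
    exact fun s => ⟨glExp_mem hH (hs s), h _ (hs s)⟩
  exact h1 ▸ inf_le_right

theorem Ad_entry_mem {n : ℕ} {Y : Type*} (S : Subalgebra ℂ (Y → ℂ)) (P : GL (Fin n) ℂ)
    {M : Y → Matrix (Fin n) (Fin n) ℂ} (hM : ∀ i j, (fun y => M y i j) ∈ S) (i j : Fin n) :
    (fun y => Ad P (M y) i j) ∈ S :=
  matrix_mul_entry_mem S (matrix_mul_entry_mem S (matrix_const_entry_mem S _) hM)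
    (matrix_const_entry_mem S _) i j

/-- The group of the `g` such that `P g P⁻¹` is block triangular. -/
def triangularGroup {n : ℕ} (P : GL (Fin n) ℂ) {β : Type*} [LinearOrder β] (b : Fin n → β) :
    Subgroup (GL (Fin n) ℂ) where
  carrier := {g | (Ad P (g : Matrix (Fin n) (Fin n) ℂ)).BlockTriangular b}
  one_mem' := by
    have : Ad P ((1 : GL (Fin n) ℂ) : Matrix (Fin n) (Fin n) ℂ) = 1 := by simp [Ad]
    change (Ad P _).BlockTriangular b
    rw [this]
    exact Matrix.blockTriangular_one
  mul_mem' := by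
    intro g h hg hh
    change (Ad P _).BlockTriangular b
    rw [Units.val_mul, Ad_matmul]
    exact Matrix.BlockTriangular.mul hg hh
  inv_mem' := by
    intro g hg
    change (Ad P _).BlockTriangular b at hg ⊢
    rw [Ad_coe] at hg ⊢
    have : P * g⁻¹ * P⁻¹ = (P * g * P⁻¹)⁻¹ := by group
    rw [this, Matrix.coe_units_inv]
    have : Invertible ((P * g * P⁻¹ : GL (Fin n) ℂ) : Matrix (Fin n) (Fin n) ℂ) :=
      (P * g * P⁻¹).invertible
    exact Matrix.blockTriangular_inv_of_blockTriangular hg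

theorem isZariskiClosed_triangularGroup {n : ℕ} (P : GL (Fin n) ℂ) {β : Type*} [LinearOrder β]
    (b : Fin n → β) : IsZariskiClosed (triangularGroup P b) := by
  refine isZariskiClosed_of_regularGL fun g hg i j hij => ?_
  exact hg _ (Ad_entry_mem _ P entry_mem_regularGL i j) fun h hh => hh hij

theorem glExp_mem_triangularGroup {n : ℕ} {P : GL (Fin n) ℂ} {β : Type*} [LinearOrder β]
    {b : Fin n → β} {X : Matrix (Fin n) (Fin n) ℂ} (hX : (Ad P X).BlockTriangular b) :
    glExp X ∈ triangularGroup P b := by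
  change (Ad P _).BlockTriangular b
  rw [Ad_coe, ← glExp_Ad, glExp_coe]
  exact hX.exp

theorem isDiag_iff_blockTriangular {n : ℕ} {X : Matrix (Fin n) (Fin n) ℂ} :
    X.IsDiag ↔ X.BlockTriangular id ∧ X.BlockTriangular OrderDual.toDual := by
  constructor
  · intro h
    refine ⟨fun i j hij => h fun h => ?_, fun i j hij => h fun h => ?_⟩ <;> subst h <;>
      exact lt_irrefl _ hij
  · rintro ⟨h1, h2⟩ i j hij
    rcases lt_or_gt_of_ne hij with h | h
    · exact h2 (OrderDual.toDual_lt_toDual.2 h)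
    · exact h1 h

/-- A basis that makes `B` triangular, `T` diagonal and `N` unitriangular. -/
structure IsTriangularForm {n : ℕ} (P : GL (Fin n) ℂ) (B T N : Subgroup (GL (Fin n) ℂ)) :
    Prop where
  triangular : ∀ b ∈ B, (b : Matrix (Fin n) (Fin n) ℂ) ∈ superdiag P 0
  diag : ∀ t ∈ T, (Ad P (t : Matrix (Fin n) (Fin n) ℂ)).IsDiag
  mem_unipotent_iff : ∀ g, g ∈ N ↔ g ∈ B ∧ (g : Matrix (Fin n) (Fin n) ℂ) - 1 ∈ superdiag P 1

theorem Ad_one_right {n : ℕ} (P : GL (Fin n) ℂ) : Ad P (1 : Matrix (Fin n) (Fin n) ℂ) = 1 := by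
  simp [Ad]

theorem sub_one_mem_superdiag_iff {n : ℕ} {P : GL (Fin n) ℂ} {X : Matrix (Fin n) (Fin n) ℂ} :
    X - 1 ∈ superdiag P 1 ↔ X ∈ superdiag P 0 ∧ ∀ i, Ad P X i i = 1 := by
  rw [mem_superdiag_one_iff, Submodule.sub_mem_iff_left _ (one_mem_superdiag P)]
  simp [Ad_sub, Ad_one_right, sub_eq_zero]

/-- The unitriangular elements of a group of triangular matrices. -/
def unitriangularPart {n : ℕ} (P : GL (Fin n) ℂ) (B : Subgroup (GL (Fin n) ℂ)) :
    Subgroup (GL (Fin n) ℂ) where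
  carrier := {g | g ∈ B ∧ (g : Matrix (Fin n) (Fin n) ℂ) - 1 ∈ superdiag P 1}
  one_mem' := ⟨B.one_mem, by simp⟩
  mul_mem' := by
    rintro g h ⟨hg, hg'⟩ ⟨hh, hh'⟩
    refine ⟨B.mul_mem hg hh, ?_⟩
    have : ((g * h : GL (Fin n) ℂ) : Matrix (Fin n) (Fin n) ℂ) - 1 =
      ((g : Matrix (Fin n) (Fin n) ℂ) - 1) * h + (h - 1) := by
      rw [Units.val_mul, sub_mul, one_mul]; abel
    rw [this]
    exact add_mem (mul_mem_superdiag (k := 1) (l := 0) hg' (sub_one_mem_superdiag_iff.1 hh').1) hh'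
  inv_mem' := by
    rintro g ⟨hg, hg'⟩
    refine ⟨B.inv_mem hg, ?_⟩
    have : ((g⁻¹ : GL (Fin n) ℂ) : Matrix (Fin n) (Fin n) ℂ) - 1 =
      -(((g : Matrix (Fin n) (Fin n) ℂ) - 1) * ((g⁻¹ : GL (Fin n) ℂ) : Matrix (Fin n) (Fin n) ℂ)) := by
      rw [sub_mul, Units.mul_inv, one_mul]; abel
    rw [this]
    exact neg_mem (mul_mem_superdiag (k := 1) (l := 0) hg'
      (inv_mem_superdiag (sub_one_mem_superdiag_iff.1 hg').1))

theorem isNilpotent_sub_one_of_mem {n : ℕ} {P : GL (Fin n) ℂ} {B : Subgroup (GL (Fin n) ℂ)}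
    {g : GL (Fin n) ℂ} (hg : g ∈ unitriangularPart P B) :
    IsNilpotent ((g : Matrix (Fin n) (Fin n) ℂ) - 1) :=
  ⟨n, pow_eq_zero_of_mem_superdiag hg.2⟩

theorem isNormalUnipotent_unitriangularPart {n : ℕ} {P : GL (Fin n) ℂ}
    {B : Subgroup (GL (Fin n) ℂ)} (hB : IsZariskiClosed B)
    (htri : ∀ b ∈ B, (b : Matrix (Fin n) (Fin n) ℂ) ∈ superdiag P 0) :
    IsNormalUnipotent (unitriangularPart P B) B where
  le := fun _ hg => hg.1
  closed := by
    refine isZariskiClosed_of_regularGL fun g hg => ⟨?_, fun i j hij => ?_⟩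
    · exact mem_of_regularGL hB fun F hF hFB => hg F hF fun h hh => hFB h hh.1
    · refine hg (fun g => Ad P ((g : Matrix (Fin n) (Fin n) ℂ) - 1) i j) ?_ fun h hh =>
        hh.2 i j hij
      refine Ad_entry_mem (regularGL n) P (fun i j => ?_) i j
      exact (regularGL n).sub_mem (entry_mem_regularGL i j) (matrix_const_entry_mem _ 1 i j)
  connected := isZariskiConnected_of_unipotent fun _ => isNilpotent_sub_one_of_mem
  normal := by
    refine ⟨?_⟩
    rintro ⟨g, hg⟩ hgN ⟨b, hb⟩
    rw [Subgroup.mem_subgroupOf] at hgN ⊢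
    refine ⟨B.mul_mem (B.mul_mem hb hg) (B.inv_mem hb), ?_⟩
    have : ((b * g * b⁻¹ : GL (Fin n) ℂ) : Matrix (Fin n) (Fin n) ℂ) - 1 =
        (b : Matrix (Fin n) (Fin n) ℂ) * ((g : Matrix (Fin n) (Fin n) ℂ) - 1) * ((b⁻¹ : GL (Fin n) ℂ) : Matrix (Fin n) (Fin n) ℂ) := by
      rw [mul_sub, sub_mul, mul_one, Units.mul_inv, Units.val_mul, Units.val_mul]
    change ((b * g * b⁻¹ : GL (Fin n) ℂ) : Matrix (Fin n) (Fin n) ℂ) - 1 ∈ superdiag P 1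
    rw [this]
    exact mul_mem_superdiag (k := 1) (l := 0) (mul_mem_superdiag (k := 0) (l := 1) (htri b hb) hgN.2)
      (inv_mem_superdiag (htri b hb))
  unipotent := fun _ => isNilpotent_sub_one_of_mem

/-- The form of the Lie algebras passes to B and T by exponentiation and connectedness. A unipotent
triangular matrix has ones on its diagonal, so N is unitriangular; conversely the unitriangular part
of B is a connected normal unipotent subgroup, hence contained in the unipotent radical. -/
theorem exists_triangularForm {n : ℕ} {B T N : Subgroup (GL (Fin n) ℂ)} (hB : IsZariskiClosed B)
    (hBc : IsZariskiConnected B) (hs : Group.IsSolvable B) (hT : IsTorus T) (hTB : T ≤ B)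
    (hN : IsUnipotentRadical N B) : ∃ P, IsTriangularForm P B T N := by
  obtain ⟨P, hPB, hPT⟩ := exists_lie_triangular hB hs hTB hT.diagonalizable
  have htri : ∀ b ∈ B, (b : Matrix (Fin n) (Fin n) ℂ) ∈ superdiag P 0 := by
    have h := le_of_glExp_mem hB hBc (isZariskiClosed_triangularGroup P id)
      fun X hX => glExp_mem_triangularGroup (hPB X hX)
    exact fun b hb => mem_superdiag_zero_iff.2 (h hb)
  refine ⟨P, htri, ?_, fun g => ⟨fun hg => ?_, fun hg => ?_⟩⟩
  · have h1 := le_of_glExp_mem hT.closed hT.connected (isZariskiClosed_triangularGroup P id)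
      fun X hX => glExp_mem_triangularGroup (isDiag_iff_blockTriangular.1 (hPT X hX)).1
    have h2 := le_of_glExp_mem hT.closed hT.connected
      (isZariskiClosed_triangularGroup P OrderDual.toDual)
      fun X hX => glExp_mem_triangularGroup (isDiag_iff_blockTriangular.1 (hPT X hX)).2
    exact fun t ht => isDiag_iff_blockTriangular.2 ⟨h1 ht, h2 ht⟩
  · have hgB := hN.le hg
    refine ⟨hgB, mem_superdiag_one_iff.2 ⟨sub_mem (htri g hgB) (one_mem_superdiag P), fun i => ?_⟩⟩
    obtain ⟨m, hm⟩ := hN.unipotent g hg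
    have h0 : (g : Matrix (Fin n) (Fin n) ℂ) - 1 ∈ superdiag P 0 :=
      sub_mem (htri g hgB) (one_mem_superdiag P)
    have hpow : ∀ k, Ad P (((g : Matrix (Fin n) (Fin n) ℂ) - 1) ^ k) i i =
        (Ad P ((g : Matrix (Fin n) (Fin n) ℂ) - 1) i i) ^ k := by
      intro k
      induction k with
      | zero => simp [Ad_one_right]
      | succ k ih =>
        rw [pow_succ, pow_succ, Ad_mul_diag_of_mem_superdiag (by simpa using pow_mem_superdiag h0 k) h0, ih]
    have := hpow m
    rw [hm] at this
    refine eq_zero_of_pow_eq_zero (n := m) (this.symm.trans ?_)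
    simp [Ad]
  · exact hN.largest _ (isNormalUnipotent_unitriangularPart hB htri) hg

/-- Strictly triangular matrices exponentiate to unitriangular ones, and conversely the linear
equations of unitriangularity pass to tangent vectors. -/
theorem IsTriangularForm.mem_lieAlg_unipotent_iff {n : ℕ} {P : GL (Fin n) ℂ}
    {B T N : Subgroup (GL (Fin n) ℂ)} (h : IsTriangularForm P B T N) (hB : IsZariskiClosed B)
    (hN : IsZariskiClosed N) {X : Matrix (Fin n) (Fin n) ℂ} :
    X ∈ lieAlg N ↔ X ∈ lieAlg B ∧ X ∈ superdiag P 1 := by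
  constructor
  · intro hX
    refine ⟨lieAlg_mono (fun g hg => ((h.mem_unipotent_iff g).1 hg).1) hX, fun i j hij => ?_⟩
    let A : Matrix (Fin n) (Fin n) ℂ →ₗ[ℂ] Matrix (Fin n) (Fin n) ℂ :=
      { toFun := Ad P, map_add' := Ad_add P, map_smul' := Ad_smul P }
    refine vanishing_linear_of_mem_lieAlg hX (Matrix.entryLinearMap ℂ ℂ i j ∘ₗ A)
      (Ad P 1 i j) fun g hg => ?_
    have := ((h.mem_unipotent_iff g).1 hg).2 i j hij
    rw [Ad_sub, Matrix.sub_apply, sub_eq_zero] at this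
    exact this
  · rintro ⟨hXB, hX⟩
    rw [mem_lieAlg_iff hN]
    intro s
    rw [h.mem_unipotent_iff]
    exact ⟨glExp_mem hB ((lieAlg B).smul_mem s hXB),
      exp_sub_one_mem_superdiag ((superdiag P 1).smul_mem s hX)⟩

theorem IsTriangularForm.lieAlg_le {n : ℕ} {P : GL (Fin n) ℂ}
    {B T N : Subgroup (GL (Fin n) ℂ)} (h : IsTriangularForm P B T N)
    {X : Matrix (Fin n) (Fin n) ℂ} (hX : X ∈ lieAlg B) : X ∈ superdiag P 0 := by
  intro i j hij
  let A : Matrix (Fin n) (Fin n) ℂ →ₗ[ℂ] Matrix (Fin n) (Fin n) ℂ :=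
    { toFun := Ad P, map_add' := Ad_add P, map_smul' := Ad_smul P }
  exact vanishing_linear_of_mem_lieAlg hX (Matrix.entryLinearMap ℂ ℂ i j ∘ₗ A) 0
    fun g hg => h.triangular g hg i j hij

/-- The diagonal part of a matrix, in the basis given by `P`. -/
def diagPart {n : ℕ} (P : GL (Fin n) ℂ) (X : Matrix (Fin n) (Fin n) ℂ) :
    Matrix (Fin n) (Fin n) ℂ := Ad P⁻¹ (Matrix.diagonal fun i => Ad P X i i)

theorem diagPart_mul {n : ℕ} {P : GL (Fin n) ℂ} {X Y : Matrix (Fin n) (Fin n) ℂ}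
    (hX : X ∈ superdiag P 0) (hY : Y ∈ superdiag P 0) :
    diagPart P (X * Y) = diagPart P X * diagPart P Y := by
  rw [diagPart, diagPart, diagPart, ← Ad_matmul, Matrix.diagonal_mul_diagonal]
  congr 2
  funext i
  exact Ad_mul_diag_of_mem_superdiag hX hY i

theorem diagPart_of_isDiag {n : ℕ} {P : GL (Fin n) ℂ} {X : Matrix (Fin n) (Fin n) ℂ}
    (hX : (Ad P X).IsDiag) : diagPart P X = X := by
  rw [diagPart, Ad_inv_eq]
  exact hX.diagonal_diag

theorem diagPart_eq_one {n : ℕ} {P : GL (Fin n) ℂ} {X : Matrix (Fin n) (Fin n) ℂ}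
    (hX : X - 1 ∈ superdiag P 1) : diagPart P X = 1 := by
  rw [diagPart, Ad_inv_eq, Ad_one_right]
  simp [(sub_one_mem_superdiag_iff.1 hX).2]

theorem diagPart_eq_one_iff {n : ℕ} {P : GL (Fin n) ℂ} {X : Matrix (Fin n) (Fin n) ℂ}
    (hX : X ∈ superdiag P 0) : diagPart P X = 1 ↔ X - 1 ∈ superdiag P 1 := by
  refine ⟨fun h => sub_one_mem_superdiag_iff.2 ⟨hX, fun i => ?_⟩, diagPart_eq_one⟩
  rw [diagPart, Ad_inv_eq, Ad_one_right] at h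
  have := congrFun (congrFun h i) i
  simpa using this

/-- The triangular elements whose diagonal part is in `T`. -/
def diagPartGroup {n : ℕ} (P : GL (Fin n) ℂ) (T : Subgroup (GL (Fin n) ℂ)) :
    Subgroup (GL (Fin n) ℂ) where
  carrier := {g | (g : Matrix (Fin n) (Fin n) ℂ) ∈ superdiag P 0 ∧
    ∃ t ∈ T, diagPart P g = ((t : GL (Fin n) ℂ) : Matrix (Fin n) (Fin n) ℂ)}
  one_mem' := ⟨one_mem_superdiag P, 1, T.one_mem, diagPart_eq_one (by simp)⟩
  mul_mem' := by
    rintro g h ⟨hg, t, ht, hgt⟩ ⟨hh, u, hu, hhu⟩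
    refine ⟨mul_mem_superdiag (k := 0) (l := 0) hg hh, t * u, T.mul_mem ht hu, ?_⟩
    rw [Units.val_mul, diagPart_mul hg hh, hgt, hhu, Units.val_mul]
  inv_mem' := by
    rintro g ⟨hg, t, ht, hgt⟩
    refine ⟨inv_mem_superdiag hg, t⁻¹, T.inv_mem ht, ?_⟩
    have h1 := diagPart_mul hg (inv_mem_superdiag hg)
    rw [Units.mul_inv, diagPart_eq_one (by simp), hgt] at h1
    exact (Units.inv_eq_of_mul_eq_one_right h1.symm).symm

theorem isZariskiClosed_diagPartGroup {n : ℕ} (P : GL (Fin n) ℂ) {T : Subgroup (GL (Fin n) ℂ)}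
    (hT : IsZariskiClosed T) : IsZariskiClosed (diagPartGroup P T) := by
  refine isZariskiClosed_of_regularGL fun g hg => ?_
  have hg0 : (g : Matrix (Fin n) (Fin n) ℂ) ∈ superdiag P 0 := fun i j hij =>
    hg _ (Ad_entry_mem _ P entry_mem_regularGL i j) fun h hh => hh.1 i j hij
  have h1 := diagPart_mul hg0 (inv_mem_superdiag hg0)
  have h2 := diagPart_mul (inv_mem_superdiag hg0) hg0
  rw [Units.mul_inv, diagPart_eq_one (by simp)] at h1
  rw [Units.inv_mul, diagPart_eq_one (by simp)] at h2
  -- The diagonal part of g is invertible, with the diagonal part of g⁻¹ as inverse; it is in T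
  -- because the equations of T, composed with the diagonal part, are regular functions of g.
  refine ⟨hg0, ⟨_, _, h1.symm, h2.symm⟩, hT _ fun p hp => ?_, rfl⟩
  refine hg (fun g => evalAt (diagPart P g) p) ?_ ?_
  · refine evalAt_mem _ (Ad_entry_mem _ _ fun i j => ?_) p
    by_cases hij : i = j
    · subst hij
      simpa using Ad_entry_mem _ P entry_mem_regularGL i i
    · simp only [Matrix.diagonal_apply_ne _ hij]
      exact (regularGL n).zero_mem
  · rintro h ⟨-, t, ht, hht⟩
    rw [hht]
    exact hp t ht

/-- If `Lie B = Lie T + Lie N`, then `B = T N`. -/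
theorem IsTriangularForm.exists_mul {n : ℕ} {P : GL (Fin n) ℂ}
    {B T N : Subgroup (GL (Fin n) ℂ)} (h : IsTriangularForm P B T N) (hB : IsZariskiClosed B)
    (hBc : IsZariskiConnected B) (hT : IsZariskiClosed T) (hTB : T ≤ B)
    (hLie : lieAlg B ≤ lieAlg T ⊔ lieAlg N) {b : GL (Fin n) ℂ} (hb : b ∈ B) :
    ∃ t ∈ T, ∃ m ∈ N, b = t * m := by
  have hA := isZariskiClosed_inf hB (isZariskiClosed_diagPartGroup P hT)
  have hTA : T ≤ B ⊓ diagPartGroup P T := fun t ht =>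
    ⟨hTB ht, h.triangular t (hTB ht), t, ht, diagPart_of_isDiag (h.diag t ht)⟩
  have hNA : N ≤ B ⊓ diagPartGroup P T := fun m hm =>
    ⟨((h.mem_unipotent_iff m).1 hm).1, h.triangular m ((h.mem_unipotent_iff m).1 hm).1, 1,
      T.one_mem, diagPart_eq_one ((h.mem_unipotent_iff m).1 hm).2⟩
  -- The elements of B with diagonal part in T form a closed subgroup containing T and N, so its Lie
  -- algebra is all of Lie B.
  have h1 : B ⊓ diagPartGroup P T = B := eq_of_lieAlg_le hA hBc inf_le_left
    (hLie.trans (sup_le (lieAlg_mono hTA) (lieAlg_mono hNA)))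
  rw [← h1] at hb
  obtain ⟨hbB, hb0, t, ht, hbt⟩ := hb
  refine ⟨t, ht, t⁻¹ * b, (h.mem_unipotent_iff _).2 ⟨B.mul_mem (B.inv_mem (hTB ht)) hbB, ?_⟩,
    by group⟩
  have ht0 := h.triangular _ (B.inv_mem (hTB ht))
  rw [Units.val_mul, ← diagPart_eq_one_iff (mul_mem_superdiag (k := 0) (l := 0) ht0 hb0)]
  rw [diagPart_mul ht0 hb0, hbt, diagPart_of_isDiag (h.diag _ (T.inv_mem ht)), Units.inv_mul]

end LinAlgGroup

/-! ### Conjugating x + e to x, and consequences of regularity -/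

namespace LinAlgGroup

open MvPolynomial

/-! ### The elements `n_x` -/

/-- A linear form on W extends to all matrices, where it is a combination of entries. Here and
below, S is an arbitrary algebra of functions on a parameter space Y: rationality in x is expressed
by membership of entries in S. -/
theorem dual_mem_of_entry_mem {n : ℕ} {Y : Type*} (S : Subalgebra ℂ (Y → ℂ))
    {W : Submodule ℂ (Matrix (Fin n) (Fin n) ℂ)} {M : Y → W}
    (hM : ∀ i j, (fun y => (M y : Matrix (Fin n) (Fin n) ℂ) i j) ∈ S) (φ : Module.Dual ℂ W) :
    (fun y => φ (M y)) ∈ S := by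
  obtain ⟨ℓ, hℓ⟩ := LinearMap.exists_extend φ
  have h1 : (fun y => φ (M y)) = ∑ i, ∑ j, (fun y => (M y : Matrix (Fin n) (Fin n) ℂ) i j) *
      (fun _ => ℓ (Matrix.single i j 1)) := by
    funext y
    have h2 : φ (M y) = ℓ (M y) := by rw [← hℓ]; rfl
    rw [h2]
    conv_lhs => rw [Matrix.matrix_eq_sum_single (M y : Matrix (Fin n) (Fin n) ℂ)]
    simp only [map_sum, Finset.sum_apply, Pi.mul_apply]
    refine Finset.sum_congr rfl fun i _ => Finset.sum_congr rfl fun j _ => ?_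
    rw [← smul_eq_mul, ← map_smul, Matrix.smul_single, smul_eq_mul, mul_one]
  rw [h1]
  exact S.sum_mem fun i _ => S.sum_mem fun j _ => S.mul_mem (hM i j) (S.algebraMap_mem _)

theorem det_mem {ι Y : Type*} [Fintype ι] [DecidableEq ι] (S : Subalgebra ℂ (Y → ℂ))
    {M : Y → Matrix ι ι ℂ} (hM : ∀ i j, (fun y => M y i j) ∈ S) : (fun y => (M y).det) ∈ S := by
  have : (fun y => (M y).det) = ∑ σ : Equiv.Perm ι, ((Equiv.Perm.sign σ : ℤ) : ℂ) •
      ∏ i, (fun y => M y (σ i) i) := by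
    funext y
    rw [Matrix.det_apply', Finset.sum_apply]
    exact Finset.sum_congr rfl fun σ _ => by
      rw [Pi.smul_apply, Finset.prod_apply, smul_eq_mul]
  rw [this]
  exact S.sum_mem fun σ _ => S.smul_mem (S.prod_mem fun i _ => hM _ _) _

theorem adjugate_entry_mem {ι Y : Type*} [Fintype ι] [DecidableEq ι] (S : Subalgebra ℂ (Y → ℂ))
    {M : Y → Matrix ι ι ℂ} (hM : ∀ i j, (fun y => M y i j) ∈ S) (i j : ι) :
    (fun y => (M y).adjugate i j) ∈ S := by
  simp only [Matrix.adjugate_apply]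
  refine det_mem S fun k l => ?_
  by_cases h : k = j
  · subst h
    simp only [Matrix.updateRow_self]
    exact S.algebraMap_mem _
  · simp only [Matrix.updateRow_ne h]
    exact hM k l

/-- The adjoint action of `Lie T` on `Lie N`. -/
def adNilradical {n : ℕ} {T N : Subgroup (GL (Fin n) ℂ)}
    (hbr : ∀ x ∈ lieAlg T, ∀ Y ∈ lieAlg N, x * Y - Y * x ∈ lieAlg N) :
    lieAlg T →ₗ[ℂ] Module.End ℂ (lieAlg N) :=
  LinearMap.mk₂ ℂ (fun x Y => ⟨x.1 * Y.1 - Y.1 * x.1, hbr _ x.2 _ Y.2⟩)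
    (by intro x x' Y; ext1; simp [add_mul, mul_add]; abel)
    (by intro c x Y; ext1; simp [smul_sub])
    (by intro x Y Y'; ext1; simp [add_mul, mul_add]; abel)
    (by intro c x Y; ext1; simp [smul_sub])

theorem adNilradical_apply {n : ℕ} {T N : Subgroup (GL (Fin n) ℂ)}
    (hbr : ∀ x ∈ lieAlg T, ∀ Y ∈ lieAlg N, x * Y - Y * x ∈ lieAlg N) (x : lieAlg T)
    (Y : lieAlg N) : (adNilradical hbr x Y : Matrix (Fin n) (Fin n) ℂ) = x.1 * Y.1 - Y.1 * x.1 :=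
  rfl

/-- The determinant of the adjoint action of `x` on `Lie N`. -/
noncomputable def discriminant {n : ℕ} {T N : Subgroup (GL (Fin n) ℂ)}
    (hbr : ∀ x ∈ lieAlg T, ∀ Y ∈ lieAlg N, x * Y - Y * x ∈ lieAlg N) (x : lieAlg T) : ℂ :=
  LinearMap.det (adNilradical hbr x)

theorem discriminant_ne_zero_iff {n : ℕ} {T N : Subgroup (GL (Fin n) ℂ)}
    (hbr : ∀ x ∈ lieAlg T, ∀ Y ∈ lieAlg N, x * Y - Y * x ∈ lieAlg N) (x : lieAlg T) :
    discriminant hbr x ≠ 0 ↔ Function.Injective (adNilradical hbr x) := by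
  rw [discriminant, ← LinearMap.ker_eq_bot, ne_eq, LinearMap.det_eq_zero_iff_ker_ne_bot, not_not]

theorem adNilradical_matrix_mem {n : ℕ} {T N : Subgroup (GL (Fin n) ℂ)}
    (hbr : ∀ x ∈ lieAlg T, ∀ Y ∈ lieAlg N, x * Y - Y * x ∈ lieAlg N) {Y : Type*}
    (S : Subalgebra ℂ (Y → ℂ)) {ξ : Y → lieAlg T}
    (hξ : ∀ i j, (fun y => (ξ y : Matrix (Fin n) (Fin n) ℂ) i j) ∈ S) {ι : Type*} [Fintype ι]
    [DecidableEq ι] (b : Module.Basis ι ℂ (lieAlg N)) (i j : ι) :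
    (fun y => LinearMap.toMatrix b b (adNilradical hbr (ξ y)) i j) ∈ S := by
  have := dual_mem_of_entry_mem S hξ
    (b.coord i ∘ₗ (adNilradical hbr).flip (b j))
  simpa [LinearMap.toMatrix_apply] using this

theorem discriminant_mem {n : ℕ} {T N : Subgroup (GL (Fin n) ℂ)}
    (hbr : ∀ x ∈ lieAlg T, ∀ Y ∈ lieAlg N, x * Y - Y * x ∈ lieAlg N) {Y : Type*}
    (S : Subalgebra ℂ (Y → ℂ)) {ξ : Y → lieAlg T}
    (hξ : ∀ i j, (fun y => (ξ y : Matrix (Fin n) (Fin n) ℂ) i j) ∈ S) :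
    (fun y => discriminant hbr (ξ y)) ∈ S := by
  simp only [discriminant, ← LinearMap.det_toMatrix (Module.finBasis ℂ (lieAlg N))]
  exact det_mem S fun i j => adNilradical_matrix_mem hbr S hξ _ i j

/-- The solution of `[x, Z] = E` in `Lie N` depends rationally on `x`. -/
theorem exists_adNilradical_eq {n : ℕ} {T N : Subgroup (GL (Fin n) ℂ)}
    (hbr : ∀ x ∈ lieAlg T, ∀ Y ∈ lieAlg N, x * Y - Y * x ∈ lieAlg N) {Y : Type*}
    (S : Subalgebra ℂ (Y → ℂ)) {ξ : Y → lieAlg T}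
    (hξ : ∀ i j, (fun y => (ξ y : Matrix (Fin n) (Fin n) ℂ) i j) ∈ S)
    (hδ : ∀ y, discriminant hbr (ξ y) ≠ 0) (hδS : (fun y => (discriminant hbr (ξ y))⁻¹) ∈ S)
    {E : Y → lieAlg N} (hE : ∀ i j, (fun y => (E y : Matrix (Fin n) (Fin n) ℂ) i j) ∈ S) :
    ∃ Z : Y → lieAlg N, (∀ y, adNilradical hbr (ξ y) (Z y) = E y) ∧
      ∀ i j, (fun y => (Z y : Matrix (Fin n) (Fin n) ℂ) i j) ∈ S := by
  let b := Module.finBasis ℂ (lieAlg N)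
  let M : Y → Matrix _ _ ℂ := fun y => LinearMap.toMatrix b b (adNilradical hbr (ξ y))
  have hM := adNilradical_matrix_mem hbr S hξ b
  have hdet : ∀ y, (M y).det = discriminant hbr (ξ y) := fun y => LinearMap.det_toMatrix b _
  -- Cramer's rule: the adjugate is polynomial in the entries of the matrix, so δ is the only
  -- denominator.
  let c : Y → Fin (Module.finrank ℂ (lieAlg N)) → ℂ := fun y =>
    (discriminant hbr (ξ y))⁻¹ • ((M y).adjugate *ᵥ (b.repr (E y)))
  have hc : ∀ i, (fun y => c y i) ∈ S := by
    intro i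
    have h1 : (fun y => c y i) = (fun y => (discriminant hbr (ξ y))⁻¹) *
        ∑ k, (fun y => (M y).adjugate i k) * (fun y => b.coord k (E y)) := by
      funext y
      simp [c, Matrix.mulVec, dotProduct]
    rw [h1]
    exact S.mul_mem hδS (S.sum_mem fun k _ => S.mul_mem (adjugate_entry_mem S hM i k)
      (dual_mem_of_entry_mem S hE _))
  refine ⟨fun y => ∑ i, c y i • b i, fun y => ?_, fun i j => ?_⟩
  · apply b.repr.injective
    ext k
    have h1 : b.repr (∑ i, c y i • b i) = Finsupp.equivFunOnFinite.symm (c y) := by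
      ext i
      exact congrFun (b.repr_sum_self (c y)) i
    have h2 := congrFun (LinearMap.toMatrix_mulVec_repr b b (adNilradical hbr (ξ y))
      (∑ i, c y i • b i)) k
    rw [← h2, h1]
    change (M y *ᵥ c y) k = _
    simp only [c]
    rw [Matrix.mulVec_smul, Matrix.mulVec_mulVec, Matrix.mul_adjugate, hdet, Matrix.smul_mulVec,
      Matrix.one_mulVec, smul_smul, inv_mul_cancel₀ (hδ y), one_smul]
  · have h1 : (fun y => ((∑ k, c y k • b k : lieAlg N) : Matrix (Fin n) (Fin n) ℂ) i j) =
        ∑ k, (b k : Matrix (Fin n) (Fin n) ℂ) i j • (fun y => c y k) := by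
      funext y
      simp [Matrix.sum_apply, mul_comm]
    rw [h1]
    exact S.sum_mem fun k _ => S.smul_mem (hc k) _

/-- An injective endomorphism that preserves the finite dimensional W is onto W. Applied to ad x, it
places the solution Z of [x, Z] = E as deep in the filtration as E. -/
theorem mem_of_injective_of_map_mem {V : Type*} [AddCommGroup V] [Module ℂ V]
    [FiniteDimensional ℂ V] {f : Module.End ℂ V} (hf : Function.Injective f) {W : Submodule ℂ V}
    (hW : ∀ w ∈ W, f w ∈ W) {z : V} (hz : f z ∈ W) : z ∈ W := by
  have h1 : Function.Injective (f.restrict hW) := fun a b hab =>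
    Subtype.ext (hf (congrArg Subtype.val hab))
  obtain ⟨w, hw⟩ := LinearMap.injective_iff_surjective.1 h1 ⟨f z, hz⟩
  have : (w : V) = z := hf (congrArg Subtype.val hw)
  exact this ▸ w.2

theorem exp_entry_mem {n : ℕ} {Y : Type*} (S : Subalgebra ℂ (Y → ℂ))
    {M : Y → Matrix (Fin n) (Fin n) ℂ} (hM : ∀ i j, (fun y => M y i j) ∈ S)
    (hnil : ∀ y, M y ^ n = 0) (i j : Fin n) : (fun y => NormedSpace.exp (M y) i j) ∈ S := by
  have hpow : ∀ k i j, (fun y => (M y ^ k) i j) ∈ S := by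
    intro k
    induction k with
    | zero => simpa using matrix_const_entry_mem S 1
    | succ k ih => simpa only [pow_succ] using matrix_mul_entry_mem S ih hM
  have h1 : (fun y => NormedSpace.exp (M y) i j) = ∑ k ∈ Finset.range n,
      ((k.factorial : ℂ)⁻¹) • (fun y => (M y ^ k) i j) := by
    funext y
    rw [exp_eq_sum_of_pow_eq_zero (hnil y)]
    simp [Matrix.sum_apply]
  rw [h1]
  exact S.sum_mem fun k _ => S.smul_mem (hpow k i j) _

variable {n : ℕ} {P : GL (Fin n) ℂ} {B T N : Subgroup (GL (Fin n) ℂ)}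

theorem IsTriangularForm.bracket_mem (h : IsTriangularForm P B T N) (hB : IsZariskiClosed B)
    (hN : IsZariskiClosed N) {X Y : Matrix (Fin n) (Fin n) ℂ} (hX : X ∈ lieAlg B)
    (hY : Y ∈ lieAlg N) : X * Y - Y * X ∈ lieAlg N := by
  rw [h.mem_lieAlg_unipotent_iff hB hN] at hY ⊢
  have h0 := h.lieAlg_le hX
  exact ⟨bracket_mem_lieAlg hB hX hY.1, sub_mem
    (by simpa using mul_mem_superdiag h0 hY.2) (mul_mem_superdiag (l := 0) hY.2 h0)⟩

/-- One step of the approximation. To first order Ad_{exp Z}(x + E) is x + E + [Z, x], and [Z, x] =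
-E; every other term contains two factors among E and Z, or a remainder of an exponential, and so
lies deeper. -/
theorem Ad_exp_sub_mem_superdiag {k : ℕ} {x E Z : Matrix (Fin n) (Fin n) ℂ}
    (hx : x ∈ superdiag P 0) (hE : E ∈ superdiag P (k + 1)) (hZ : Z ∈ superdiag P (k + 1))
    (h : x * Z - Z * x = E) : Ad (glExp Z) (x + E) - x ∈ superdiag P (k + 2) := by
  set R := NormedSpace.exp Z - 1 - Z with hR
  set R' := NormedSpace.exp (-Z) - 1 - (-Z) with hR'
  have hRm : R ∈ superdiag P (k + 2) := exp_sub_one_sub_mem_superdiag hZ (Nat.succ_ne_zero k)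
  have hRm' : R' ∈ superdiag P (k + 2) :=
    exp_sub_one_sub_mem_superdiag (neg_mem hZ) (Nat.succ_ne_zero k)
  have ha' : (1 - Z + R') ∈ superdiag P 0 :=
    add_mem (sub_mem (one_mem_superdiag P) (superdiag_antitone P (Nat.zero_le _) hZ))
      (superdiag_antitone P (Nat.zero_le _) hRm')
  have key : Ad (glExp Z) (x + E) - x = R * (x * (1 - Z + R')) + (1 + Z) * x * R' - Z * x * Z +
      (Z + R) * (E * (1 - Z + R')) + E * (-Z + R') := by
    have h1 : Ad (glExp Z) (x + E) = (1 + Z + R) * (x + E) * (1 - Z + R') := by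
      rw [Ad, ← glExp_neg, glExp_coe, glExp_coe, hR, hR']
      congr 2 <;> abel
    rw [h1, ← h]
    noncomm_ring
  rw [key]
  refine add_mem (add_mem (sub_mem (add_mem ?_ ?_) ?_) ?_) ?_
  · exact mul_mem_superdiag (l := 0) hRm (mul_mem_superdiag (k := 0) (l := 0) hx ha')
  · refine superdiag_antitone P (by omega) (mul_mem_superdiag (k := 0) (mul_mem_superdiag (k := 0)
      (l := 0) (add_mem (one_mem_superdiag P) (superdiag_antitone P (Nat.zero_le _) hZ)) hx) hRm')
  · exact superdiag_antitone P (by omega) (mul_mem_superdiag (mul_mem_superdiag (l := 0) hZ hx) hZ)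
  · exact superdiag_antitone P (by omega) (mul_mem_superdiag
      (add_mem hZ (superdiag_antitone P (Nat.le_succ _) hRm)) (mul_mem_superdiag (l := 0) hE ha'))
  · exact superdiag_antitone P (by omega) (mul_mem_superdiag hE
      (add_mem (neg_mem hZ) (superdiag_antitone P (Nat.le_succ _) hRm')))

/-- The conjugation of `x + e` to `x` by elements of `N` that depend rationally on `x`. -/
theorem IsTriangularForm.exists_conj (h : IsTriangularForm P B T N) (hB : IsZariskiClosed B)
    (hN : IsZariskiClosed N) (hTB : T ≤ B)
    (hbr : ∀ x ∈ lieAlg T, ∀ Y ∈ lieAlg N, x * Y - Y * x ∈ lieAlg N)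
    {e : Matrix (Fin n) (Fin n) ℂ} (he : e ∈ lieAlg N) {Y : Type*}
    (S : Subalgebra ℂ (Y → ℂ)) {ξ : Y → lieAlg T}
    (hξ : ∀ i j, (fun y => (ξ y : Matrix (Fin n) (Fin n) ℂ) i j) ∈ S)
    (hδ : ∀ y, discriminant hbr (ξ y) ≠ 0) (hδS : (fun y => (discriminant hbr (ξ y))⁻¹) ∈ S)
    (k : ℕ) : ∃ g : Y → GL (Fin n) ℂ, (∀ y, g y ∈ N) ∧
      (∀ i j, (fun y => (g y : Matrix (Fin n) (Fin n) ℂ) i j) ∈ S) ∧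
      (∀ i j, (fun y => (((g y)⁻¹ : GL (Fin n) ℂ) : Matrix (Fin n) (Fin n) ℂ) i j) ∈ S) ∧
      ∀ y, Ad (g y) ((ξ y : Matrix (Fin n) (Fin n) ℂ) + e) - ξ y ∈ superdiag P (k + 1) := by
  have hNiff := fun X => h.mem_lieAlg_unipotent_iff hB hN (X := X)
  induction k with
  | zero =>
    refine ⟨fun _ => 1, fun _ => N.one_mem, matrix_const_entry_mem S _,
      matrix_const_entry_mem S _, fun y => ?_⟩
    rw [Ad_one, add_sub_cancel_left]
    exact ((hNiff _).1 he).2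
  | succ k ih =>
    obtain ⟨g, hgN, hgS, hgS', hg⟩ := ih
    have hxB : ∀ y, (ξ y : Matrix (Fin n) (Fin n) ℂ) ∈ lieAlg B := fun y => lieAlg_mono hTB (ξ y).2
    have hEN : ∀ y, Ad (g y) ((ξ y : Matrix (Fin n) (Fin n) ℂ) + e) - ξ y ∈ lieAlg N := by
      intro y
      refine (hNiff _).2 ⟨sub_mem (Ad_mem_lieAlg hB (fun b hb => ?_)
        (add_mem (hxB y) ((hNiff _).1 he).1)) (hxB y), superdiag_antitone P (by omega) (hg y)⟩
      have hgB := ((h.mem_unipotent_iff _).1 (hgN y)).1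
      exact B.mul_mem (B.mul_mem hgB hb) (B.inv_mem hgB)
    obtain ⟨Z, hZ, hZS⟩ := exists_adNilradical_eq hbr S hξ hδ hδS (E := fun y => ⟨_, hEN y⟩)
      (fun i j => by
        have h1 := matrix_mul_entry_mem S (matrix_mul_entry_mem S hgS (M' := fun y =>
          (ξ y : Matrix (Fin n) (Fin n) ℂ) + e) fun i j =>
            S.add_mem (hξ i j) (matrix_const_entry_mem S e i j)) hgS' i j
        exact S.sub_mem h1 (hξ i j))
    have hZ1 : ∀ y, (Z y : Matrix (Fin n) (Fin n) ℂ) ∈ superdiag P 1 := fun y =>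
      ((hNiff _).1 (Z y).2).2
    have hZk : ∀ y, (Z y : Matrix (Fin n) (Fin n) ℂ) ∈ superdiag P (k + 1) := by
      intro y
      refine mem_of_injective_of_map_mem ((discriminant_ne_zero_iff hbr _).1 (hδ y))
        (W := (superdiag P (k + 1)).comap (lieAlg N).subtype) (fun w hw => ?_) (z := Z y) ?_
      · have hx0 := h.lieAlg_le (hxB y)
        exact sub_mem (by simpa using! mul_mem_superdiag hx0 hw)
          (mul_mem_superdiag (l := 0) hw hx0)
      · rw [hZ]; exact hg y
    refine ⟨fun y => glExp (Z y : Matrix (Fin n) (Fin n) ℂ) * g y, fun y =>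
      N.mul_mem (glExp_mem hN (Z y).2) (hgN y), ?_, ?_, fun y => ?_⟩
    · simp only [Units.val_mul, glExp_coe]
      exact matrix_mul_entry_mem S (exp_entry_mem S hZS
        fun y => pow_eq_zero_of_mem_superdiag (hZ1 y)) hgS
    · simp only [mul_inv_rev, Units.val_mul, ← glExp_neg, glExp_coe]
      exact matrix_mul_entry_mem S hgS' (exp_entry_mem S (fun i j => S.neg_mem (hZS i j))
        fun y => pow_eq_zero_of_mem_superdiag (neg_mem (hZ1 y)))
    · have h1 := congrArg Subtype.val (hZ y)
      rw [adNilradical_apply] at h1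
      have h2 := Ad_exp_sub_mem_superdiag (h.lieAlg_le (hxB y)) (hg y) (hZk y) h1
      rwa [add_sub_cancel, ← Ad_mul] at h2

/-- Existence and rationality of `n_x`. -/
theorem IsTriangularForm.exists_Ad_eq (h : IsTriangularForm P B T N) (hB : IsZariskiClosed B)
    (hN : IsZariskiClosed N) (hTB : T ≤ B)
    (hbr : ∀ x ∈ lieAlg T, ∀ Y ∈ lieAlg N, x * Y - Y * x ∈ lieAlg N)
    {e : Matrix (Fin n) (Fin n) ℂ} (he : e ∈ lieAlg N) {Y : Type*}
    (S : Subalgebra ℂ (Y → ℂ)) {ξ : Y → lieAlg T}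
    (hξ : ∀ i j, (fun y => (ξ y : Matrix (Fin n) (Fin n) ℂ) i j) ∈ S)
    (hδ : ∀ y, discriminant hbr (ξ y) ≠ 0) (hδS : (fun y => (discriminant hbr (ξ y))⁻¹) ∈ S) :
    ∃ g : Y → N, (∀ i j, (fun y => ((g y : GL (Fin n) ℂ) : Matrix (Fin n) (Fin n) ℂ) i j) ∈ S) ∧
      (∀ i j, (fun y => (((g y : GL (Fin n) ℂ)⁻¹ : GL (Fin n) ℂ) :
        Matrix (Fin n) (Fin n) ℂ) i j) ∈ S) ∧
      ∀ y, Ad (g y : GL (Fin n) ℂ) (ξ y : Matrix (Fin n) (Fin n) ℂ) = ξ y + e := by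
  -- After n steps the error lies beyond the last superdiagonal, hence is zero. The conjugator takes
  -- x + e to x, so n_x is its inverse.
  obtain ⟨g, hgN, hgS, hgS', hg⟩ := h.exists_conj hB hN hTB hbr he S hξ hδ hδS n
  refine ⟨fun y => ⟨(g y)⁻¹, N.inv_mem (hgN y)⟩, hgS', by simpa using hgS, fun y => ?_⟩
  have h1 := eq_zero_of_mem_superdiag (superdiag_antitone P (Nat.le_succ n) (hg y))
  exact Ad_inv_eq.2 (sub_eq_zero.1 h1).symm

/-- Uniqueness of `n_x`. -/
theorem IsTriangularForm.eq_of_Ad_eq (h : IsTriangularForm P B T N)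
    (hbr : ∀ x ∈ lieAlg T, ∀ Y ∈ lieAlg N, x * Y - Y * x ∈ lieAlg N) {x : lieAlg T}
    (hδ : discriminant hbr x ≠ 0) {g g' : GL (Fin n) ℂ} (hg : g ∈ N) (hg' : g' ∈ N)
    (heq : Ad g (x : Matrix (Fin n) (Fin n) ℂ) = Ad g' x) : g = g' := by
  have hu : g'⁻¹ * g ∈ N := N.mul_mem (N.inv_mem hg') hg
  have hux : Ad (g'⁻¹ * g) (x : Matrix (Fin n) (Fin n) ℂ) = x := by
    rw [Ad_mul, heq, Ad_inv_eq]
  rw [Ad_eq_self_iff] at hux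
  have h1 : g'⁻¹ * g = 1 := by
    -- A candidate Y in Lie N is a polynomial in u - 1, so it commutes with x as u does, and
    -- injectivity of ad x makes it zero.
    refine eq_one_of_unipotent hu
      ⟨n, pow_eq_zero_of_mem_superdiag ((h.mem_unipotent_iff _).1 hu).2⟩ fun Y hY hYadj hYnil => ?_
    have hc : Commute (x : Matrix (Fin n) (Fin n) ℂ) Y := by
      clear hY hYnil
      induction hYadj using Algebra.adjoin_induction with
      | mem z hz =>
        rw [Set.mem_singleton_iff.1 hz]
        exact (show Commute (x : Matrix (Fin n) (Fin n) ℂ) _ from hux.symm).sub_right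
          (Commute.one_right _)
      | algebraMap r => exact (Algebra.commutes r _).symm
      | add a b _ _ ha hb => exact ha.add_right hb
      | mul a b _ _ ha hb => exact ha.mul_right hb
    have h2 : adNilradical hbr x ⟨Y, hY⟩ = 0 := by
      ext1
      rw [adNilradical_apply]
      exact sub_eq_zero.2 hc
    exact congrArg Subtype.val ((discriminant_ne_zero_iff hbr x).1 hδ (h2.trans (map_zero _).symm))
  exact (inv_mul_eq_one.1 h1).symm

/-! ### Regular elements -/

theorem IsTriangularForm.commute (h : IsTriangularForm P B T N) {t : GL (Fin n) ℂ} (ht : t ∈ T)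
    {x : Matrix (Fin n) (Fin n) ℂ} (hx : x ∈ lieAlg T) :
    Ad t x = x := by
  rw [Ad_eq_self_iff]
  have h1 := h.diag t ht
  have h2 := isDiag_Ad_of_mem_lieAlg h.diag hx
  have h3 : Ad P ((t : Matrix (Fin n) (Fin n) ℂ) * x) = Ad P (x * t) := by
    rw [Ad_matmul, Ad_matmul, ← h1.diagonal_diag, ← h2.diagonal_diag,
      Matrix.diagonal_mul_diagonal, Matrix.diagonal_mul_diagonal]
    congr 1; funext i; exact mul_comm _ _
  have h4 := congrArg (Ad P⁻¹) h3
  rwa [← Ad_mul, ← Ad_mul, inv_mul_cancel, Ad_one, Ad_one] at h4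

/-- Lie T is contained in Lie C_G(x) and regularity says that the dimensions agree, so the two are
equal; Y exponentiates into C_G(x). -/
theorem IsTriangularForm.mem_lieAlg_of_commute (h : IsTriangularForm P B T N)
    (hB : IsZariskiClosed B) (hTB : T ≤ B) {G : Subgroup (GL (Fin n) ℂ)} (hBG : B ≤ G)
    {x : lieAlg T} (hx : x ∈ regularSet G T) {Y : Matrix (Fin n) (Fin n) ℂ} (hY : Y ∈ lieAlg B)
    (hc : (x : Matrix (Fin n) (Fin n) ℂ) * Y = Y * x) : Y ∈ lieAlg T := by
  have hle : lieAlg T ≤ lieAlg (centralizerIn G (x : Matrix (Fin n) (Fin n) ℂ)) :=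
    lieAlg_mono fun t ht => ⟨hBG (hTB ht), h.commute ht x.2⟩
  rw [Submodule.eq_of_le_of_finrank_eq hle (Eq.symm hx)]
  refine mem_lieAlg_of_glExp_mem fun s => ⟨hBG (glExp_mem hB ((lieAlg B).smul_mem s hY)), ?_⟩
  rw [Ad_eq_self_iff]
  exact ((show Commute (x : Matrix (Fin n) (Fin n) ℂ) Y from hc).symm.smul_left s).exp_left

theorem IsTriangularForm.discriminant_ne_zero (h : IsTriangularForm P B T N)
    (hB : IsZariskiClosed B) (hN : IsZariskiClosed N) (hTB : T ≤ B)
    {G : Subgroup (GL (Fin n) ℂ)} (hBG : B ≤ G)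
    (hbr : ∀ x ∈ lieAlg T, ∀ Y ∈ lieAlg N, x * Y - Y * x ∈ lieAlg N)
    {x : lieAlg T} (hx : x ∈ regularSet G T) : discriminant hbr x ≠ 0 := by
  rw [discriminant_ne_zero_iff, injective_iff_map_eq_zero]
  intro Y hY
  have h1 := congrArg Subtype.val hY
  rw [adNilradical_apply] at h1
  have hYN := (h.mem_lieAlg_unipotent_iff hB hN).1 Y.2
  have hYT := h.mem_lieAlg_of_commute hB hTB hBG hx hYN.1 (sub_eq_zero.1 h1)
  have hd := isDiag_Ad_of_mem_lieAlg h.diag hYT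
  have h2 : Ad P (Y : Matrix (Fin n) (Fin n) ℂ) = 0 := by
    ext i j
    by_cases hij : i = j
    · subst hij; exact hYN.2 i i (by omega)
    · exact hd hij
  ext1
  rw [← Ad_one (Y : Matrix (Fin n) (Fin n) ℂ), ← inv_mul_cancel P, Ad_mul, h2]
  simp [Ad]

theorem IsTriangularForm.exists_mul_of_regular (h : IsTriangularForm P B T N)
    (hB : IsZariskiClosed B) (hBc : IsZariskiConnected B) (hT : IsZariskiClosed T)
    (hN : IsZariskiClosed N) (hTB : T ≤ B) {G : Subgroup (GL (Fin n) ℂ)} (hBG : B ≤ G)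
    {x : lieAlg T} (hx : x ∈ regularSet G T) {b : GL (Fin n) ℂ} (hb : b ∈ B) :
    ∃ t ∈ T, ∃ m ∈ N, b = t * m := by
  refine h.exists_mul hB hBc hT hTB (fun Y hY => ?_) hb
  have hbr : ∀ x ∈ lieAlg T, ∀ Y ∈ lieAlg N, x * Y - Y * x ∈ lieAlg N := fun x hx Y hY =>
    h.bracket_mem hB hN (lieAlg_mono hTB hx) hY
  have hxB := lieAlg_mono hTB x.2
  -- A bracket of triangular matrices is strictly triangular, so [x, Y] is in Lie N. Solving [x, Z]
  -- = [x, Y] in Lie N leaves Y - Z commuting with x, hence in Lie T.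
  have hE : (x : Matrix (Fin n) (Fin n) ℂ) * Y - Y * x ∈ lieAlg N := by
    refine (h.mem_lieAlg_unipotent_iff hB hN).2 ⟨bracket_mem_lieAlg hB hxB hY, ?_⟩
    have h1 := h.lieAlg_le hxB
    have h2 := h.lieAlg_le hY
    refine mem_superdiag_one_iff.2 ⟨sub_mem (mul_mem_superdiag (k := 0) (l := 0) h1 h2)
      (mul_mem_superdiag (k := 0) (l := 0) h2 h1), fun i => ?_⟩
    rw [Ad_sub, Matrix.sub_apply, Ad_mul_diag_of_mem_superdiag h1 h2,
      Ad_mul_diag_of_mem_superdiag h2 h1, mul_comm, sub_self]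
  obtain ⟨Z, hZ⟩ := LinearMap.injective_iff_surjective.1 ((discriminant_ne_zero_iff hbr x).1
    (h.discriminant_ne_zero hB hN hTB hBG hbr hx)) ⟨_, hE⟩
  have h1 := congrArg Subtype.val hZ
  rw [adNilradical_apply] at h1
  have hYZ : Y - Z ∈ lieAlg T := by
    refine h.mem_lieAlg_of_commute hB hTB hBG hx (sub_mem hY
      ((h.mem_lieAlg_unipotent_iff hB hN).1 Z.2).1) ?_
    rw [mul_sub, sub_mul, sub_eq_sub_iff_sub_eq_sub]
    exact h1.symm
  rw [← sub_add_cancel Y Z]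
  exact add_mem (Submodule.mem_sup_left hYZ) (Submodule.mem_sup_right Z.2)

theorem IsTriangularForm.eq_one_of_mem (h : IsTriangularForm P B T N) {g : GL (Fin n) ℂ}
    (hT : g ∈ T) (hN : g ∈ N) : g = 1 := by
  have h1 := diagPart_of_isDiag (h.diag g hT)
  rw [diagPart_eq_one ((h.mem_unipotent_iff g).1 hN).2] at h1
  exact Units.ext h1.symm

end LinAlgGroup

/-! ### Characters of the torus, polynomial functions and the graph of exp -/

namespace LinAlgGroup

/-! ### Weights and the exponential map -/

theorem differentiable_lieExp {n : ℕ} {H : Subgroup (GL (Fin n) ℂ)} (hH : IsZariskiClosed H)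
    (X : lieAlg H) {F : H → ℂ} (hF : F ∈ coordRing H) :
    Differentiable ℂ fun s : ℂ => F (lieExp hH (s • X)) := by
  have hd : ∀ (A : Matrix (Fin n) (Fin n) ℂ) i j,
      Differentiable ℂ fun s : ℂ => NormedSpace.exp (s • A) i j :=
    fun A i j s => (hasDerivAt_exp_smul_apply A s i j).differentiableAt
  induction hF using Algebra.adjoin_induction with
  | mem F hF =>
    obtain ⟨i, j, rfl | rfl⟩ := hF
    · exact hd X i j
    · have h1 : ∀ s : ℂ, (((lieExp hH (s • X))⁻¹ : H) : GL (Fin n) ℂ) =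
          glExp (s • (-X : Matrix (Fin n) (Fin n) ℂ)) := fun s => by
        rw [smul_neg, glExp_neg]; rfl
      simp only [h1, glExp_coe]
      exact hd _ i j
  | algebraMap r => exact differentiable_const r
  | add F G _ _ hF hG => exact hF.add hG
  | mul F G _ _ hF hG => exact hF.mul hG

theorem lieExp_add {n : ℕ} {H : Subgroup (GL (Fin n) ℂ)} (hH : IsZariskiClosed H)
    {X Y : lieAlg H} (h : Commute (X : Matrix (Fin n) (Fin n) ℂ) Y) :
    lieExp hH (X + Y) = lieExp hH X * lieExp hH Y :=
  Subtype.ext (glExp_add h)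

/-- The function s ↦ χ(exp sx) is a differentiable homomorphism from (ℂ, +), hence satisfies φ' = φ
· ⟨χ, x⟩ with φ(0) = 1. -/
theorem charFun_lieExp_smul {n : ℕ} {T : Subgroup (GL (Fin n) ℂ)} (hT : IsZariskiClosed T)
    (χ : weightLattice T) (x : lieAlg T) (s : ℂ) :
    charFun (χ : T →* ℂˣ) (lieExp hT (s • x)) = Complex.exp (s * differential hT χ x) := by
  set φ : ℂ → ℂ := fun s => charFun (χ : T →* ℂˣ) (lieExp hT (s • x)) with hφ
  have hd : Differentiable ℂ φ := differentiable_lieExp hT x χ.2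
  have hadd : ∀ s u, φ (s + u) = φ s * φ u := by
    intro s u
    have h1 : lieExp hT ((s + u) • x) = lieExp hT (s • x) * lieExp hT (u • x) := by
      rw [add_smul]
      exact lieExp_add hT (((Commute.refl _).smul_left s).smul_right u)
    simp only [hφ, charFun, h1, map_mul, Units.val_mul]
  have h0 : φ 0 = 1 := by
    have h1 : lieExp hT ((0 : ℂ) • x) = 1 := Subtype.ext (by simp [lieExp, glExp_zero])
    simp only [hφ, charFun, h1, map_one, Units.val_one]
  have hder : ∀ s, HasDerivAt φ (φ s * differential hT χ x) s := by
    intro s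
    have h1 : HasDerivAt φ (differential hT χ x) (s - s) := by
      rw [sub_self]; exact (hd 0).hasDerivAt
    have h2 := (HasDerivAt.comp_sub_const s s h1).const_mul (φ s)
    refine h2.congr_of_eventuallyEq (Filter.Eventually.of_forall fun u => ?_)
    change φ u = φ s * φ (u - s)
    rw [← hadd, add_sub_cancel]
  have h3 : ∀ s, HasDerivAt (fun s => φ s * Complex.exp (-(s * differential hT χ x))) 0 s := by
    intro s
    refine ((hder s).mul ((((hasDerivAt_id s).mul_const (differential hT χ x)).neg).cexp)).congr_deriv ?_
    simp only [id]
    ring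
  have h4 := is_const_of_deriv_eq_zero (fun s => (h3 s).differentiableAt)
    (fun s => (h3 s).deriv) s 0
  simp only [h0, zero_mul, neg_zero, Complex.exp_zero, mul_one] at h4
  change φ s = _
  rw [Complex.exp_neg] at h4
  exact (mul_inv_eq_one₀ (Complex.exp_ne_zero _)).1 h4

theorem charFun_lieExp {n : ℕ} {T : Subgroup (GL (Fin n) ℂ)} (hT : IsZariskiClosed T)
    (χ : weightLattice T) (x : lieAlg T) :
    charFun (χ : T →* ℂˣ) (lieExp hT x) = Complex.exp (differential hT χ x) := by
  simpa using charFun_lieExp_smul hT χ x 1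

theorem differential_eq_of_forall {n : ℕ} {T : Subgroup (GL (Fin n) ℂ)} (hT : IsZariskiClosed T)
    (χ : weightLattice T) (x : lieAlg T) {a : ℂ}
    (h : ∀ s : ℂ, charFun (χ : T →* ℂˣ) (lieExp hT (s • x)) = Complex.exp (s * a)) :
    differential hT χ x = a := by
  have h1 : HasDerivAt (fun s : ℂ => Complex.exp (s * a)) a 0 := by
    simpa using ((hasDerivAt_id (0 : ℂ)).mul_const a).cexp
  rw [differential, funext h, h1.deriv]

theorem IsTorus.commute_lieAlg {n : ℕ} {T : Subgroup (GL (Fin n) ℂ)} (hT : IsTorus T)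
    (x y : lieAlg T) : Commute (x : Matrix (Fin n) (Fin n) ℂ) y := by
  obtain ⟨P, hP⟩ := hT.diagonalizable
  have h1 := isDiag_Ad_of_mem_lieAlg hP x.2
  have h2 := isDiag_Ad_of_mem_lieAlg hP y.2
  have h3 : Ad P ((x : Matrix (Fin n) (Fin n) ℂ) * y) = Ad P (y * x) := by
    rw [Ad_matmul, Ad_matmul, ← h1.diagonal_diag, ← h2.diagonal_diag,
      Matrix.diagonal_mul_diagonal, Matrix.diagonal_mul_diagonal]
    congr 1; funext i; exact mul_comm _ _
  have h4 := congrArg (Ad P⁻¹) h3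
  rwa [← Ad_mul, ← Ad_mul, inv_mul_cancel, Ad_one, Ad_one] at h4

/-- The differential of a weight, as a linear form. -/
noncomputable def differentialₗ {n : ℕ} {T : Subgroup (GL (Fin n) ℂ)} (hT : IsTorus T)
    (χ : weightLattice T) : Module.Dual ℂ (lieAlg T) where
  toFun := differential hT.closed χ
  map_add' x y := differential_eq_of_forall _ _ _ fun s => by
    rw [smul_add, lieExp_add _ (((hT.commute_lieAlg x y).smul_left s).smul_right s), mul_add,
      Complex.exp_add, ← charFun_lieExp_smul, ← charFun_lieExp_smul]
    simp [charFun]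
  map_smul' c x := differential_eq_of_forall _ _ _ fun s => by
    rw [smul_smul, charFun_lieExp_smul]
    simp [mul_assoc]

theorem differentialₗ_apply {n : ℕ} {T : Subgroup (GL (Fin n) ℂ)} (hT : IsTorus T)
    (χ : weightLattice T) (x : lieAlg T) : differentialₗ hT χ x = differential hT.closed χ x := rfl

/-- The differentiation of weights, as a homomorphism of groups. -/
noncomputable def differentialHom {n : ℕ} {T : Subgroup (GL (Fin n) ℂ)} (hT : IsTorus T) :
    Additive (weightLattice T) →+ Module.Dual ℂ (lieAlg T) :=
  AddMonoidHom.mk' (fun χ => differentialₗ hT χ.toMul) fun χ η => LinearMap.ext fun x =>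
    differential_eq_of_forall hT.closed _ _ fun s => by
      rw [LinearMap.add_apply, differentialₗ_apply, differentialₗ_apply, mul_add, Complex.exp_add,
        ← charFun_lieExp_smul, ← charFun_lieExp_smul]
      simp [charFun]

/-- The kernel of χ is a closed subgroup that contains exp(Lie T), so it is T because T is
connected. -/
theorem eq_one_of_differential_eq_zero {n : ℕ} {T : Subgroup (GL (Fin n) ℂ)} (hT : IsTorus T)
    {χ : weightLattice T} (h : differentialₗ hT χ = 0) : χ = 1 := by
  have hres : ∀ F ∈ coordRing T, ∃ F' ∈ regularGL n, ∀ t : T, F t = F' t := by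
    intro F hF
    induction hF using Algebra.adjoin_induction with
    | mem F hF =>
      obtain ⟨i, j, rfl | rfl⟩ := hF
      · exact ⟨_, entry_mem_regularGL i j, fun t => rfl⟩
      · exact ⟨_, inv_entry_mem_regularGL i j, fun t => rfl⟩
    | algebraMap r => exact ⟨_, (regularGL n).algebraMap_mem r, fun t => rfl⟩
    | add F G _ _ hF hG =>
      obtain ⟨F', h1, h2⟩ := hF
      obtain ⟨G', h3, h4⟩ := hG
      exact ⟨_, add_mem h1 h3, fun t => by simp [h2, h4]⟩
    | mul F G _ _ hF hG =>
      obtain ⟨F', h1, h2⟩ := hF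
      obtain ⟨G', h3, h4⟩ := hG
      exact ⟨_, mul_mem h1 h3, fun t => by simp [h2, h4]⟩
  obtain ⟨F, hF, hFχ⟩ := hres _ χ.2
  let K : Subgroup (GL (Fin n) ℂ) := (χ : T →* ℂˣ).ker.map T.subtype
  have hKT : K ≤ T := Subgroup.map_subtype_le _
  have hK : IsZariskiClosed K := by
    refine isZariskiClosed_of_regularGL fun g hg => ?_
    have hgT : g ∈ T := mem_of_regularGL hT.closed fun F hF hFT => hg F hF fun k hk => hFT k (hKT hk)
    have h1 := hg (F - 1) (sub_mem hF (one_mem _)) (by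
      rintro _ ⟨t, ht, rfl⟩
      have h2 := hFχ t
      rw [charFun, MonoidHom.mem_ker.1 ht, Units.val_one] at h2
      simp [← h2])
    refine ⟨⟨g, hgT⟩, ?_, rfl⟩
    have h2 := hFχ ⟨g, hgT⟩
    rw [SetLike.mem_coe, MonoidHom.mem_ker]
    ext1
    exact h2.trans (sub_eq_zero.1 h1)
  have hKT' : K = T := by
    refine eq_of_lieAlg_le hK hT.connected hKT fun x hx => mem_lieAlg_of_glExp_mem fun s => ?_
    refine ⟨lieExp hT.closed (s • ⟨x, hx⟩), ?_, rfl⟩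
    rw [SetLike.mem_coe, MonoidHom.mem_ker]
    ext1
    refine (charFun_lieExp_smul hT.closed χ _ s).trans ?_
    rw [← differentialₗ_apply hT, h]
    simp
  refine Subtype.ext (MonoidHom.ext fun t => ?_)
  obtain ⟨t', ht', h'⟩ := (hKT'.symm ▸ t.2 : (t : GL (Fin n) ℂ) ∈ K)
  obtain rfl : t' = t := Subtype.ext h'
  exact ht'

theorem differentialₗ_injective {n : ℕ} {T : Subgroup (GL (Fin n) ℂ)} (hT : IsTorus T) :
    Function.Injective (differentialₗ hT) := by
  have h : Function.Injective (differentialHom hT) :=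
    (injective_iff_map_eq_zero _).2 fun χ hχ =>
      congrArg Additive.ofMul (eq_one_of_differential_eq_zero hT (χ := χ.toMul) hχ)
  exact fun a b hab => congrArg Additive.toMul (@h (Additive.ofMul a) (Additive.ofMul b) hab)

theorem differentialₗ_prod_zpow {n : ℕ} {T : Subgroup (GL (Fin n) ℂ)} (hT : IsTorus T)
    {I : Type*} [Fintype I] (α : I → weightLattice T) (m : I → ℤ) :
    differentialₗ hT (∏ i, α i ^ m i) = ∑ i, m i • differentialₗ hT (α i) := by
  have h := map_sum (differentialHom hT) (fun i => m i • Additive.ofMul (α i)) Finset.univ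
  simp only [map_zsmul] at h
  exact h

theorem sum_differential_eq {n : ℕ} {T : Subgroup (GL (Fin n) ℂ)} (hT : IsTorus T)
    {I : Type*} [Fintype I] (α : I → weightLattice T) (m : I → ℤ) :
    (∑ i, m i • differential hT.closed (α i)) = ⇑(∑ i, m i • differentialₗ hT (α i)) := by
  funext x
  simp [differentialₗ_apply]

/-! ### Polynomial functions on a vector space -/

section polyRing

variable {V : Type*} [AddCommGroup V] [Module ℂ V]

theorem dual_mem_polyRing (φ : Module.Dual ℂ V) : (φ : V → ℂ) ∈ polyRing V :=
  Algebra.subset_adjoin ⟨φ, rfl⟩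

theorem exists_polynomial_of_mem_polyRing {p : V → ℂ} (hp : p ∈ polyRing V) (x y : V) :
    ∃ q : Polynomial ℂ, ∀ z : ℂ, p (x + z • y) = q.eval z := by
  induction hp using Algebra.adjoin_induction with
  | mem p hp =>
    obtain ⟨φ, rfl⟩ := hp
    exact ⟨Polynomial.C (φ x) + Polynomial.C (φ y) * Polynomial.X, fun z => by
      simp [mul_comm (φ y)]⟩
  | algebraMap r => exact ⟨Polynomial.C r, fun z => by simp⟩
  | add p p' _ _ h h' =>
    obtain ⟨q, hq⟩ := h
    obtain ⟨q', hq'⟩ := h'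
    exact ⟨q + q', fun z => by simp [hq, hq']⟩
  | mul p p' _ _ h h' =>
    obtain ⟨q, hq⟩ := h
    obtain ⟨q', hq'⟩ := h'
    exact ⟨q * q', fun z => by simp [hq, hq']⟩

/-- Restrict to the line from a point x with p(x) ≠ 0 to a given y; polynomials in one variable form
a domain. -/
theorem eq_zero_of_mul_eq_zero_of_mem_polyRing {p q : V → ℂ} (hp : p ∈ polyRing V)
    (hq : q ∈ polyRing V) (hp0 : p ≠ 0) (h : p * q = 0) : q = 0 := by
  obtain ⟨x, hx⟩ := Function.ne_iff.1 hp0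
  funext y
  obtain ⟨a, ha⟩ := exists_polynomial_of_mem_polyRing hp x (y - x)
  obtain ⟨b, hb⟩ := exists_polynomial_of_mem_polyRing hq x (y - x)
  have hab : a * b = 0 := Polynomial.funext fun z => by
    rw [Polynomial.eval_mul, ← ha, ← hb]
    simpa using! congrFun h (x + z • (y - x))
  rcases mul_eq_zero.1 hab with h0 | h0
  · have := ha 0
    simp [h0] at this
    exact absurd this hx
  · have := hb 1
    simpa [h0] using this

end polyRing

/-! ### Exponential polynomials -/

/-- The space of entire functions. -/
def entireFunctions : Submodule ℂ (ℂ → ℂ) where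
  carrier := {f | Differentiable ℂ f}
  zero_mem' := differentiable_const 0
  add_mem' hf hg := Differentiable.add hf hg
  smul_mem' c _ hf := Differentiable.const_smul hf c

/-- The derivative, as an endomorphism of the space of entire functions. -/
noncomputable def entireDeriv : Module.End ℂ entireFunctions where
  toFun f := ⟨deriv f.1, Differentiable.deriv f.2⟩
  map_add' f g := Subtype.ext (funext fun z => deriv_add (f.2 z) (g.2 z))
  map_smul' c f := Subtype.ext (funext fun z => deriv_const_smul c (f.2 z))

/-- The function `z ↦ q(z) e^{az}`. -/
noncomputable def expPoly (a : ℂ) (q : Polynomial ℂ) : entireFunctions :=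
  ⟨fun z => q.eval z * Complex.exp (z * a), q.differentiable.mul
    ((differentiable_id.mul_const a).cexp)⟩

theorem entireDeriv_sub_expPoly (a : ℂ) (q : Polynomial ℂ) :
    (entireDeriv - a • (1 : Module.End ℂ entireFunctions)) (expPoly a q) =
      expPoly a (Polynomial.derivative q) := by
  refine Subtype.ext (funext fun z => ?_)
  have h1 := (q.hasDerivAt z).mul (((hasDerivAt_id z).mul_const a).cexp)
  change deriv (fun z => q.eval z * Complex.exp (z * a)) z -
    a * (q.eval z * Complex.exp (z * a)) = _
  rw [(show HasDerivAt (fun z => q.eval z * Complex.exp (z * a)) _ z from h1).deriv]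
  simp only [expPoly, id]
  ring

theorem expPoly_mem_maxGenEigenspace (a : ℂ) (q : Polynomial ℂ) :
    expPoly a q ∈ entireDeriv.maxGenEigenspace a := by
  rw [Module.End.mem_maxGenEigenspace]
  have h1 : ∀ k, ((entireDeriv - a • (1 : Module.End ℂ entireFunctions)) ^ k) (expPoly a q) =
      expPoly a (Polynomial.derivative^[k] q) := by
    intro k
    induction k with
    | zero => rfl
    | succ k ih =>
      rw [pow_succ', Module.End.mul_apply, ih, entireDeriv_sub_expPoly,
        Function.iterate_succ_apply']
  refine ⟨q.natDegree + 1, ?_⟩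
  rw [h1, Polynomial.iterate_derivative_eq_zero (Nat.lt_succ_self _)]
  exact Subtype.ext (funext fun z => by simp [expPoly])

/-- The functions q(z) e^{az} are generalized eigenvectors of d/dz for the eigenvalue a, and
generalized eigenspaces for distinct eigenvalues are independent. -/
theorem eq_zero_of_sum_expPoly_eq_zero {ι : Type*} {s : Finset ι} {a : ι → ℂ}
    (ha : Set.InjOn a s) {q : ι → Polynomial ℂ}
    (h : ∀ z, ∑ i ∈ s, (q i).eval z * Complex.exp (z * a i) = 0) {i : ι} (hi : i ∈ s) :
    q i = 0 := by
  classical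
  have h1 := (iSupIndep_iff_finsetSum_eq_zero_imp_eq_zero _).1
    ((Module.End.independent_maxGenEigenspace entireDeriv).comp
      (f := fun j : s => a j) (fun j k hjk => Subtype.ext (ha j.2 k.2 hjk))) Finset.univ
      (fun j => expPoly (a j) (q j)) (fun j _ => expPoly_mem_maxGenEigenspace _ _) (by
        refine Subtype.ext (funext fun z => ?_)
        have h2 := h z
        rw [← Finset.sum_coe_sort] at h2
        simpa [expPoly] using! h2) ⟨i, hi⟩ (Finset.mem_univ _)
  refine Polynomial.funext fun z => ?_
  have h2 := congrFun (congrArg Subtype.val h1) z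
  simpa [expPoly] using h2

/-! ### Density of the graph of the exponential map -/

/-- The elements of a matrix algebra that are diagonalized by `P`, evaluated at one coordinate. -/
noncomputable def diagChar {n : ℕ} {T : Subgroup (GL (Fin n) ℂ)} {P : GL (Fin n) ℂ}
    (hP : ∀ t ∈ T, (Ad P (t : Matrix (Fin n) (Fin n) ℂ)).IsDiag) (k : Fin n) : T →* ℂˣ :=
  MonoidHom.toHomUnits
    { toFun := fun t => Ad P ((t : GL (Fin n) ℂ) : Matrix (Fin n) (Fin n) ℂ) k k
      map_one' := by simp [Ad_one_right]
      map_mul' := fun t t' => by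
        have h1 := (hP t t.2).diagonal_diag
        have h2 := (hP t' t'.2).diagonal_diag
        rw [Subgroup.coe_mul, Units.val_mul, Ad_matmul, ← h1, ← h2, Matrix.diagonal_mul_diagonal]
        simp }

theorem diagChar_mem {n : ℕ} {T : Subgroup (GL (Fin n) ℂ)} {P : GL (Fin n) ℂ}
    (hP : ∀ t ∈ T, (Ad P (t : Matrix (Fin n) (Fin n) ℂ)).IsDiag) (k : Fin n) :
    diagChar hP k ∈ weightLattice T := by
  exact matrix_mul_entry_mem (coordRing T) (matrix_mul_entry_mem (coordRing T)
    (matrix_const_entry_mem _ _) fun i j => Algebra.subset_adjoin ⟨i, j, Or.inl rfl⟩)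
    (matrix_const_entry_mem _ _) k k

theorem entry_eq_sum_diagChar {n : ℕ} {T : Subgroup (GL (Fin n) ℂ)} {P : GL (Fin n) ℂ}
    (hP : ∀ t ∈ T, (Ad P (t : Matrix (Fin n) (Fin n) ℂ)).IsDiag) (t : T) (i j : Fin n) :
    ((t : GL (Fin n) ℂ) : Matrix (Fin n) (Fin n) ℂ) i j = ∑ k,
      ((P⁻¹ : GL (Fin n) ℂ) : Matrix (Fin n) (Fin n) ℂ) i k * (P : Matrix (Fin n) (Fin n) ℂ) k j *
        charFun (diagChar hP k) t := by
  have h1 : ((t : GL (Fin n) ℂ) : Matrix (Fin n) (Fin n) ℂ) =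
      Ad P⁻¹ (Ad P ((t : GL (Fin n) ℂ) : Matrix (Fin n) (Fin n) ℂ)) := by
    rw [← Ad_mul, inv_mul_cancel, Ad_one]
  rw [h1, ← (hP t t.2).diagonal_diag, Ad, inv_inv, Matrix.mul_apply]
  refine Finset.sum_congr rfl fun k _ => ?_
  rw [Matrix.mul_diagonal]
  change _ * Ad P ((t : GL (Fin n) ℂ) : Matrix (Fin n) (Fin n) ℂ) k k * _ =
    _ * Ad P ((t : GL (Fin n) ℂ) : Matrix (Fin n) (Fin n) ℂ) k k
  ring

/-- The character functions span the algebra of regular functions of a torus. -/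
theorem IsTorus.coordRing_le {n : ℕ} {T : Subgroup (GL (Fin n) ℂ)} (hT : IsTorus T)
    {S : Subalgebra ℂ (T → ℂ)} (hS : ∀ χ : weightLattice T, charFun (χ : T →* ℂˣ) ∈ S) :
    coordRing T ≤ S := by
  obtain ⟨P, hP⟩ := hT.diagonalizable
  refine Algebra.adjoin_le ?_
  have h1 : ∀ k, charFun (diagChar hP k) ∈ S := fun k => hS ⟨_, diagChar_mem hP k⟩
  have h2 : ∀ k, (fun t => charFun (diagChar hP k) t⁻¹) ∈ S := fun k => by
    have h := hS (⟨_, diagChar_mem hP k⟩⁻¹)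
    have h3 : (fun t => charFun (diagChar hP k) t⁻¹) =
        charFun ((⟨_, diagChar_mem hP k⟩⁻¹ : weightLattice T) : T →* ℂˣ) := by
      funext t
      simp [charFun]
    rwa [h3]
  rintro F ⟨i, j, rfl | rfl⟩
  · simp only [entry_eq_sum_diagChar hP _ i j]
    have h3 := S.sum_mem (t := Finset.univ) fun k _ => S.smul_mem (h1 k)
      (((P⁻¹ : GL (Fin n) ℂ) : Matrix (Fin n) (Fin n) ℂ) i k * (P : Matrix (Fin n) (Fin n) ℂ) k j)
    rw [SetLike.mem_coe]
    convert h3 using 1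
    funext t
    simp
  · simp only [entry_eq_sum_diagChar hP _ i j]
    have h3 := S.sum_mem (t := Finset.univ) fun k _ => S.smul_mem (h2 k)
      (((P⁻¹ : GL (Fin n) ℂ) : Matrix (Fin n) (Fin n) ℂ) i k * (P : Matrix (Fin n) (Fin n) ℂ) k j)
    rw [SetLike.mem_coe]
    convert h3 using 1
    funext t
    simp

/-- The group algebra of the weight lattice over ℂ[V] maps onto an algebra that contains both kinds
of generators, since characters generate ℂ[T]. -/
theorem exists_sum_of_mem_prodRing {V : Type*} [AddCommGroup V] [Module ℂ V] {n : ℕ}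
    {T : Subgroup (GL (Fin n) ℂ)} (hT : IsTorus T) {F : V × T → ℂ} (hF : F ∈ prodRing V T) :
    ∃ c : weightLattice T →₀ polyRing V, ∀ z, F z =
      c.sum fun χ q => (q : V → ℂ) z.1 * charFun (χ : T →* ℂˣ) z.2 := by
  let A : polyRing V →ₐ[ℂ] (V × T → ℂ) :=
    { toFun := fun p z => (p : V → ℂ) z.1
      map_one' := rfl, map_mul' := fun _ _ => rfl, map_zero' := rfl, map_add' := fun _ _ => rfl
      commutes' := fun _ => rfl }
  let g : weightLattice T →* (V × T → ℂ) :=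
    { toFun := fun χ z => charFun (χ : T →* ℂˣ) z.2
      map_one' := by funext z; simp [charFun]
      map_mul' := fun χ η => by funext z; simp [charFun] }
  let Φ := MonoidAlgebra.liftNCAlgHom A g fun _ _ => Commute.all _ _
  have hle : prodRing V T ≤ Φ.range := by
    refine Algebra.adjoin_le ?_
    rintro F (⟨p, hp, rfl⟩ | ⟨q, hq, rfl⟩)
    · refine ⟨MonoidAlgebra.single 1 ⟨p, hp⟩, ?_⟩
      change MonoidAlgebra.liftNC _ _ _ = _
      rw [MonoidAlgebra.liftNC_single, map_one, mul_one]
      rfl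
    · let C : (T → ℂ) →ₐ[ℂ] (V × T → ℂ) :=
        { toFun := fun q z => q z.2
          map_one' := rfl, map_mul' := fun _ _ => rfl, map_zero' := rfl
          map_add' := fun _ _ => rfl, commutes' := fun _ => rfl }
      refine (hT.coordRing_le (S := Φ.range.comap C) fun χ => ?_) hq
      refine ⟨MonoidAlgebra.single χ 1, ?_⟩
      change MonoidAlgebra.liftNC _ _ _ = _
      rw [MonoidAlgebra.liftNC_single]
      exact (congrArg (· * _) (map_one A)).trans (one_mul _)
  obtain ⟨c, hc⟩ := hle hF
  refine ⟨c.coeff, fun z => ?_⟩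
  rw [← hc]
  change (c.coeff.sum fun χ q => A q * g χ) z = _
  simp only [Finsupp.sum, Finset.sum_apply]
  rfl

/-- A regular function on `𝔱 × T` is determined by its values at the points `(x, exp x)`. -/
theorem eq_zero_of_graph_eq_zero {n : ℕ} {T : Subgroup (GL (Fin n) ℂ)} (hT : IsTorus T)
    {F : lieAlg T × T → ℂ} (hF : F ∈ prodRing (lieAlg T) T)
    (h : ∀ x, F (x, lieExp hT.closed x) = 0) : F = 0 := by
  obtain ⟨c, hc⟩ := exists_sum_of_mem_prodRing hT hF
  -- A direction y on which the finitely many weights of F take distinct values. On each line x + zy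
  -- the function becomes an exponential polynomial with distinct frequencies, so all coefficients
  -- vanish there.
  obtain ⟨y, hy⟩ := Module.Dual.exists_forall_ne_zero_of_forall_exists
    (fun p : {p : c.support × c.support // p.1 ≠ p.2} =>
      differentialₗ hT p.1.1 - differentialₗ hT p.1.2) (by
      rintro ⟨p, hp⟩
      by_contra! h0
      exact hp (Subtype.ext (differentialₗ_injective hT (sub_eq_zero.1 (LinearMap.ext h0)))))
  have hinj : Set.InjOn (fun χ => differentialₗ hT χ y) c.support := by
    intro χ hχ η hη hχη
    by_contra hne
    refine hy ⟨(⟨χ, hχ⟩, ⟨η, hη⟩), fun h0 => hne (congrArg Subtype.val h0)⟩ ?_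
    exact sub_eq_zero.2 hχη
  have h0 : ∀ χ ∈ c.support, ∀ x, (c χ : lieAlg T → ℂ) x = 0 := by
    intro χ hχ x
    choose q hq using fun χ => exists_polynomial_of_mem_polyRing (c χ).2 x y
    have h1 := eq_zero_of_sum_expPoly_eq_zero hinj (q := fun χ =>
      Polynomial.C (Complex.exp (differentialₗ hT χ x)) * q χ) (fun z => by
        have h2 := h (x + z • y)
        rw [hc] at h2
        rw [← h2, Finsupp.sum]
        refine Finset.sum_congr rfl fun η _ => ?_
        rw [charFun_lieExp, ← differentialₗ_apply hT, map_add, map_smul, Complex.exp_add, hq,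
          Polynomial.eval_mul, Polynomial.eval_C, smul_eq_mul]
        ring) hχ
    have h2 : q χ = 0 := by
      simpa [Complex.exp_ne_zero] using h1
    have h3 := hq χ 0
    simpa [h2] using h3
  funext z
  rw [hc, Finsupp.sum, Finset.sum_eq_zero fun χ hχ => by rw [h0 χ hχ, zero_mul]]
  rfl

end LinAlgGroup

/-! ### Expansion of a function along a curve -/

namespace LinAlgGroup

open MvPolynomial

/-! ### Invariant vector fields -/

theorem derivation_sum_apply {A ι : Type*} [CommRing A] [Algebra ℂ A] (s : Finset ι)
    (D : ι → Derivation ℂ A A) (a : A) : (∑ i ∈ s, D i) a = ∑ i ∈ s, D i a := by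
  rw [← Finset.sum_apply]
  exact congrFun (map_sum (Derivation.coeFnAddMonoidHom (R := ℂ) (A := A) (M := A)) D s) a

/-- The left invariant vector field of `X`, as a derivation. -/
noncomputable def leftInvDerivation {n : ℕ} (X : Matrix (Fin n) (Fin n) ℂ) :
    Derivation ℂ (MvPolynomial (Fin n × Fin n) ℂ) (MvPolynomial (Fin n × Fin n) ℂ) :=
  ∑ ij : Fin n × Fin n, (∑ k, MvPolynomial.X (ij.1, k) * C (X k ij.2)) • pderiv ij

theorem leftInvDerivation_apply {n : ℕ} (X : Matrix (Fin n) (Fin n) ℂ)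
    (p : MvPolynomial (Fin n × Fin n) ℂ) : leftInvDerivation X p = leftInvField X p := by
  simp [leftInvDerivation, leftInvField, derivation_sum_apply]

theorem leftInvDerivation_X {n : ℕ} (X : Matrix (Fin n) (Fin n) ℂ) (i j : Fin n) :
    leftInvDerivation X (MvPolynomial.X (i, j)) = ∑ k, MvPolynomial.X (i, k) * C (X k j) := by
  simp only [leftInvDerivation, derivation_sum_apply, Derivation.smul_apply,
    pderiv_X, smul_eq_mul]
  rw [Finset.sum_eq_single (i, j)]
  · simp
  · intro b _ hb
    simp [hb.symm]
  · simp

/-- The right invariant vector field of `X`, as a derivation. -/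
noncomputable def rightInvDerivation {n : ℕ} (X : Matrix (Fin n) (Fin n) ℂ) :
    Derivation ℂ (MvPolynomial (Fin n × Fin n) ℂ) (MvPolynomial (Fin n × Fin n) ℂ) :=
  ∑ ij : Fin n × Fin n, (∑ k, C (X ij.1 k) * MvPolynomial.X (k, ij.2)) • pderiv ij

theorem rightInvDerivation_X {n : ℕ} (X : Matrix (Fin n) (Fin n) ℂ) (i j : Fin n) :
    rightInvDerivation X (MvPolynomial.X (i, j)) = ∑ k, C (X i k) * MvPolynomial.X (k, j) := by
  simp only [rightInvDerivation, derivation_sum_apply, Derivation.smul_apply,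
    pderiv_X, smul_eq_mul]
  rw [Finset.sum_eq_single (i, j)]
  · simp
  · intro b _ hb
    simp [hb.symm]
  · simp

theorem evalAt_rightInvDerivation {n : ℕ} (A X : Matrix (Fin n) (Fin n) ℂ)
    (p : MvPolynomial (Fin n × Fin n) ℂ) :
    evalAt A (rightInvDerivation X p) =
      ∑ ij : Fin n × Fin n, (X * A) ij.1 ij.2 * evalAt A (pderiv ij p) := by
  simp [evalAt, rightInvDerivation, derivation_sum_apply, Matrix.mul_apply]

/-- Left and right translations commute; the commutator is a derivation, so it is enough to compare
values on the coordinates. -/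
theorem leftInvField_rightInvDerivation {n : ℕ} (X Y : Matrix (Fin n) (Fin n) ℂ)
    (p : MvPolynomial (Fin n × Fin n) ℂ) :
    leftInvField X (rightInvDerivation Y p) = rightInvDerivation Y (leftInvField X p) := by
  have h : ⁅leftInvDerivation X, rightInvDerivation Y⁆ = 0 := by
    refine derivation_ext fun ij => ?_
    rw [Derivation.commutator_apply, rightInvDerivation_X, leftInvDerivation_X]
    simp only [map_sum, Derivation.leibniz, leftInvDerivation_X, rightInvDerivation_X,
      Derivation.zero_apply, smul_eq_mul]
    simp only [← algebraMap_eq, Derivation.map_algebraMap, mul_zero, add_zero, zero_add]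
    simp only [Finset.mul_sum]
    rw [Finset.sum_comm, sub_eq_zero]
    exact Finset.sum_congr rfl fun _ _ => Finset.sum_congr rfl fun _ _ => by ring
  have h1 := congrArg (fun D => D p) h
  simp only [Derivation.commutator_apply, Derivation.zero_apply, leftInvDerivation_apply] at h1
  exact sub_eq_zero.1 h1

/-! ### The coefficients `⟨e_𝐢, f⟩` -/

/-- The filtration of an algebra by the number of derivations that kill an element. -/
def nilFiltration {A I : Type*} [CommRing A] [Algebra ℂ A] (D : I → Derivation ℂ A A) :
    ℕ → Submodule ℂ A
  | 0 => ⊥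
  | k + 1 => ⨅ i, (nilFiltration D k).comap (D i : A →ₗ[ℂ] A)

theorem mem_nilFiltration_succ {A I : Type*} [CommRing A] [Algebra ℂ A]
    {D : I → Derivation ℂ A A} {k : ℕ} {a : A} :
    a ∈ nilFiltration D (k + 1) ↔ ∀ i, D i a ∈ nilFiltration D k := by
  simp [nilFiltration]

theorem nilFiltration_le_succ {A I : Type*} [CommRing A] [Algebra ℂ A]
    (D : I → Derivation ℂ A A) (k : ℕ) : nilFiltration D k ≤ nilFiltration D (k + 1) := by
  induction k with
  | zero => exact bot_le
  | succ k ih =>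
    intro a ha
    exact mem_nilFiltration_succ.2 fun i => ih (mem_nilFiltration_succ.1 ha i)

theorem nilFiltration_mono {A I : Type*} [CommRing A] [Algebra ℂ A]
    (D : I → Derivation ℂ A A) : Monotone (nilFiltration D) :=
  monotone_nat_of_le_succ (nilFiltration_le_succ D)

theorem mul_mem_nilFiltration {A I : Type*} [CommRing A] [Algebra ℂ A]
    (D : I → Derivation ℂ A A) (m : ℕ) : ∀ {k l : ℕ} {a b : A}, k + l = m →
      a ∈ nilFiltration D k → b ∈ nilFiltration D l → a * b ∈ nilFiltration D m := by
  induction m with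
  | zero =>
    intro k l a b h ha hb
    obtain rfl : k = 0 := by omega
    rw [(Submodule.mem_bot ℂ).1 ha, zero_mul]
    exact zero_mem _
  | succ m ih =>
    intro k l a b h ha hb
    rcases k with _ | k
    · rw [(Submodule.mem_bot ℂ).1 ha, zero_mul]
      exact zero_mem _
    rcases l with _ | l
    · rw [(Submodule.mem_bot ℂ).1 hb, mul_zero]
      exact zero_mem _
    refine mem_nilFiltration_succ.2 fun i => ?_
    rw [Derivation.leibniz, smul_eq_mul, smul_eq_mul, mul_comm b]
    exact add_mem (ih (by omega) ha (mem_nilFiltration_succ.1 hb i))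
      (ih (by omega) (mem_nilFiltration_succ.1 ha i) hb)

/-- The derivation of E_i sends an entry of M·X to the same entry of (M E_i)·X, and multiplication
by E_i moves M one superdiagonal up. So n derivations kill the coordinates, and the Leibniz rule
extends nilpotency to all polynomials. -/
theorem exists_mem_nilFiltration {n : ℕ} {P : GL (Fin n) ℂ} {I : Type*}
    {E : I → Matrix (Fin n) (Fin n) ℂ} (hE : ∀ i, E i ∈ superdiag P 1)
    (p : MvPolynomial (Fin n × Fin n) ℂ) :
    ∃ k, p ∈ nilFiltration (fun i => rightInvDerivation (E i)) k := by
  have hX : ∀ (k j : ℕ) (M : Matrix (Fin n) (Fin n) ℂ), n ≤ j + k → M ∈ superdiag P j →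
      ∀ a b, ∑ c, C (M a c) * (X (c, b) : MvPolynomial (Fin n × Fin n) ℂ) ∈
        nilFiltration (fun i => rightInvDerivation (E i)) k := by
    intro k
    induction k with
    | zero =>
      intro j M hj hM a b
      rw [eq_zero_of_mem_superdiag (superdiag_antitone P hj hM)]
      simp
    | succ k ih =>
      intro j M hj hM a b
      refine mem_nilFiltration_succ.2 fun i => ?_
      have h1 := ih (j + 1) (M * E i) (by omega) (mul_mem_superdiag hM (hE i)) a b
      convert h1 using 1
      simp only [map_sum, Derivation.leibniz, rightInvDerivation_X, smul_eq_mul]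
      simp only [← algebraMap_eq, Derivation.map_algebraMap, mul_zero, add_zero]
      simp only [algebraMap_eq, Matrix.mul_apply, map_sum, map_mul, Finset.mul_sum,
        Finset.sum_mul]
      rw [Finset.sum_comm]
      exact Finset.sum_congr rfl fun _ _ => Finset.sum_congr rfl fun _ _ => by ring
  induction p using MvPolynomial.induction_on with
  | C a =>
    refine ⟨1, mem_nilFiltration_succ.2 fun i => ?_⟩
    rw [← algebraMap_eq, Derivation.map_algebraMap]
    exact zero_mem _
  | add p q hp hq =>
    obtain ⟨k, hk⟩ := hp
    obtain ⟨l, hl⟩ := hq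
    exact ⟨k + l, add_mem (nilFiltration_mono _ (Nat.le_add_right _ _) hk)
      (nilFiltration_mono _ (Nat.le_add_left _ _) hl)⟩
  | mul_X p ij hp =>
    obtain ⟨k, hk⟩ := hp
    refine ⟨k + n, mul_mem_nilFiltration _ _ rfl hk ?_⟩
    have h1 := hX n 0 1 (by omega) (one_mem_superdiag P) ij.1 ij.2
    simpa [Matrix.one_apply, ite_mul, apply_ite (C : ℂ → MvPolynomial (Fin n × Fin n) ℂ)] using h1

/-- The value at `1` of the iterated left invariant derivative of a polynomial. -/
noncomputable def polyPairing {n : ℕ} {I : Type*} (E : I → Matrix (Fin n) (Fin n) ℂ) (l : List I)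
    (p : MvPolynomial (Fin n × Fin n) ℂ) : ℂ :=
  evalAt 1 (l.foldr (fun i q => leftInvField (E i) q) p)

/-- At the identity the left and right invariant fields of E_i agree, and the right invariant one
commutes past the others. The first letter of the sequence thus becomes the first derivation applied
to p, as the recursion along the curve requires. -/
theorem polyPairing_cons {n : ℕ} {I : Type*} (E : I → Matrix (Fin n) (Fin n) ℂ) (i : I)
    (l : List I) (p : MvPolynomial (Fin n × Fin n) ℂ) :
    polyPairing E (i :: l) p = polyPairing E l (rightInvDerivation (E i) p) := by
  have h1 : ∀ l : List I, l.foldr (fun i q => leftInvField (E i) q) (rightInvDerivation (E i) p) =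
      rightInvDerivation (E i) (l.foldr (fun i q => leftInvField (E i) q) p) := by
    intro l
    induction l with
    | nil => rfl
    | cons j l ih => rw [List.foldr_cons, List.foldr_cons, ih, leftInvField_rightInvDerivation]
  rw [polyPairing, polyPairing, h1, List.foldr_cons, evalAt_leftInvField,
    evalAt_rightInvDerivation, one_mul, mul_one]

theorem polyPairing_zero {n : ℕ} {I : Type*} (E : I → Matrix (Fin n) (Fin n) ℂ) (l : List I) :
    polyPairing E l 0 = 0 := by
  have h : l.foldr (fun i q => leftInvField (E i) q) 0 = 0 := by
    induction l with
    | nil => rfl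
    | cons j l ih => rw [List.foldr_cons, ih, leftInvField]; simp
  rw [polyPairing, h]
  simp [evalAt]

theorem polyPairing_eq_zero {n : ℕ} {I : Type*} (E : I → Matrix (Fin n) (Fin n) ℂ) {k : ℕ} :
    ∀ {p : MvPolynomial (Fin n × Fin n) ℂ},
      p ∈ nilFiltration (fun i => rightInvDerivation (E i)) k → ∀ {l : List I}, k ≤ l.length →
        polyPairing E l p = 0 := by
  induction k with
  | zero =>
    intro p hp l _
    rw [(Submodule.mem_bot ℂ).1 hp, polyPairing_zero]
  | succ k ih =>
    intro p hp l hl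
    cases l with
    | nil => simp at hl
    | cons i l =>
      rw [polyPairing_cons]
      exact ih (mem_nilFiltration_succ.1 hp i) (by simpa using hl)

theorem lieAct_evalAt {n : ℕ} {N : Subgroup (GL (Fin n) ℂ)} (hN : IsZariskiClosed N)
    (X : lieAlg N) (p : MvPolynomial (Fin n × Fin n) ℂ) :
    lieAct hN X (fun g => evalAt ((g : GL (Fin n) ℂ) : Matrix (Fin n) (Fin n) ℂ) p) =
      fun g : N => evalAt ((g : GL (Fin n) ℂ) : Matrix (Fin n) (Fin n) ℂ)
        (leftInvField (X : Matrix (Fin n) (Fin n) ℂ) p) := by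
  funext g
  have h1 := hasDerivAt_evalAt (γ := fun s : ℂ => ((g : GL (Fin n) ℂ) : Matrix (Fin n) (Fin n) ℂ) *
    NormedSpace.exp (s • (X : Matrix (Fin n) (Fin n) ℂ))) (s := 0)
    (hasDerivAt_matrix_mul (γ' := 0) (fun i j => hasDerivAt_const _ _)
      (η' := NormedSpace.exp ((0 : ℂ) • (X : Matrix (Fin n) (Fin n) ℂ)) * X.1)
      fun i j => hasDerivAt_exp_smul_apply (X : Matrix (Fin n) (Fin n) ℂ) 0 i j) p
  rw [evalAt_leftInvField]
  simp only [zero_smul, NormedSpace.exp_zero, mul_one, one_mul, zero_add] at h1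
  exact h1.deriv

theorem monomialPairing_evalAt {n : ℕ} {N : Subgroup (GL (Fin n) ℂ)} (hN : IsZariskiClosed N)
    {I : Type*} (e : I → lieAlg N) (l : List I) (p : MvPolynomial (Fin n × Fin n) ℂ) :
    monomialPairing hN e l (fun g => evalAt ((g : GL (Fin n) ℂ) : Matrix (Fin n) (Fin n) ℂ) p) =
      polyPairing (fun i => (e i : Matrix (Fin n) (Fin n) ℂ)) l p := by
  have h1 : l.foldr (fun i F => lieAct hN (e i) F)
      (fun g : N => evalAt ((g : GL (Fin n) ℂ) : Matrix (Fin n) (Fin n) ℂ) p) =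
      fun g : N => evalAt ((g : GL (Fin n) ℂ) : Matrix (Fin n) (Fin n) ℂ)
        (l.foldr (fun i q => leftInvField (e i : Matrix (Fin n) (Fin n) ℂ) q) p) := by
    induction l with
    | nil => rfl
    | cons j l ih => rw [List.foldr_cons, ih, lieAct_evalAt, List.foldr_cons]
  rw [monomialPairing, h1]
  rfl

/-- On a unitriangular group the inverse is the finite geometric series in 1 - g, so entries of g⁻¹
are polynomials in those of g. -/
theorem exists_evalAt_of_mem_coordRing {n : ℕ} {P : GL (Fin n) ℂ} {N : Subgroup (GL (Fin n) ℂ)}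
    (hN : ∀ g ∈ N, (g : Matrix (Fin n) (Fin n) ℂ) - 1 ∈ superdiag P 1) {f : N → ℂ}
    (hf : f ∈ coordRing N) : ∃ p : MvPolynomial (Fin n × Fin n) ℂ,
      f = fun g : N => evalAt ((g : GL (Fin n) ℂ) : Matrix (Fin n) (Fin n) ℂ) p := by
  let S : Subalgebra ℂ (N → ℂ) :=
    (AlgHom.pi fun g : N => (MvPolynomial.aeval (R := ℂ) fun ij : Fin n × Fin n =>
      ((g : GL (Fin n) ℂ) : Matrix (Fin n) (Fin n) ℂ) ij.1 ij.2)).range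
  have hS : ∀ F, F ∈ S ↔ ∃ p, (fun g : N =>
      evalAt ((g : GL (Fin n) ℂ) : Matrix (Fin n) (Fin n) ℂ) p) = F := fun F => Iff.rfl
  have hent : ∀ i j, (fun g : N => ((g : GL (Fin n) ℂ) : Matrix (Fin n) (Fin n) ℂ) i j) ∈ S :=
    fun i j => (hS _).2 ⟨X (i, j), by simp [evalAt]⟩
  have hle : coordRing N ≤ S := by
    refine Algebra.adjoin_le ?_
    rintro F ⟨i, j, rfl | rfl⟩
    · exact hent i j
    · have hM : ∀ i j, (fun g : N =>
          (1 - ((g : GL (Fin n) ℂ) : Matrix (Fin n) (Fin n) ℂ)) i j) ∈ S := fun i j =>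
        S.sub_mem (matrix_const_entry_mem S 1 i j) (hent i j)
      have hpow : ∀ k i j, (fun g : N =>
          ((1 - ((g : GL (Fin n) ℂ) : Matrix (Fin n) (Fin n) ℂ)) ^ k :
            Matrix (Fin n) (Fin n) ℂ) i j) ∈ S := by
        intro k
        induction k with
        | zero => simpa using matrix_const_entry_mem S 1
        | succ k ih => simpa only [pow_succ] using matrix_mul_entry_mem S ih hM
      have h1 : (fun g : N => (((g⁻¹ : N) : GL (Fin n) ℂ) : Matrix (Fin n) (Fin n) ℂ) i j) =
          ∑ k ∈ Finset.range n, fun g : N =>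
            ((1 - ((g : GL (Fin n) ℂ) : Matrix (Fin n) (Fin n) ℂ)) ^ k :
              Matrix (Fin n) (Fin n) ℂ) i j := by
        funext g
        have h2 : (1 - ((g : GL (Fin n) ℂ) : Matrix (Fin n) (Fin n) ℂ)) ^ n = 0 := by
          refine pow_eq_zero_of_mem_superdiag (P := P) ?_
          rw [← neg_sub]
          exact neg_mem (hN g g.2)
        have h3 := mul_neg_geom_sum (1 - ((g : GL (Fin n) ℂ) : Matrix (Fin n) (Fin n) ℂ)) n
        rw [h2, sub_sub_cancel, sub_zero] at h3
        have h4 : (((g⁻¹ : N) : GL (Fin n) ℂ) : Matrix (Fin n) (Fin n) ℂ) =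
            ∑ k ∈ Finset.range n, (1 - ((g : GL (Fin n) ℂ) : Matrix (Fin n) (Fin n) ℂ)) ^ k := by
          rw [Subgroup.coe_inv]
          exact Units.inv_eq_of_mul_eq_one_right h3
        rw [h4, Matrix.sum_apply, Finset.sum_apply]
      rw [SetLike.mem_coe, h1]
      exact S.sum_mem fun k _ => hpow k i j
  obtain ⟨p, hp⟩ := hle hf
  exact ⟨p, hp.symm⟩

/-! ### Iterated integrals -/

/-- The iterated integrals of the exponentials `e^{-ra}`. -/
noncomputable def iterInt : List ℂ → ℝ → ℂ
  | [], _ => 1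
  | a :: l, s => ∫ r in (0 : ℝ)..s, Complex.exp (-(r * a)) * iterInt l r

theorem continuous_iterInt (l : List ℂ) : Continuous (iterInt l) := by
  induction l with
  | nil => exact continuous_const
  | cons a l ih =>
    exact intervalIntegral.continuous_primitive
      (fun a b => (by fun_prop : Continuous _).intervalIntegrable a b) 0

theorem hasDerivAt_iterInt (a : ℂ) (l : List ℂ) (s : ℝ) :
    HasDerivAt (iterInt (a :: l)) (Complex.exp (-(s * a)) * iterInt l s) s := by
  have h := continuous_iterInt l
  have h1 : Continuous fun r : ℝ => Complex.exp (-(r * a)) * iterInt l r := by fun_prop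
  exact intervalIntegral.integral_hasDerivAt_right (h1.intervalIntegrable _ _)
    (h1.stronglyMeasurableAtFilter _ _) h1.continuousAt

open Classical in
/-- The finite set of sequences of length less than `k`. -/
noncomputable def listsLT (I : Type*) [Fintype I] : ℕ → Finset (List I)
  | 0 => ∅
  | k + 1 => insert [] ((Finset.univ ×ˢ listsLT I k).image fun p => p.1 :: p.2)

theorem mem_listsLT {I : Type*} [Fintype I] {k : ℕ} {l : List I} :
    l ∈ listsLT I k ↔ l.length < k := by
  induction k generalizing l with
  | zero => simp [listsLT]
  | succ k ih =>
    cases l with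
    | nil => simp [listsLT]
    | cons i l => simp [listsLT, ih]

theorem sum_listsLT_succ {I : Type*} [Fintype I] (k : ℕ) (g : List I → ℂ) :
    ∑ l ∈ listsLT I (k + 1), g l = g [] + ∑ i, ∑ l ∈ listsLT I k, g (i :: l) := by
  classical
  rw [listsLT, Finset.sum_insert (by simp), Finset.sum_image (by
    rintro ⟨i, l⟩ _ ⟨j, l'⟩ _ h; simpa using h), Finset.sum_product]

/-- The expansion of a polynomial function along a curve with velocity `∑ e^{-s a_i} E_i`. -/
theorem evalAt_eq_sum_iterInt {n : ℕ} {I : Type*} [Fintype I] (E : I → Matrix (Fin n) (Fin n) ℂ)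
    (a : I → ℂ) {u : ℂ → Matrix (Fin n) (Fin n) ℂ} (hu0 : u 0 = 1)
    (hu : ∀ s i j, HasDerivAt (fun z => u z i j)
      (((∑ k, Complex.exp (-(s * a k)) • E k) * u s) i j) s) {k : ℕ} :
    ∀ {p : MvPolynomial (Fin n × Fin n) ℂ},
      p ∈ nilFiltration (fun i => rightInvDerivation (E i)) k → ∀ s : ℝ,
        evalAt (u s) p = ∑ l ∈ listsLT I k, polyPairing E l p * iterInt (l.map a) s := by
  induction k with
  | zero =>
    intro p hp s
    rw [(Submodule.mem_bot ℂ).1 hp]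
    simp [listsLT, evalAt]
  | succ k ih =>
    intro p hp s
    simp only [sum_listsLT_succ, polyPairing_cons, List.map_cons, List.map_nil]
    have h1 : ∀ s : ℝ, HasDerivAt (fun s : ℝ => evalAt (u s) p)
        (∑ i, Complex.exp (-(s * a i)) * evalAt (u s) (rightInvDerivation (E i) p)) s := by
      intro s
      refine (hasDerivAt_evalAt (hu s) p).comp_ofReal.congr_deriv ?_
      simp only [evalAt_rightInvDerivation, Finset.sum_mul, Matrix.sum_apply, Finset.mul_sum,
        smul_mul_assoc, Matrix.smul_apply, smul_eq_mul]
      rw [Finset.sum_comm]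
      exact Finset.sum_congr rfl fun _ _ => Finset.sum_congr rfl fun _ _ => by ring
    have h2 : ∀ s : ℝ, HasDerivAt (fun s : ℝ => polyPairing E [] p * iterInt [] s +
        ∑ i, ∑ l ∈ listsLT I k, polyPairing E l (rightInvDerivation (E i) p) *
          iterInt (a i :: l.map a) s)
        (∑ i, Complex.exp (-(s * a i)) * evalAt (u s) (rightInvDerivation (E i) p)) s := by
      intro s
      have h3 := HasDerivAt.fun_sum (u := Finset.univ) fun i _ =>
        HasDerivAt.fun_sum (u := listsLT I k) fun l _ => (hasDerivAt_iterInt (a i) (l.map a) s).const_mul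
          (polyPairing E l (rightInvDerivation (E i) p))
      refine (h3.const_add (polyPairing E [] p * iterInt [] s)).congr_deriv ?_
      refine Finset.sum_congr rfl fun i _ => ?_
      rw [ih (mem_nilFiltration_succ.1 hp i), Finset.mul_sum]
      exact Finset.sum_congr rfl fun _ _ => by ring
    -- Both sides have the same derivative, by the induction hypothesis for the derivatives of p,
    -- and the same value at s = 0, where all nonempty iterated integrals vanish.
    have h3 := is_const_of_deriv_eq_zero (fun s => ((h1 s).sub (h2 s)).differentiableAt)
      (fun s => by rw [((h1 s).sub (h2 s)).deriv, sub_self]) s 0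
    have h4 : polyPairing E [] p = evalAt 1 p := rfl
    simp only [Pi.sub_apply, Complex.ofReal_zero, hu0, h4] at h3
    have h5 : ∀ i (l : List I), iterInt (a i :: l.map a) 0 = 0 := fun i l => by
      rw [iterInt, intervalIntegral.integral_same]
    simp only [h5, mul_zero, Finset.sum_const_zero, add_zero] at h3
    have h6 : ∀ r, iterInt [] r = 1 := fun _ => rfl
    rw [h6, h6, mul_one, sub_self, sub_eq_zero] at h3
    rw [h3, h4, h6, mul_one]

end LinAlgGroup

/-! ### The curve exp(-sx) exp(s(x + e)) and the rationality of its expansion -/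

namespace LinAlgGroup

/-! ### The expansion of `exp (-x) exp (x + e)` -/

/-- The terms in x cancel, leaving exp(-sx) E_k exp(s(x + e)); moving exp(-sx) past the root vector
E_k multiplies it by e^{-s α_k(x)}. -/
theorem hasDerivAt_exp_neg_mul_exp {n : ℕ} {T : Subgroup (GL (Fin n) ℂ)} (hT : IsZariskiClosed T)
    {I : Type*} [Fintype I] {α : I → weightLattice T} {E : I → Matrix (Fin n) (Fin n) ℂ}
    (hE : ∀ i, IsRootVector (α i) (E i)) (x : lieAlg T) (s : ℂ) (i j : Fin n) :
    HasDerivAt (fun z : ℂ => (NormedSpace.exp (z • (-x : Matrix (Fin n) (Fin n) ℂ)) *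
      NormedSpace.exp (z • ((x : Matrix (Fin n) (Fin n) ℂ) + ∑ k, E k))) i j)
      (((∑ k, Complex.exp (-(s * differential hT (α k) x)) • E k) *
        (NormedSpace.exp (s • (-x : Matrix (Fin n) (Fin n) ℂ)) *
          NormedSpace.exp (s • ((x : Matrix (Fin n) (Fin n) ℂ) + ∑ k, E k)))) i j) s := by
  refine (hasDerivAt_matrix_mul (hasDerivAt_exp_smul_apply (-x : Matrix (Fin n) (Fin n) ℂ) s)
    (hasDerivAt_exp_smul_apply ((x : Matrix (Fin n) (Fin n) ℂ) + ∑ k, E k) s) i j).congr_deriv ?_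
  have h1 : ∀ k, NormedSpace.exp (s • (-x : Matrix (Fin n) (Fin n) ℂ)) * E k =
      (Complex.exp (-(s * differential hT (α k) x)) • E k) *
        NormedSpace.exp (s • (-x : Matrix (Fin n) (Fin n) ℂ)) := by
    intro k
    have h2 := (hE k).2 (lieExp hT ((-s) • x))
    have h3 := charFun_lieExp_smul hT (α k) x (-s)
    rw [charFun] at h3
    rw [h3, neg_mul] at h2
    have h4 : ((lieExp hT ((-s) • x) : T) : GL (Fin n) ℂ) =
        glExp (s • (-x : Matrix (Fin n) (Fin n) ℂ)) := by
      simp [lieExp]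
    rw [h4] at h2
    rw [← h2, Ad, mul_assoc, Units.inv_mul_of_eq (glExp_coe _), mul_one, glExp_coe]
  have h5 : ((x : Matrix (Fin n) (Fin n) ℂ) + ∑ k, E k) *
      NormedSpace.exp (s • ((x : Matrix (Fin n) (Fin n) ℂ) + ∑ k, E k)) =
      NormedSpace.exp (s • ((x : Matrix (Fin n) (Fin n) ℂ) + ∑ k, E k)) *
        ((x : Matrix (Fin n) (Fin n) ℂ) + ∑ k, E k) :=
    ((Commute.refl _).smul_right s).exp_right
  rw [← h5, mul_assoc, ← mul_add, ← add_mul, neg_add_cancel_left, ← mul_assoc, ← mul_assoc,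
    Finset.mul_sum]
  simp only [h1, Finset.sum_mul]

theorem evalAt_exp_neg_mul_exp {n : ℕ} {T : Subgroup (GL (Fin n) ℂ)} (hT : IsZariskiClosed T)
    {I : Type*} [Fintype I] {α : I → weightLattice T} {E : I → Matrix (Fin n) (Fin n) ℂ}
    (hE : ∀ i, IsRootVector (α i) (E i)) (x : lieAlg T) {k : ℕ}
    {p : MvPolynomial (Fin n × Fin n) ℂ}
    (hp : p ∈ nilFiltration (fun i => rightInvDerivation (E i)) k) :
    evalAt (NormedSpace.exp (-x : Matrix (Fin n) (Fin n) ℂ) *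
      NormedSpace.exp ((x : Matrix (Fin n) (Fin n) ℂ) + ∑ k, E k)) p =
      ∑ l ∈ listsLT I k, polyPairing E l p *
        iterInt (l.map fun i => differential hT (α i) x) 1 := by
  have h := evalAt_eq_sum_iterInt E (fun i => differential hT (α i) x) (by simp)
    (hasDerivAt_exp_neg_mul_exp hT hE x) hp 1
  simpa using h

/-! ### Rationality of the iterated integrals -/

/-- A nonzero integral combination of the independent simple roots is a nontrivial weight, so its
differential is a nonzero linear form; products stay nonzero because ℂ[𝔱] is a domain. -/
theorem rootDenominators_spec {n : ℕ} {T : Subgroup (GL (Fin n) ℂ)} (hT : IsTorus T)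
    {I : Type*} [Fintype I] {α : I → weightLattice T}
    (hα : ∀ m : I → ℤ, ∏ i, α i ^ m i = 1 → m = 0) {s : lieAlg T → ℂ}
    (hs : s ∈ rootDenominators hT.closed α) : s ∈ polyRing (lieAlg T) ∧ s ≠ 0 := by
  induction hs using Submonoid.closure_induction with
  | mem F hF =>
    obtain ⟨m, hm, rfl⟩ := hF
    rw [sum_differential_eq hT]
    refine ⟨dual_mem_polyRing _, fun h => hm (hα m (eq_one_of_differential_eq_zero hT ?_))⟩
    rw [differentialₗ_prod_zpow]
    exact LinearMap.ext fun x => congrFun h x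
  | one => exact ⟨one_mem _, one_ne_zero⟩
  | mul a b _ _ ha hb =>
    exact ⟨mul_mem ha.1 hb.1, fun h =>
      hb.2 (eq_zero_of_mul_eq_zero_of_mem_polyRing ha.1 hb.1 ha.2 h)⟩

/-- The combinations of the exponentials `e^{-s ∑ m_i α_i(x)}` with coefficients in `ℂ[𝔱]`. -/
def expSums {n : ℕ} {T : Subgroup (GL (Fin n) ℂ)} (hT : IsZariskiClosed T)
    {I : Type*} [Fintype I] (α : I → weightLattice T) : Submodule ℂ (lieAlg T → ℝ → ℂ) :=
  Submodule.span ℂ {Φ | ∃ c ∈ polyRing (lieAlg T), ∃ m : I → ℕ,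
    Φ = fun x (s : ℝ) => c x * Complex.exp (-((s : ℂ) * ∑ i, (m i : ℂ) * differential hT (α i) x))}

section expSums

variable {n : ℕ} {T : Subgroup (GL (Fin n) ℂ)} {I : Type*} [Fintype I] {α : I → weightLattice T}

theorem mul_mem_expSums (hT : IsZariskiClosed T) {c : lieAlg T → ℂ}
    (hc : c ∈ polyRing (lieAlg T)) {Φ : lieAlg T → ℝ → ℂ} (hΦ : Φ ∈ expSums hT α) :
    (fun x s => c x * Φ x s) ∈ expSums hT α := by
  induction hΦ using Submodule.span_induction with
  | mem Φ h =>
    obtain ⟨d, hd, m, rfl⟩ := h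
    exact Submodule.subset_span ⟨c * d, mul_mem hc hd, m, by
      funext x s; simp [mul_assoc]⟩
  | zero =>
    simp only [Pi.zero_apply, mul_zero]
    exact zero_mem (expSums hT α)
  | add Φ Ψ _ _ h h' =>
    simp only [Pi.add_apply, mul_add]
    exact add_mem h h'
  | smul a Φ _ h =>
    simp only [Pi.smul_apply, mul_smul_comm]
    exact (expSums hT α).smul_mem a h

theorem continuous_of_mem_expSums (hT : IsZariskiClosed T) {Φ : lieAlg T → ℝ → ℂ}
    (hΦ : Φ ∈ expSums hT α) (x : lieAlg T) : Continuous (Φ x) := by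
  induction hΦ using Submodule.span_induction with
  | mem Φ h =>
    obtain ⟨d, hd, m, rfl⟩ := h
    fun_prop
  | zero => exact continuous_const
  | add Φ Ψ _ _ h h' => exact h.add h'
  | smul a Φ _ h => exact h.const_smul a

theorem mul_integral_exp (b : ℂ) (s : ℝ) :
    b * ∫ r in (0 : ℝ)..s, Complex.exp (-(r * b)) = 1 - Complex.exp (-(s * b)) := by
  rw [← intervalIntegral.integral_const_mul]
  have h : ∀ r : ℝ, HasDerivAt (fun r : ℝ => -Complex.exp (-(r * b)))
      (b * Complex.exp (-(r * b))) r := by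
    intro r
    have h1 := (((hasDerivAt_id (r : ℂ)).mul_const b).neg.cexp.neg).comp_ofReal
    refine h1.congr_deriv ?_
    simp only [id, Pi.neg_apply]
    ring
  rw [intervalIntegral.integral_eq_sub_of_hasDerivAt (fun r _ => h r)
    ((by fun_prop : Continuous fun r : ℝ => b * Complex.exp (-(r * b))).intervalIntegrable _ _)]
  simp
  ring

/-- Integrating e^{-rb} from 0 to s and multiplying by b gives 1 - e^{-sb}, also where b(x) = 0.
Sums are handled by multiplying the denominators. -/
theorem exists_integral_mem_expSums (hT : IsTorus T) (i : I) {Φ : lieAlg T → ℝ → ℂ}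
    (hα : ∀ m : I → ℤ, ∏ i, α i ^ m i = 1 → m = 0)
    (hΦ : Φ ∈ expSums hT.closed α) : ∃ V ∈ rootDenominators hT.closed α,
      (fun x s => V x * ∫ r in (0 : ℝ)..s,
        Complex.exp (-(r * differential hT.closed (α i) x)) * Φ x r) ∈ expSums hT.closed α := by
  classical
  induction hΦ using Submodule.span_induction with
  | mem Φ h =>
    obtain ⟨d, hd, m, rfl⟩ := h
    -- The new exponent has a positive coefficient at i, so the linear form used as denominator is
    -- not zero. Keeping the exponents in ℕ is what guarantees this.
    let m' : I → ℕ := m + Pi.single i 1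
    have hm' : ∀ x, ∑ j, (m' j : ℂ) * differential hT.closed (α j) x =
        differential hT.closed (α i) x + ∑ j, (m j : ℂ) * differential hT.closed (α j) x := by
      intro x
      simp [m', add_mul, Finset.sum_add_distrib, Pi.single_apply, add_comm]
    refine ⟨∑ j, (m' j : ℤ) • differential hT.closed (α j),
      Submonoid.subset_closure ⟨fun j => (m' j : ℤ), fun h => ?_, rfl⟩, ?_⟩
    · have := congrFun h i
      simp [m'] at this
      omega
    · have h1 : (fun (x : lieAlg T) (s : ℝ) => (∑ j, (m' j : ℤ) • differential hT.closed (α j)) x *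
          ∫ r in (0 : ℝ)..s, Complex.exp (-(r * differential hT.closed (α i) x)) *
            (d x * Complex.exp (-(r * ∑ i, (m i : ℂ) * differential hT.closed (α i) x)))) =
          (fun (x : lieAlg T) (s : ℝ) => d x * Complex.exp (-(s * ∑ i, ((0 : I → ℕ) i : ℂ) *
            differential hT.closed (α i) x))) -
          fun (x : lieAlg T) (s : ℝ) => d x * Complex.exp (-(s * ∑ i, (m' i : ℂ) *
            differential hT.closed (α i) x)) := by
        funext x s
        have h2 : (∑ j, (m' j : ℤ) • differential hT.closed (α j)) x =
            ∑ j, (m' j : ℂ) * differential hT.closed (α j) x := by simp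
        have h3 : ∀ r : ℝ, Complex.exp (-(r * differential hT.closed (α i) x)) *
            (d x * Complex.exp (-(r * ∑ i, (m i : ℂ) * differential hT.closed (α i) x))) =
            d x * Complex.exp (-(r * ∑ j, (m' j : ℂ) * differential hT.closed (α j) x)) := by
          intro r
          rw [hm', mul_add, neg_add, Complex.exp_add]
          ring
        simp only [h2, h3, intervalIntegral.integral_const_mul]
        rw [mul_left_comm, mul_integral_exp]
        simp [mul_sub]
      rw [h1]
      exact sub_mem (Submodule.subset_span ⟨d, hd, 0, rfl⟩) (Submodule.subset_span ⟨d, hd, m', rfl⟩)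
  | zero =>
    refine ⟨1, one_mem _, ?_⟩
    simp only [Pi.zero_apply, mul_zero, intervalIntegral.integral_zero]
    exact zero_mem (expSums hT.closed α)
  | add Φ Ψ hΦ hΨ h h' =>
    obtain ⟨V, hV, h⟩ := h
    obtain ⟨W, hW, h'⟩ := h'
    refine ⟨V * W, mul_mem hV hW, ?_⟩
    have h1 := mul_mem_expSums hT.closed (rootDenominators_spec hT hα hW).1 h
    have h2 := mul_mem_expSums hT.closed (rootDenominators_spec hT hα hV).1 h'
    convert add_mem h1 h2 using 1
    funext x s
    have hc := continuous_of_mem_expSums (α := α) hT.closed hΦ x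
    have hc' := continuous_of_mem_expSums (α := α) hT.closed hΨ x
    simp only [Pi.add_apply, Pi.mul_apply, mul_add]
    rw [intervalIntegral.integral_add
      ((by fun_prop : Continuous _).intervalIntegrable _ _)
      ((by fun_prop : Continuous _).intervalIntegrable _ _)]
    ring
  | smul a Φ _ h =>
    obtain ⟨V, hV, h⟩ := h
    refine ⟨V, hV, ?_⟩
    convert (expSums hT.closed α).smul_mem a h using 1
    funext x s
    simp only [Pi.smul_apply, smul_eq_mul, mul_left_comm _ a, intervalIntegral.integral_const_mul]

theorem exists_iterInt_mem_expSums (hT : IsTorus T)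
    (hα : ∀ m : I → ℤ, ∏ i, α i ^ m i = 1 → m = 0) (l : List I) :
    ∃ V ∈ rootDenominators hT.closed α,
      (fun x s => V x * iterInt (l.map fun i => differential hT.closed (α i) x) s) ∈
        expSums hT.closed α := by
  induction l with
  | nil =>
    refine ⟨1, one_mem _, Submodule.subset_span ⟨1, one_mem _, 0, ?_⟩⟩
    funext x s
    simp [iterInt]
  | cons i l ih =>
    obtain ⟨V, hV, h⟩ := ih
    obtain ⟨W, hW, h'⟩ := exists_integral_mem_expSums hT i hα h
    refine ⟨W * V, mul_mem hW hV, ?_⟩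
    convert h' using 1
    funext x s
    simp only [List.map_cons, iterInt, Pi.mul_apply, mul_left_comm _ (V x),
      intervalIntegral.integral_const_mul, mul_assoc]

theorem exists_prodRing_of_mem_expSums (hT : IsTorus T) {Φ : lieAlg T → ℝ → ℂ}
    (hΦ : Φ ∈ expSums hT.closed α) :
    ∃ p ∈ prodRing (lieAlg T) T, ∀ x, Φ x 1 = p (x, lieExp hT.closed x) := by
  induction hΦ using Submodule.span_induction with
  | mem Φ h =>
    obtain ⟨c, hc, m, rfl⟩ := h
    let χ : weightLattice T := ∏ i, α i ^ (-(m i : ℤ))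
    refine ⟨(fun z => c z.1) * fun z => charFun (χ : T →* ℂˣ) z.2,
      mul_mem (Algebra.subset_adjoin (Or.inl ⟨c, hc, rfl⟩))
        (Algebra.subset_adjoin (Or.inr ⟨_, χ.2, rfl⟩)), fun x => ?_⟩
    simp only [Pi.mul_apply]
    rw [charFun_lieExp, ← differentialₗ_apply hT, differentialₗ_prod_zpow]
    simp [differentialₗ_apply]
  | zero => exact ⟨0, zero_mem _, fun _ => rfl⟩
  | add Φ Ψ _ _ h h' =>
    obtain ⟨p, hp, h⟩ := h
    obtain ⟨q, hq, h'⟩ := h'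
    exact ⟨p + q, add_mem hp hq, fun x => by simp [h, h']⟩
  | smul a Φ _ h =>
    obtain ⟨p, hp, h⟩ := h
    exact ⟨a • p, Subalgebra.smul_mem _ hp a, fun x => by simp [h]⟩

/-- Combinations of the iterated integrals are rational. -/
theorem exists_isRationalForm_sum_iterInt (hT : IsTorus T)
    (hα : ∀ m : I → ℤ, ∏ i, α i ^ m i = 1 → m = 0) (L : Finset (List I)) (c : List I → ℂ) :
    ∃ s ∈ rootDenominators hT.closed α, ∃ p, IsRationalForm hT.closed
      (fun x => ∑ l ∈ L, c l * iterInt (l.map fun i => differential hT.closed (α i) x) 1) s p := by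
  have h : ∃ V ∈ rootDenominators hT.closed α, (fun (x : lieAlg T) (s : ℝ) => V x * ∑ l ∈ L, c l *
      iterInt (l.map fun i => differential hT.closed (α i) x) s) ∈ expSums hT.closed α := by
    classical
    induction L using Finset.induction_on with
    | empty =>
      refine ⟨1, one_mem _, ?_⟩
      simp only [Finset.sum_empty, mul_zero]
      exact zero_mem (expSums hT.closed α)
    | insert l L hl ih =>
      obtain ⟨V, hV, h⟩ := ih
      obtain ⟨W, hW, h'⟩ := exists_iterInt_mem_expSums hT hα l
      refine ⟨V * W, mul_mem hV hW, ?_⟩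
      have h1 := mul_mem_expSums hT.closed (rootDenominators_spec hT hα hW).1 h
      have h2 := mul_mem_expSums hT.closed (rootDenominators_spec hT hα hV).1 h'
      convert add_mem h1 ((expSums hT.closed α).smul_mem (c l) h2) using 1
      funext x s
      simp only [Finset.sum_insert hl, Pi.add_apply, Pi.mul_apply, Pi.smul_apply, smul_eq_mul]
      ring
  obtain ⟨V, hV, h⟩ := h
  obtain ⟨p, hp, hpx⟩ := exists_prodRing_of_mem_expSums hT h
  have hs := rootDenominators_spec hT hα hV
  exact ⟨V, hV, p, hs.1, hs.2, hp, hpx⟩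

end expSums

end LinAlgGroup

/-! ### Iterated integrals as Fourier transforms of simplex measures -/

namespace LinAlgGroup

open MeasureTheory

/-! ### Integrals over simplices -/

/-- The simplex `{c | c_k ≥ 0, c_1 + ⋯ + c_p ≤ s}`. -/
def scaledSimplex (p : ℕ) (s : ℝ) : Set (Fin p → ℝ) := {c | (∀ k, 0 ≤ c k) ∧ ∑ k, c k ≤ s}

theorem isCompact_scaledSimplex (p : ℕ) (s : ℝ) : IsCompact (scaledSimplex p s) := by
  refine (isCompact_Icc (a := (0 : Fin p → ℝ)) (b := fun _ => s)).of_isClosed_subset ?_ ?_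
  · have : scaledSimplex p s = (⋂ k, {c | 0 ≤ c k}) ∩ {c | ∑ k, c k ≤ s} := by
      ext; simp [scaledSimplex]
    rw [this]
    exact (isClosed_iInter fun k => isClosed_le (by fun_prop) (by fun_prop)).inter
      (isClosed_le (by fun_prop) (by fun_prop))
  · rintro c ⟨h0, h1⟩
    exact ⟨h0, fun k => (Finset.single_le_sum (fun i _ => h0 i) (Finset.mem_univ k)).trans h1⟩

/-- The linear form `∑ c_k (a_1 + ⋯ + a_k)`. -/
noncomputable def simplexPhase (a : List ℂ) (c : Fin a.length → ℝ) : ℂ :=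
  ∑ k : Fin a.length, (c k : ℂ) * (a.take (k + 1)).sum

theorem continuous_simplexPhase (a : List ℂ) : Continuous (simplexPhase a) := by
  unfold simplexPhase
  fun_prop

theorem simplexPhase_cons (b : ℂ) (a : List ℂ) (r : ℝ) (c : Fin a.length → ℝ) :
    simplexPhase (b :: a) (Fin.cons r c : Fin (a.length + 1) → ℝ) =
      ((r + ∑ k, c k : ℝ) : ℂ) * b + simplexPhase a c := by
  have h : simplexPhase (b :: a) (Fin.cons r c : Fin (a.length + 1) → ℝ) =
      ∑ k : Fin (a.length + 1), ((Fin.cons r c : Fin (a.length + 1) → ℝ) k : ℂ) *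
        ((b :: a).take (k + 1)).sum := rfl
  rw [h, Fin.sum_univ_succ]
  simp only [Fin.cons_zero, Fin.cons_succ, Fin.val_zero, Fin.val_succ, List.take_succ_cons,
    List.sum_cons, List.take_zero, List.sum_nil, add_zero, mul_add, Finset.sum_add_distrib,
    simplexPhase, ← Finset.sum_mul]
  push_cast
  ring

/-- The first term b of the sequence occurs in all partial sums, so its coefficient in the phase is
the total r = ∑ c_k. Take r as a coordinate in place of c_1: this is a shear, and the slice at r is
the simplex of size r in the other variables, to which induction applies. -/
theorem integral_scaledSimplex (a : List ℂ) : ∀ s : ℝ, 0 ≤ s →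
    ∫ c in scaledSimplex a.length s, Complex.exp (-simplexPhase a c) = iterInt a s := by
  induction a with
  | nil =>
    intro s hs
    have h1 : scaledSimplex ([] : List ℂ).length s = Set.univ :=
      Set.eq_univ_of_forall fun c => ⟨fun k => k.elim0, by simpa using! hs⟩
    have h2 : (volume : Measure (Fin ([] : List ℂ).length → ℝ)).real Set.univ = 1 := by
      rw [measureReal_def]
      simp [volume_pi]
    rw [h1, Measure.restrict_univ]
    simp [simplexPhase, iterInt, h2]
  | cons b a ih =>
    intro s hs
    let p := a.length
    let K : Set (ℝ × (Fin p → ℝ)) := {z | 0 ≤ z.1 ∧ (∀ k, 0 ≤ z.2 k) ∧ z.1 + ∑ k, z.2 k ≤ s}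
    let K' : Set (ℝ × (Fin p → ℝ)) := {z | (∀ k, 0 ≤ z.2 k) ∧ ∑ k, z.2 k ≤ z.1 ∧ z.1 ≤ s}
    let h : ℝ × (Fin p → ℝ) → ℂ := fun z =>
      Complex.exp (-((z.1 + ∑ k, z.2 k : ℝ) * b + simplexPhase a z.2))
    let h' : ℝ × (Fin p → ℝ) → ℂ := fun z => Complex.exp (-(z.1 * b + simplexPhase a z.2))
    have hph := continuous_simplexPhase a
    have hKb : IsCompact (Set.Icc (0 : ℝ × (Fin p → ℝ)) (s, fun _ => s)) := isCompact_Icc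
    have hK : IsCompact K := by
      refine hKb.of_isClosed_subset ?_ ?_
      · have : K = {z | 0 ≤ z.1} ∩ ((⋂ k, {z | 0 ≤ z.2 k}) ∩ {z | z.1 + ∑ k, z.2 k ≤ s}) := by
          ext; simp [K]
        rw [this]
        exact (isClosed_le (by fun_prop) (by fun_prop)).inter ((isClosed_iInter fun k =>
          isClosed_le (by fun_prop) (by fun_prop)).inter (isClosed_le (by fun_prop) (by fun_prop)))
      · rintro z ⟨h0, h1, h2⟩
        have h3 : 0 ≤ ∑ k, z.2 k := Finset.sum_nonneg fun k _ => h1 k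
        refine ⟨⟨h0, h1⟩, ⟨by simp only; linarith, fun k => ?_⟩⟩
        have h4 := Finset.single_le_sum (fun i _ => h1 i) (Finset.mem_univ k)
        simp only
        linarith
    have hK' : IsCompact K' := by
      refine hKb.of_isClosed_subset ?_ ?_
      · have : K' = (⋂ k, {z | 0 ≤ z.2 k}) ∩ ({z | ∑ k, z.2 k ≤ z.1} ∩ {z | z.1 ≤ s}) := by
          ext; simp [K']
        rw [this]
        exact (isClosed_iInter fun k => isClosed_le (by fun_prop) (by fun_prop)).inter
          ((isClosed_le (by fun_prop) (by fun_prop)).inter (isClosed_le (by fun_prop) (by fun_prop)))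
      · rintro z ⟨h1, h2, h0⟩
        have h3 : 0 ≤ ∑ k, z.2 k := Finset.sum_nonneg fun k _ => h1 k
        refine ⟨⟨by simp only [Prod.fst_zero]; linarith, h1⟩, ⟨h0, fun k => ?_⟩⟩
        have h4 := Finset.single_le_sum (fun i _ => h1 i) (Finset.mem_univ k)
        simp only
        linarith
    have hint : Integrable (K.indicator h) :=
      (integrable_indicator_iff hK.measurableSet).2
        (ContinuousOn.integrableOn_compact hK (by fun_prop))
    have hint' : Integrable (K'.indicator h') :=
      (integrable_indicator_iff hK'.measurableSet).2
        (ContinuousOn.integrableOn_compact hK' (by fun_prop))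
    have hshear : ∀ (c : Fin p → ℝ) (r : ℝ),
        K.indicator h (r - ∑ k, c k, c) = K'.indicator h' (r, c) := by
      intro c r
      have h1 : (r - ∑ k, c k, c) ∈ K ↔ (r, c) ∈ K' := by
        simp only [K, K', Set.mem_ofPred_eq, sub_nonneg, sub_add_cancel]
        tauto
      by_cases h2 : (r, c) ∈ K'
      · rw [Set.indicator_of_mem h2, Set.indicator_of_mem (h1.2 h2)]
        simp only [h, h', sub_add_cancel]
      · rw [Set.indicator_of_notMem h2, Set.indicator_of_notMem (mt h1.1 h2)]
    have hslice : ∀ r : ℝ, ∫ c, K'.indicator h' (r, c) =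
        (Set.Icc 0 s).indicator (fun r : ℝ => Complex.exp (-(r * b)) * iterInt a r) r := by
      intro r
      by_cases hr : r ∈ Set.Icc 0 s
      · rw [Set.indicator_of_mem hr, ← ih r hr.1, ← integral_const_mul,
          ← integral_indicator (isCompact_scaledSimplex _ _).measurableSet]
        refine integral_congr_ae (Filter.Eventually.of_forall fun c => ?_)
        have h1 : (r, c) ∈ K' ↔ c ∈ scaledSimplex p r := by
          simp only [K', scaledSimplex, Set.mem_ofPred_eq]
          exact ⟨fun h => ⟨h.1, h.2.1⟩, fun h => ⟨h.1, h.2, hr.2⟩⟩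
        by_cases h2 : (r, c) ∈ K'
        · simp only
          rw [Set.indicator_of_mem h2, Set.indicator_of_mem (h1.1 h2)]
          simp only [h', neg_add, Complex.exp_add]
        · simp only
          rw [Set.indicator_of_notMem h2, Set.indicator_of_notMem (mt h1.2 h2)]
      · rw [Set.indicator_of_notMem hr]
        have h1 : ∀ c, K'.indicator h' (r, c) = 0 := fun c =>
          Set.indicator_of_notMem (fun hc => hr ⟨(Finset.sum_nonneg fun k _ => hc.1 k).trans hc.2.1,
            hc.2.2⟩) _
        simp only [h1, integral_zero]
    have hcons : ∀ z : ℝ × (Fin p → ℝ), (scaledSimplex (p + 1) s).indicator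
        (fun c => Complex.exp (-simplexPhase (b :: a) c))
        ((MeasurableEquiv.piFinSuccAbove (fun _ : Fin (p + 1) => ℝ) 0).symm z) =
        K.indicator h z := by
      rintro ⟨r, c⟩
      have h0 : (MeasurableEquiv.piFinSuccAbove (fun _ : Fin (p + 1) => ℝ) 0).symm (r, c) =
          Fin.cons r c := by
        rw [MeasurableEquiv.piFinSuccAbove_symm_apply]
        exact Fin.insertNth_zero' r c
      have h1 : (r, c) ∈ K ↔ (Fin.cons r c : Fin (p + 1) → ℝ) ∈ scaledSimplex (p + 1) s := by
        simp only [K, scaledSimplex, Set.mem_ofPred_eq, Fin.forall_fin_succ, Fin.cons_zero,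
          Fin.cons_succ, Fin.sum_univ_succ, and_assoc]
      rw [h0]
      by_cases h2 : (r, c) ∈ K
      · rw [Set.indicator_of_mem h2, Set.indicator_of_mem (h1.1 h2)]
        simp only [h]
        rw [← simplexPhase_cons]
      · rw [Set.indicator_of_notMem h2, Set.indicator_of_notMem (mt h1.2 h2)]
    calc ∫ c in scaledSimplex (p + 1) s, Complex.exp (-simplexPhase (b :: a) c)
        = ∫ c, (scaledSimplex (p + 1) s).indicator
            (fun c => Complex.exp (-simplexPhase (b :: a) c)) c :=
          (integral_indicator (isCompact_scaledSimplex _ _).measurableSet).symm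
      _ = ∫ z, K.indicator h z := by
          rw [← ((volume_preserving_piFinSuccAbove (fun _ : Fin (p + 1) => ℝ) 0).symm _).integral_comp']
          exact integral_congr_ae (Filter.Eventually.of_forall hcons)
      _ = ∫ c, ∫ r, K.indicator h (r, c) := integral_prod_symm _ hint
      _ = ∫ c, ∫ r, K'.indicator h' (r, c) := by
          refine integral_congr_ae (Filter.Eventually.of_forall fun c => ?_)
          simp only
          rw [← integral_sub_right_eq_self (fun r => K.indicator h (r, c)) (∑ k, c k)]
          simp only [hshear]
      _ = ∫ r, ∫ c, K'.indicator h' (r, c) :=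
          (integral_integral_swap (f := fun r c => K'.indicator h' (r, c)) hint').symm
      _ = ∫ r in (0 : ℝ)..s, Complex.exp (-(r * b)) * iterInt a r := by
          simp only [hslice]
          rw [integral_indicator measurableSet_Icc, integral_Icc_eq_integral_Ioc,
            intervalIntegral.integral_of_le hs]

/-! ### Fourier transforms -/

/-- The integral of a function against a multiple of a finite measure. -/
theorem integral_smul_toComplexMeasure {X : Type*} [MeasurableSpace X] (μ : Measure X)
    [IsFiniteMeasure μ] (c : ℂ) {f : X → ℂ} (hf : Integrable f μ) :
    (c • μ.toSignedMeasure.toComplexMeasure 0).Integrable f ∧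
    (c • μ.toSignedMeasure.toComplexMeasure 0).integral f (ContinuousLinearMap.mul ℝ ℂ) =
      c * ∫ x, f x ∂μ := by
  set ν : ComplexMeasure X := c • μ.toSignedMeasure.toComplexMeasure 0 with hν
  have hval : ∀ s, MeasurableSet s → ν s = c * μ.real s := by
    intro s hs
    rw [hν, smul_apply, SignedMeasure.toComplexMeasure_apply,
      Measure.toSignedMeasure_apply_measurable hs, smul_eq_mul]
    rfl
  -- Domination of the variation makes both sides continuous in f for the L¹ norm of μ, so the
  -- equality may be checked on indicators of measurable sets.
  have hle : ν.variation ≤ ‖c‖ₑ • μ := by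
    refine VectorMeasure.variation_le_of_forall_enorm_le fun s hs => ?_
    rw [hval s hs, enorm_mul, Measure.smul_apply, smul_eq_mul]
    gcongr
    rw [← ofReal_norm, Complex.norm_real, Real.norm_of_nonneg measureReal_nonneg,
      measureReal_def, ENNReal.ofReal_toReal (measure_ne_top μ s)]
  have hT' := dominatedFinMeasAdditive_cbmApplyMeasure ν (ContinuousLinearMap.mul ℝ ℂ)
  have hT := hT'.of_measure_le_smul enorm_ne_top hle
    (ContinuousLinearMap.opNorm_nonneg (ContinuousLinearMap.mul ℝ ℂ))
  refine ⟨hf.of_measure_le_smul enorm_ne_top hle, ?_⟩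
  rw [VectorMeasure.integral_eq_setToFun,
    ← setToFun_congr_measure_of_integrable ‖c‖ₑ enorm_ne_top hle hT hT' f hf]
  refine Integrable.induction (P := fun f => setToFun μ _ hT f = c * ∫ x, f x ∂μ)
    (fun a s hs hμs => ?_) (fun f g _ hf hg h h' => ?_) ?_ (fun f g hfg hf h => ?_) hf
  · rw [setToFun_indicator_const hT hs hμs.ne, integral_indicator_const _ hs]
    change a * ν s = _
    rw [hval _ hs, Complex.real_smul]
    ring
  · rw [setToFun_add hT hf hg, h, h', integral_add' hf hg, mul_add]
  · exact isClosed_eq (continuous_setToFun hT) (continuous_integral.const_mul c)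
  · rw [← setToFun_congr_ae hT hfg, h, integral_congr_ae hfg]

section measFourier

variable {n : ℕ} {T : Subgroup (GL (Fin n) ℂ)} {I : Type*} {α : I → weightLattice T}

theorem simplexMap_apply (hT : IsZariskiClosed T) (l : List I)
    (c : Fin (l.length + 1) → ℝ) (x : lieAlg T) :
    (simplexMap hT α l c : lieAlg T → ℂ) x =
      -∑ k, (c k : ℂ) * ((l.map fun i => differential hT (α i) x).take k).sum := by
  have h1 : ∀ k : ℕ, (partialSum hT α l k : lieAlg T → ℂ) x =
      ((l.map fun i => differential hT (α i) x).take k).sum := by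
    intro k
    rw [← List.map_take, partialSum]
    generalize l.take k = l'
    induction l' with
    | nil => rfl
    | cons i l' ih =>
      rw [List.map_cons, List.sum_cons, List.map_cons, List.sum_cons, ← ih]
      rfl
  simp only [← h1, simplexMap]
  simp [Finset.sum_apply]

theorem measurable_simplexMap (hT : IsZariskiClosed T) (l : List I) :
    Measurable (simplexMap hT α l) := by
  have h1 : Measurable fun c => (simplexMap hT α l c : lieAlg T → ℂ) := by
    refine measurable_pi_lambda _ fun x => ?_
    simp only [simplexMap_apply]
    fun_prop
  exact h1.subtype_mk

theorem integral_seqMeasure (hT : IsZariskiClosed T) (l : List I) (x : lieAlg T) :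
    Integrable (fun β : realDual hT => Complex.exp ((β : lieAlg T → ℂ) x)) (seqMeasure hT α l) ∧
    ∫ β : realDual hT, Complex.exp ((β : lieAlg T → ℂ) x) ∂(seqMeasure hT α l) =
      iterInt (l.map fun i => differential hT (α i) x) 1 := by
  have hF : Measurable fun β : realDual hT => Complex.exp ((β : lieAlg T → ℂ) x) :=
    Complex.measurable_exp.comp ((measurable_pi_apply x).comp measurable_subtype_coe)
  have hg : Measurable fun c : Fin l.length → ℝ =>
      (Fin.cons (1 - ∑ k, c k) c : Fin (l.length + 1) → ℝ) := by
    refine Continuous.measurable (continuous_pi fun k => ?_)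
    refine Fin.cases ?_ (fun k => ?_) k
    · simp only [Fin.cons_zero]; fun_prop
    · simp only [Fin.cons_succ]; fun_prop
  have hs := measurable_simplexMap (α := α) hT l
  -- The dimension p is kept apart from `a.length`, because the list to be used is a `map`, whose
  -- length is `l.length` only up to a rewriting.
  have hphase : ∀ (a : List ℂ) (p : ℕ), p = a.length →
      Continuous (fun c : Fin p → ℝ => ∑ k, (c k : ℂ) * (a.take (k + 1)).sum) ∧
      ∫ c in cornerSimplex p, Complex.exp (-∑ k, (c k : ℂ) * (a.take (k + 1)).sum) =
        iterInt a 1 := by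
    rintro a p rfl
    exact ⟨continuous_simplexPhase a, integral_scaledSimplex a 1 zero_le_one⟩
  obtain ⟨hc, hint⟩ := hphase (l.map fun i => differential hT (α i) x) l.length (by simp)
  have hval : ∀ c : Fin l.length → ℝ, Complex.exp ((simplexMap hT α l
      (Fin.cons (1 - ∑ k, c k) c : Fin (l.length + 1) → ℝ) : lieAlg T → ℂ) x) =
      Complex.exp (-∑ k, (c k : ℂ) *
        ((l.map fun i => differential hT (α i) x).take (k + 1)).sum) := by
    intro c
    -- The coordinate c_0 drops out since β_0 = 0.
    rw [simplexMap_apply, Fin.sum_univ_succ]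
    simp
  rw [seqMeasure, simplexMeasure, Measure.map_map hs hg]
  constructor
  · rw [integrable_map_measure hF.aestronglyMeasurable (hs.comp hg).aemeasurable]
    simp only [Function.comp_def, hval]
    exact ContinuousOn.integrableOn_compact (isCompact_scaledSimplex _ 1) (by fun_prop)
  · rw [integral_map (hs.comp hg).aemeasurable hF.aestronglyMeasurable]
    simp only [Function.comp_def, hval]
    exact hint

/-- The Fourier transform of `D(f)`. -/
theorem measFourier_measD [Fintype I] {N : Subgroup (GL (Fin n) ℂ)} (hT : IsZariskiClosed T)
    (hN : IsZariskiClosed N) (e : I → lieAlg N) (f : N → ℂ) {L : Finset (List I)}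
    (hL : (Function.support fun l : List I => monomialPairing hN e l f) ⊆ L) (x : lieAlg T) :
    measFourier (measD hT hN α e f) x = ∑ l ∈ L, monomialPairing hN e l f *
      iterInt (l.map fun i => differential hT (α i) x) 1 := by
  have h1 : measD hT hN α e f = ∑ l ∈ L, monomialPairing hN e l f •
      (seqMeasure hT α l).toSignedMeasure.toComplexMeasure 0 :=
    finsum_eq_sum_of_support_subset _ fun l hl => hL fun h => hl (by
      simp only at h ⊢
      rw [h]
      exact VectorMeasure.ext fun i _ => zero_smul ℂ _)
  have h2 := fun l => integral_smul_toComplexMeasure (seqMeasure hT α l)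
    (monomialPairing hN e l f) (integral_seqMeasure hT l x).1
  rw [measFourier, h1, VectorMeasure.integral_finsetSum_vectorMeasure fun l _ => (h2 l).1]
  exact Finset.sum_congr rfl fun l _ => by rw [(h2 l).2, (integral_seqMeasure hT l x).2]

end measFourier

end LinAlgGroup

/-! ### Comparison of rational forms, and the family n_x -/

namespace LinAlgGroup

/-! ### Regular functions -/

theorem comp_mem_of_mem_coordRing {n : ℕ} {H : Subgroup (GL (Fin n) ℂ)} {Y : Type*}
    (S : Subalgebra ℂ (Y → ℂ)) {φ : Y → H}
    (hφ : ∀ i j, (fun y => ((φ y : GL (Fin n) ℂ) : Matrix (Fin n) (Fin n) ℂ) i j) ∈ S)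
    (hφ' : ∀ i j, (fun y => (((φ y : GL (Fin n) ℂ)⁻¹ : GL (Fin n) ℂ) :
      Matrix (Fin n) (Fin n) ℂ) i j) ∈ S)
    {q : H → ℂ} (hq : q ∈ coordRing H) : (fun y => q (φ y)) ∈ S := by
  induction hq using Algebra.adjoin_induction with
  | mem q hq =>
    obtain ⟨i, j, rfl | rfl⟩ := hq
    · exact hφ i j
    · exact hφ' i j
  | algebraMap r => exact S.algebraMap_mem r
  | add p q _ _ hp hq => exact S.add_mem hp hq
  | mul p q _ _ hp hq => exact S.mul_mem hp hq

section regularRing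

variable {V : Type*} [AddCommGroup V] [Module ℂ V] {U : Set V} {n : ℕ}
  {H : Subgroup (GL (Fin n) ℂ)} {Y : Type*} {a : Y → V} {b : Y → H}

theorem poly_mem_regularRing {p : V → ℂ} (hp : p ∈ polyRing V) :
    (fun y => p (a y)) ∈ regularRing U a b :=
  Algebra.subset_adjoin (Or.inl (Or.inl ⟨p, hp, rfl⟩))

theorem inv_mem_regularRing {q : V → ℂ} (hq : q ∈ polyRing V) (hqU : ∀ u ∈ U, q u ≠ 0) :
    (fun y => (q (a y))⁻¹) ∈ regularRing U a b :=
  Algebra.subset_adjoin (Or.inl (Or.inr ⟨q, hq, hqU, rfl⟩))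

theorem coord_mem_regularRing {q : H → ℂ} (hq : q ∈ coordRing H) :
    (fun y => q (b y)) ∈ regularRing U a b :=
  Algebra.subset_adjoin (Or.inr ⟨q, hq, rfl⟩)

theorem entry_mem_regularRing (i j : Fin n) :
    (fun y => ((b y : GL (Fin n) ℂ) : Matrix (Fin n) (Fin n) ℂ) i j) ∈ regularRing U a b :=
  coord_mem_regularRing (Algebra.subset_adjoin ⟨i, j, Or.inl rfl⟩)

theorem inv_entry_mem_regularRing (i j : Fin n) :
    (fun y => (((b y : GL (Fin n) ℂ)⁻¹ : GL (Fin n) ℂ) : Matrix (Fin n) (Fin n) ℂ) i j) ∈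
      regularRing U a b :=
  coord_mem_regularRing (q := fun h : H => (((h⁻¹ : H) : GL (Fin n) ℂ) :
    Matrix (Fin n) (Fin n) ℂ) i j) (Algebra.subset_adjoin ⟨i, j, Or.inr rfl⟩)

/-- Pull back of regular functions. -/
theorem comp_mem_of_mem_regularRing {Y' : Type*} (S : Subalgebra ℂ (Y' → ℂ)) {θ : Y' → Y}
    (hp : ∀ p ∈ polyRing V, (fun y => p (a (θ y))) ∈ S)
    (hp' : ∀ p ∈ polyRing V, (∀ u ∈ U, p u ≠ 0) → (fun y => (p (a (θ y)))⁻¹) ∈ S)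
    (hb : ∀ i j, (fun y => ((b (θ y) : GL (Fin n) ℂ) : Matrix (Fin n) (Fin n) ℂ) i j) ∈ S)
    (hb' : ∀ i j, (fun y => (((b (θ y) : GL (Fin n) ℂ)⁻¹ : GL (Fin n) ℂ) :
      Matrix (Fin n) (Fin n) ℂ) i j) ∈ S)
    {F : Y → ℂ} (hF : F ∈ regularRing U a b) : (fun y => F (θ y)) ∈ S := by
  induction hF using Algebra.adjoin_induction with
  | mem F hF =>
    obtain (⟨p, h, rfl⟩ | ⟨p, h, hU, rfl⟩) | ⟨q, h, rfl⟩ := hF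
    · exact hp p h
    · exact hp' p h hU
    · exact comp_mem_of_mem_coordRing S hb hb' h
  | algebraMap r => exact S.algebraMap_mem r
  | add p q _ _ hp hq => exact S.add_mem hp hq
  | mul p q _ _ hp hq => exact S.mul_mem hp hq

/-- Only functions of the base point are inverted, so a common denominator is a polynomial on V
without zeros on U. -/
theorem exists_denominator (ha : ∀ y, a y ∈ U) {F : Y → ℂ} (hF : F ∈ regularRing U a b) :
    ∃ d ∈ polyRing V, (∀ u ∈ U, d u ≠ 0) ∧ ∃ h ∈ prodRing V H, ∀ y,
      d (a y) * F y = h (a y, b y) := by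
  have hpoly : ∀ p ∈ polyRing V, (fun z : V × H => p z.1) ∈ prodRing V H :=
    fun p hp => Algebra.subset_adjoin (Or.inl ⟨p, hp, rfl⟩)
  induction hF using Algebra.adjoin_induction with
  | mem F hF =>
    obtain (⟨p, hp, rfl⟩ | ⟨p, hp, hU, rfl⟩) | ⟨q, hq, rfl⟩ := hF
    · exact ⟨1, one_mem _, fun _ _ => one_ne_zero, _, hpoly p hp, fun y => one_mul _⟩
    · exact ⟨p, hp, hU, 1, one_mem _, fun y => mul_inv_cancel₀ (hU _ (ha y))⟩
    · exact ⟨1, one_mem _, fun _ _ => one_ne_zero, _,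
        Algebra.subset_adjoin (Or.inr ⟨q, hq, rfl⟩), fun y => one_mul _⟩
  | algebraMap r =>
    exact ⟨1, one_mem _, fun _ _ => one_ne_zero, _, (prodRing V H).algebraMap_mem r,
      fun y => one_mul _⟩
  | add F G _ _ hF hG =>
    obtain ⟨d, hd, hdU, h, hh, hF⟩ := hF
    obtain ⟨d', hd', hdU', h', hh', hG⟩ := hG
    refine ⟨d * d', mul_mem hd hd', fun u hu => mul_ne_zero (hdU u hu) (hdU' u hu),
      (fun z => d' z.1) * h + (fun z => d z.1) * h',
      add_mem (mul_mem (hpoly _ hd') hh) (mul_mem (hpoly _ hd) hh'), fun y => ?_⟩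
    simp only [Pi.mul_apply, Pi.add_apply, ← hF, ← hG]
    ring
  | mul F G _ _ hF hG =>
    obtain ⟨d, hd, hdU, h, hh, hF⟩ := hF
    obtain ⟨d', hd', hdU', h', hh', hG⟩ := hG
    refine ⟨d * d', mul_mem hd hd', fun u hu => mul_ne_zero (hdU u hu) (hdU' u hu), h * h',
      mul_mem hh hh', fun y => ?_⟩
    simp only [Pi.mul_apply, ← hF, ← hG]
    ring

end regularRing

/-- A rational form of `Φ` determines the regular function that restricts to `Φ` on the graph of
the exponential map. -/
theorem eq_mul_of_isRationalForm {n : ℕ} {T : Subgroup (GL (Fin n) ℂ)} (hT : IsTorus T)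
    {U : Set (lieAlg T)} {δ : lieAlg T → ℂ} (hδ : δ ∈ polyRing (lieAlg T))
    (hU : ∀ x, x ∈ U ↔ δ x ≠ 0) {F : U × T → ℂ}
    (hF : F ∈ regularRing U (fun y : U × T => (y.1 : lieAlg T)) (fun y => y.2))
    {Φ s : lieAlg T → ℂ} {p : lieAlg T × T → ℂ} (hform : IsRationalForm hT.closed Φ s p)
    (hΦ : ∀ x : U, Φ x = F (x, lieExp hT.closed x)) (x : U) (t : T) :
    p (x, t) = s x * F (x, t) := by
  obtain ⟨d, hd, hdU, h, hh, hFh⟩ := exists_denominator (fun y => y.1.2) hF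
  obtain ⟨hs, -, hp, hsp⟩ := hform
  have hpoly : ∀ q ∈ polyRing (lieAlg T), (fun z : lieAlg T × T => q z.1) ∈
      prodRing (lieAlg T) T := fun q hq => Algebra.subset_adjoin (Or.inl ⟨q, hq, rfl⟩)
  -- The cross-multiplied identity s h = d p is known on the graph only over {δ ≠ 0}; the factor δ
  -- makes it hold over all of 𝔱, where density of the graph applies.
  have h0 := eq_zero_of_graph_eq_zero hT (F := (fun z => δ z.1) * ((fun z => s z.1) * h -
    (fun z => d z.1) * p)) (mul_mem (hpoly _ hδ) (sub_mem (mul_mem (hpoly _ hs) hh)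
      (mul_mem (hpoly _ hd) hp))) (fun x => by
      simp only [Pi.mul_apply, Pi.sub_apply]
      by_cases hx : δ x = 0
      · rw [hx, zero_mul]
      · have h1 := hFh (⟨x, (hU x).2 hx⟩, lieExp hT.closed x)
        rw [← hΦ ⟨x, (hU x).2 hx⟩] at h1
        simp only at h1
        rw [← h1, ← hsp]
        ring)
  have h1 := congrFun h0 (x, t)
  simp only [Pi.mul_apply, Pi.sub_apply, Pi.zero_apply] at h1
  have h2 := sub_eq_zero.1 ((mul_eq_zero.1 h1).resolve_left ((hU x).1 x.2))
  rw [← hFh (x, t)] at h2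
  refine mul_left_cancel₀ (hdU x x.2) ?_
  rw [← h2]
  ring

/-! ### The family of the elements `n_x` -/

section conjugator

variable {n : ℕ} {P : GL (Fin n) ℂ} {B T N : Subgroup (GL (Fin n) ℂ)}

theorem IsTriangularForm.exists_conjugator (h : IsTriangularForm P B T N) (hB : IsZariskiClosed B)
    (hN : IsZariskiClosed N) (hTB : T ≤ B)
    (hbr : ∀ x ∈ lieAlg T, ∀ Y ∈ lieAlg N, x * Y - Y * x ∈ lieAlg N)
    {e : Matrix (Fin n) (Fin n) ℂ} (he : e ∈ lieAlg N) :
    ∃ nx : {x : lieAlg T | discriminant hbr x ≠ 0} → N,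
      (∀ x (m : N), Ad (m : GL (Fin n) ℂ) (x.1 : Matrix (Fin n) (Fin n) ℂ) = x.1 + e ↔
        m = nx x) ∧
      ∀ (Y : Type) (S : Subalgebra ℂ (Y → ℂ)) (ξ : Y → {x : lieAlg T | discriminant hbr x ≠ 0}),
        (∀ i j, (fun y => ((ξ y).1 : Matrix (Fin n) (Fin n) ℂ) i j) ∈ S) →
        (fun y => (discriminant hbr (ξ y).1)⁻¹) ∈ S →
        (∀ i j, (fun y => ((nx (ξ y) : GL (Fin n) ℂ) : Matrix (Fin n) (Fin n) ℂ) i j) ∈ S) ∧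
        ∀ i j, (fun y => (((nx (ξ y) : GL (Fin n) ℂ)⁻¹ : GL (Fin n) ℂ) :
          Matrix (Fin n) (Fin n) ℂ) i j) ∈ S := by
  -- With the algebra of all functions only existence is used. Rationality over any other parameter
  -- space comes from a second construction there, which uniqueness identifies with the pull back of
  -- this family.
  obtain ⟨nx, -, -, hnx⟩ := h.exists_Ad_eq hB hN hTB hbr he ⊤
    (ξ := fun x : {x : lieAlg T | discriminant hbr x ≠ 0} => x.1) (fun _ _ => Algebra.mem_top)
    (fun x => x.2) Algebra.mem_top
  have huniq : ∀ (x : {x : lieAlg T | discriminant hbr x ≠ 0}) (m : N),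
      Ad (m : GL (Fin n) ℂ) (x.1 : Matrix (Fin n) (Fin n) ℂ) = x.1 + e → m = nx x :=
    fun x m hm => Subtype.ext (h.eq_of_Ad_eq hbr x.2 m.2 (nx x).2 (hm.trans (hnx x).symm))
  refine ⟨nx, fun x m => ⟨huniq x m, fun hm => hm ▸ hnx x⟩, fun Y S ξ hξ hδ => ?_⟩
  obtain ⟨g, hg, hg', hgx⟩ := h.exists_Ad_eq hB hN hTB hbr he S hξ (fun y => (ξ y).2) hδ
  obtain rfl : g = fun y => nx (ξ y) := funext fun y => huniq _ _ (hgx y)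
  exact ⟨hg, hg'⟩

theorem IsTriangularForm.commutator_mem (h : IsTriangularForm P B T N) (hTB : T ≤ B) (t : T)
    (m : N) : (t : GL (Fin n) ℂ)⁻¹ * m * t * (m : GL (Fin n) ℂ)⁻¹ ∈ N := by
  refine N.mul_mem ?_ (N.inv_mem m.2)
  have hm := (h.mem_unipotent_iff _).1 m.2
  have ht := hTB t.2
  refine (h.mem_unipotent_iff _).2 ⟨B.mul_mem (B.mul_mem (B.inv_mem ht) hm.1) ht, ?_⟩
  have h1 : (((t : GL (Fin n) ℂ)⁻¹ * m * t : GL (Fin n) ℂ) : Matrix (Fin n) (Fin n) ℂ) - 1 =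
      (((t : GL (Fin n) ℂ)⁻¹ : GL (Fin n) ℂ) : Matrix (Fin n) (Fin n) ℂ) *
        (((m : GL (Fin n) ℂ) : Matrix (Fin n) (Fin n) ℂ) - 1) * (t : GL (Fin n) ℂ) := by
    rw [mul_sub, sub_mul, mul_one, Units.inv_mul, Units.val_mul, Units.val_mul]
  rw [h1]
  exact mul_mem_superdiag (k := 1) (l := 0) (by
    simpa using! mul_mem_superdiag (h.triangular _ (B.inv_mem ht)) hm.2) (h.triangular _ ht)

/-- An element of `B` that centralizes `x + e = Ad_m x` is conjugate by `m` to an element of `T`. -/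
theorem IsTriangularForm.exists_eq_conj (h : IsTriangularForm P B T N)
    (hB : IsZariskiClosed B) (hBc : IsZariskiConnected B) (hT : IsZariskiClosed T)
    (hN : IsZariskiClosed N) (hTB : T ≤ B) {G : Subgroup (GL (Fin n) ℂ)} (hBG : B ≤ G)
    (hbr : ∀ x ∈ lieAlg T, ∀ Y ∈ lieAlg N, x * Y - Y * x ∈ lieAlg N)
    {x : lieAlg T} (hx : x ∈ regularSet G T) {b m : GL (Fin n) ℂ} (hb : b ∈ B) (hm : m ∈ N)
    (hbm : Ad b (Ad m (x : Matrix (Fin n) (Fin n) ℂ)) = Ad m x) :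
    ∃ t ∈ T, b = m * t * m⁻¹ := by
  have hmB := ((h.mem_unipotent_iff _).1 hm).1
  obtain ⟨t, ht, u, hu, htu⟩ := h.exists_mul_of_regular hB hBc hT hN hTB hBG hx
    (B.mul_mem (B.mul_mem (B.inv_mem hmB) hb) hmB)
  have h1 : Ad (t * u) (x : Matrix (Fin n) (Fin n) ℂ) = x := by
    rw [← htu, Ad_mul, Ad_mul, hbm, Ad_inv_eq]
  have h2 : Ad u (x : Matrix (Fin n) (Fin n) ℂ) = x := by
    rw [Ad_mul] at h1
    have h3 := Ad_inv_eq.2 h1.symm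
    rw [← h3]
    exact h.commute (T.inv_mem ht) x.2
  have h3 : u = 1 := h.eq_of_Ad_eq hbr (h.discriminant_ne_zero hB hN hTB hBG hbr hx) hu N.one_mem
    (by rw [h2, Ad_one])
  refine ⟨t, ht, ?_⟩
  rw [h3, mul_one] at htu
  rw [← htu]
  group

end conjugator

end LinAlgGroup

/-! ### The theorem -/

theorem mainTheorem7 {n : ℕ} (G B T N : Subgroup (GL (Fin n) ℂ))
    (hG : IsSimpleAlgebraicGroup G) (hsc : SimplyConnectedSpace G)
    (hB : IsBorel B G) (hT : IsMaximalTorus T B) (hN : IsUnipotentRadical N B)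
    {I : Type*} [Fintype I] (α : I → weightLattice T) (hα : IsSimpleSystem T N α)
    (e : I → lieAlg N)
    (he : ∀ i, IsRootVector (α i) (e i : Matrix (Fin n) (Fin n) ℂ))
    (eSum : Matrix (Fin n) (Fin n) ℂ) (heSum : eSum = ∑ i, (e i : Matrix (Fin n) (Fin n) ℂ)) :
    ∃ (nx : regularSet G T → N)
      (τ : univCentralizer G B T eSum (regularSet G T) → T)
      (ν : univCentralizer G B T eSum (regularSet G T) → N)
      (ψ : regularSet G T × T → N),
      -- `nx x` is the unique element `m` of `N` with `Ad_m x = x + e`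
      (∀ (x : regularSet G T) (m : N),
        Ad (m : GL (Fin n) ℂ) (x.1 : Matrix (Fin n) (Fin n) ℂ) =
          (x.1 : Matrix (Fin n) (Fin n) ℂ) + eSum ↔ m = nx x) ∧
      -- `t = τ (x, b)` and `m = ν (x, b)` are the unique elements of `T` and `N` with `b = t m`
      (∀ (z : univCentralizer G B T eSum (regularSet G T)) (t : T) (m : N),
        (z.1.2 : GL (Fin n) ℂ) = (t : GL (Fin n) ℂ) * (m : GL (Fin n) ℂ) ↔ t = τ z ∧ m = ν z) ∧
      -- `ψ (x, t) = t⁻¹ n_x t n_x⁻¹`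
      (∀ (x : regularSet G T) (t : T), (ψ (x, t) : GL (Fin n) ℂ) =
        (t : GL (Fin n) ℂ)⁻¹ * (nx x : GL (Fin n) ℂ) * (t : GL (Fin n) ℂ) *
          (nx x : GL (Fin n) ℂ)⁻¹) ∧
      -- (i) `(x, b) ↦ (x, τ (x, b))` is an isomorphism of varieties
      (Function.Bijective (toRegTorus τ) ∧
        ∀ F : regularSet G T × T → ℂ,
          F ∈ regTorusRing G T ↔ F ∘ toRegTorus τ ∈ regCentralizerRing G B T eSum) ∧
      -- (ii) under this isomorphism, the map `(x, b) ↦ ν (x, b)` to `N` becomes `ψ`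
      (∀ z, ν z = ψ (toRegTorus τ z)) ∧
      -- (iii) the pull back along `ψ` is `FT ∘ D`
      (∀ f ∈ coordRing N,
        (Function.support fun l : List I => monomialPairing hN.closed e l f).Finite ∧
        f ∘ ψ ∈ regTorusRing G T ∧
        (∃ s ∈ rootDenominators hT.closed α, ∃ p,
          IsRationalForm hT.closed (measFourier (measD hT.closed hN.closed α e f)) s p) ∧
        (∀ s p, IsRationalForm hT.closed (measFourier (measD hT.closed hN.closed α e f)) s p →
          ∀ (x : regularSet G T) (t : T), p (x.1, t) = s x.1 * f (ψ (x, t)))) := by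
  have hBc := hB.closed
  have hNc := hN.closed
  have hTt : IsTorus T := hT.toIsTorus
  have hTB := hT.le
  have hBG := hB.le
  obtain ⟨P, h⟩ := exists_triangularForm hBc hB.connected hB.solvable hTt hTB hN
  have hbr : ∀ x ∈ lieAlg T, ∀ Y ∈ lieAlg N, x * Y - Y * x ∈ lieAlg N := fun x hx Y hY =>
    h.bracket_mem hBc hNc (lieAlg_mono hTB hx) hY
  have heN : eSum ∈ lieAlg N := heSum ▸ (lieAlg N).sum_mem fun i _ => (e i).2
  have hreg : ∀ x ∈ regularSet G T, discriminant hbr x ≠ 0 := fun x hx =>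
    h.discriminant_ne_zero hBc hNc hTB hBG hbr hx
  have hentry : ∀ i j, (fun x : lieAlg T => (x : Matrix (Fin n) (Fin n) ℂ) i j) ∈
      polyRing (lieAlg T) := fun i j =>
    dual_mem_polyRing (Matrix.entryLinearMap ℂ ℂ i j ∘ₗ (lieAlg T).subtype)
  have hδ : discriminant hbr ∈ polyRing (lieAlg T) := discriminant_mem hbr _ hentry
  -- The family is built on all of {δ ≠ 0}, which contains the regular set: the comparison of
  -- rational forms in (iii) needs an open set defined by a single polynomial.
  obtain ⟨nx', hnx', hnxS⟩ := h.exists_conjugator hBc hNc hTB hbr heN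
  let ι : regularSet G T → {x : lieAlg T | discriminant hbr x ≠ 0} := fun x => ⟨x.1, hreg _ x.2⟩
  let nx : regularSet G T → N := fun x => nx' (ι x)
  have hnx : ∀ (x : regularSet G T) (m : N), Ad (m : GL (Fin n) ℂ)
      (x.1 : Matrix (Fin n) (Fin n) ℂ) = (x.1 : Matrix (Fin n) (Fin n) ℂ) + eSum ↔ m = nx x :=
    fun x m => hnx' (ι x) m
  let ψ' : {x : lieAlg T | discriminant hbr x ≠ 0} × T → N := fun y =>
    ⟨_, h.commutator_mem hTB y.2 (nx' y.1)⟩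
  let ψ : regularSet G T × T → N := fun y => ψ' (ι y.1, y.2)
  have hNB : ∀ m : N, (m : GL (Fin n) ℂ) ∈ B := fun m => hN.le m.2
  let C := univCentralizer G B T eSum (regularSet G T)
  have hfac : ∀ z : C, ∃ t : T, (z.1.2 : GL (Fin n) ℂ) =
      nx ⟨z.1.1, z.2.1⟩ * t * (nx ⟨z.1.1, z.2.1⟩ : GL (Fin n) ℂ)⁻¹ := by
    intro z
    have h1 := (hnx ⟨z.1.1, z.2.1⟩ _).2 rfl
    obtain ⟨t, ht, htz⟩ := h.exists_eq_conj hBc hB.connected hTt.closed hNc hTB hBG hbr z.2.1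
      z.1.2.2 (nx ⟨z.1.1, z.2.1⟩).2 (by rw [h1]; exact z.2.2.2)
    exact ⟨⟨t, ht⟩, htz⟩
  choose τ hτ using hfac
  have hψ : ∀ (x : regularSet G T) (t : T), (ψ (x, t) : GL (Fin n) ℂ) =
      (t : GL (Fin n) ℂ)⁻¹ * (nx x : GL (Fin n) ℂ) * (t : GL (Fin n) ℂ) *
        (nx x : GL (Fin n) ℂ)⁻¹ := fun x t => rfl
  have hfact : ∀ (t t' : T) (m m' : N), (t : GL (Fin n) ℂ) * (m : GL (Fin n) ℂ) = t' * m' →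
      t = t' ∧ m = m' := by
    intro t t' m m' htm
    have h1 : (t' : GL (Fin n) ℂ)⁻¹ * t = m' * (m : GL (Fin n) ℂ)⁻¹ := by
      rw [eq_mul_inv_iff_mul_eq, mul_assoc, htm, inv_mul_cancel_left]
    have h2 := h.eq_one_of_mem (T.mul_mem (T.inv_mem t'.2) t.2)
      (h1 ▸ N.mul_mem m'.2 (N.inv_mem m.2))
    have h3 : (t : GL (Fin n) ℂ) = t' := (inv_mul_eq_one.1 h2).symm
    rw [h3, mul_right_inj] at htm
    exact ⟨Subtype.ext h3, Subtype.ext htm⟩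
  have hτψ : ∀ z : C, (z.1.2 : GL (Fin n) ℂ) =
      (τ z : GL (Fin n) ℂ) * (ψ (toRegTorus τ z) : GL (Fin n) ℂ) := by
    intro z
    rw [hτ z]
    change _ = _ * ((τ z : GL (Fin n) ℂ)⁻¹ * (nx ⟨z.1.1, z.2.1⟩ : GL (Fin n) ℂ) *
      (τ z : GL (Fin n) ℂ) * (nx ⟨z.1.1, z.2.1⟩ : GL (Fin n) ℂ)⁻¹)
    group
  -- The inverse isomorphism (x, t) ↦ (x, n_x t n_x⁻¹).
  let Ψ : regularSet G T × T → C := fun y =>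
    ⟨(y.1.1, ⟨nx y.1 * y.2 * (nx y.1 : GL (Fin n) ℂ)⁻¹,
      B.mul_mem (B.mul_mem (hNB _) (hTB y.2.2)) (B.inv_mem (hNB _))⟩), y.1.2,
      hBG (B.mul_mem (B.mul_mem (hNB _) (hTB y.2.2)) (B.inv_mem (hNB _))), by
        have h1 := (hnx y.1 _).2 rfl
        simp only
        rw [← h1, ← Ad_mul, inv_mul_cancel_right, Ad_mul, h.commute y.2.2 y.1.1.2]⟩
  have hΦΨ : ∀ y, toRegTorus τ (Ψ y) = y := by
    intro y
    have h1 := hτψ (Ψ y)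
    have h2 : ((Ψ y).1.2 : GL (Fin n) ℂ) = y.2 * (ψ y : GL (Fin n) ℂ) := by
      change (nx y.1 * y.2 * (nx y.1 : GL (Fin n) ℂ)⁻¹ : GL (Fin n) ℂ) =
        y.2 * ((y.2 : GL (Fin n) ℂ)⁻¹ * (nx y.1 : GL (Fin n) ℂ) * (y.2 : GL (Fin n) ℂ) *
          (nx y.1 : GL (Fin n) ℂ)⁻¹)
      group
    exact Prod.ext rfl (hfact _ _ _ _ (h1.symm.trans h2)).1
  have hΨΦ : ∀ z, Ψ (toRegTorus τ z) = z := fun z =>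
    Subtype.ext (Prod.ext rfl (Subtype.ext (hτ z).symm))
  have hpolyδ : ∀ (Y : Type) (a : Y → regularSet G T) (H : Subgroup (GL (Fin n) ℂ)) (b : Y → H),
      (∀ i j, (fun y => ((nx (a y) : GL (Fin n) ℂ) : Matrix (Fin n) (Fin n) ℂ) i j) ∈
        regularRing (regularSet G T) (fun y => (a y).1) b) ∧
      ∀ i j, (fun y => (((nx (a y) : GL (Fin n) ℂ)⁻¹ : GL (Fin n) ℂ) :
        Matrix (Fin n) (Fin n) ℂ) i j) ∈ regularRing (regularSet G T) (fun y => (a y).1) b :=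
    fun Y a H b => hnxS Y _ (fun y => ι (a y)) (fun i j => poly_mem_regularRing (hentry i j))
      (inv_mem_regularRing hδ hreg)
  have hψS : ∀ (Y : Type) (S : Subalgebra ℂ (Y → ℂ))
      (ξ : Y → {x : lieAlg T | discriminant hbr x ≠ 0}) (θ : Y → T),
      (∀ i j, (fun y => ((ξ y).1 : Matrix (Fin n) (Fin n) ℂ) i j) ∈ S) →
      (fun y => (discriminant hbr (ξ y).1)⁻¹) ∈ S →
      (∀ i j, (fun y => ((θ y : GL (Fin n) ℂ) : Matrix (Fin n) (Fin n) ℂ) i j) ∈ S) →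
      (∀ i j, (fun y => (((θ y : GL (Fin n) ℂ)⁻¹ : GL (Fin n) ℂ) :
        Matrix (Fin n) (Fin n) ℂ) i j) ∈ S) →
      ∀ f ∈ coordRing N, (fun y => f (ψ' (ξ y, θ y))) ∈ S := by
    intro Y S ξ θ hξ hξδ hθ hθ' f hf
    obtain ⟨h1, h2⟩ := hnxS Y S ξ hξ hξδ
    refine comp_mem_of_mem_coordRing S (φ := fun y => ψ' (ξ y, θ y)) ?_ ?_ hf
    · exact matrix_mul_entry_mem S (matrix_mul_entry_mem S (matrix_mul_entry_mem S hθ' h1) hθ) h2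
    · have h3 : ∀ y, (ψ' (ξ y, θ y) : GL (Fin n) ℂ)⁻¹ = (nx' (ξ y) : GL (Fin n) ℂ) *
          ((θ y : GL (Fin n) ℂ)⁻¹ * ((nx' (ξ y) : GL (Fin n) ℂ)⁻¹ * θ y)) := by
        intro y
        change ((θ y : GL (Fin n) ℂ)⁻¹ * (nx' (ξ y) : GL (Fin n) ℂ) * (θ y : GL (Fin n) ℂ) *
          (nx' (ξ y) : GL (Fin n) ℂ)⁻¹)⁻¹ = _
        group
      simp only [h3]
      exact matrix_mul_entry_mem S h1 (matrix_mul_entry_mem S hθ' (matrix_mul_entry_mem S h2 hθ))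
  refine ⟨nx, τ, fun z => ψ (toRegTorus τ z), ψ, hnx, fun z t m => ⟨fun htm => ?_, ?_⟩, hψ,
    ⟨⟨fun z z' hz => ?_, fun y => ⟨Ψ y, hΦΨ y⟩⟩, fun F => ⟨fun hF => ?_, fun hF => ?_⟩⟩,
    fun z => rfl, fun f hf => ?_⟩
  · exact hfact _ _ _ _ (htm.symm.trans (hτψ z))
  · rintro ⟨rfl, rfl⟩
    exact hτψ z
  · rw [← hΨΦ z, hz, hΨΦ]
  -- Regularity of the map: t = n_x⁻¹ b n_x, and the entries of n_x are regular because δ is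
  -- invertible on the regular set.
  · have hconj : ∀ a b t : GL (Fin n) ℂ, b = a * t * a⁻¹ → t = a⁻¹ * (b * a) := by
      rintro a b t rfl
      group
    obtain ⟨h1, h2⟩ := hpolyδ C (fun z => ⟨z.1.1, z.2.1⟩) B (fun z => z.1.2)
    have h3 : ∀ z : C, (τ z : GL (Fin n) ℂ) = (nx ⟨z.1.1, z.2.1⟩ : GL (Fin n) ℂ)⁻¹ *
        (z.1.2 * nx ⟨z.1.1, z.2.1⟩) := by
      exact fun z => hconj _ _ _ (hτ z)
    have h4 : ∀ z : C, (τ z : GL (Fin n) ℂ)⁻¹ = (nx ⟨z.1.1, z.2.1⟩ : GL (Fin n) ℂ)⁻¹ *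
        ((z.1.2 : GL (Fin n) ℂ)⁻¹ * nx ⟨z.1.1, z.2.1⟩) := by
      intro z
      rw [h3]
      group
    refine comp_mem_of_mem_regularRing (regCentralizerRing G B T eSum) (θ := toRegTorus τ)
      (a := fun y : regularSet G T × T => (y.1 : lieAlg T)) (b := fun y => y.2)
      (fun p hp => poly_mem_regularRing (a := fun z : C => z.1.1) (b := fun z : C => z.1.2) hp)
      (fun p hp hpU => inv_mem_regularRing (a := fun z : C => z.1.1) (b := fun z : C => z.1.2)
        hp hpU) ?_ ?_ hF
    · change ∀ i j, (fun z : C => ((τ z : GL (Fin n) ℂ) : Matrix (Fin n) (Fin n) ℂ) i j) ∈ _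
      simp only [h3]
      exact matrix_mul_entry_mem _ h2 (matrix_mul_entry_mem _ entry_mem_regularRing h1)
    · change ∀ i j, (fun z : C => (((τ z : GL (Fin n) ℂ)⁻¹ : GL (Fin n) ℂ) :
        Matrix (Fin n) (Fin n) ℂ) i j) ∈ _
      simp only [h4]
      exact matrix_mul_entry_mem _ h2 (matrix_mul_entry_mem _ inv_entry_mem_regularRing h1)
  · obtain ⟨h1, h2⟩ := hpolyδ (regularSet G T × T) (fun y => y.1) T (fun y => y.2)
    have h3 : F = fun y => (F ∘ toRegTorus τ) (Ψ y) := by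
      funext y
      rw [Function.comp_apply, hΦΨ]
    rw [h3]
    refine comp_mem_of_mem_regularRing (regTorusRing G T) (θ := Ψ)
      (a := fun z : C => z.1.1) (b := fun z : C => z.1.2)
      (fun p hp => poly_mem_regularRing (a := fun y : regularSet G T × T => (y.1 : lieAlg T))
        (b := fun y => y.2) hp)
      (fun p hp hpU => inv_mem_regularRing (a := fun y : regularSet G T × T => (y.1 : lieAlg T))
        (b := fun y => y.2) hp hpU) ?_ ?_ hF
    · exact matrix_mul_entry_mem _ (matrix_mul_entry_mem _ h1 entry_mem_regularRing) h2
    · have h4 : ∀ y : regularSet G T × T, ((Ψ y).1.2 : GL (Fin n) ℂ)⁻¹ =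
          (nx y.1 : GL (Fin n) ℂ) * ((y.2 : GL (Fin n) ℂ)⁻¹ * (nx y.1 : GL (Fin n) ℂ)⁻¹) := by
        intro y
        change (nx y.1 * y.2 * (nx y.1 : GL (Fin n) ℂ)⁻¹ : GL (Fin n) ℂ)⁻¹ = _
        group
      simp only [h4]
      exact matrix_mul_entry_mem _ h1 (matrix_mul_entry_mem _ inv_entry_mem_regularRing h2)
  · have hE : ∀ i, (e i : Matrix (Fin n) (Fin n) ℂ) ∈ superdiag P 1 := fun i =>
      ((h.mem_lieAlg_unipotent_iff hBc hNc).1 (e i).2).2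
    obtain ⟨p, rfl⟩ := exists_evalAt_of_mem_coordRing
      (fun g hg => ((h.mem_unipotent_iff g).1 hg).2) hf
    obtain ⟨k, hk⟩ := exists_mem_nilFiltration hE p
    have hsupp : (Function.support fun l : List I => monomialPairing hN.closed e l
        fun g : N => evalAt ((g : GL (Fin n) ℂ) : Matrix (Fin n) (Fin n) ℂ) p) ⊆
          listsLT I k := by
      intro l hl
      by_contra hlk
      refine hl ?_
      simp only
      rw [monomialPairing_evalAt]
      exact polyPairing_eq_zero _ hk (not_lt.1 fun hlt => hlk (mem_listsLT.2 hlt))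
    have hFT := measFourier_measD (α := α) hT.closed hN.closed e _ hsupp
    have hFT' : ∀ x : {x : lieAlg T | discriminant hbr x ≠ 0},
        measFourier (measD hT.closed hN.closed α e fun g : N =>
          evalAt ((g : GL (Fin n) ℂ) : Matrix (Fin n) (Fin n) ℂ) p) x =
        evalAt ((ψ' (x, lieExp hT.closed x) : GL (Fin n) ℂ) : Matrix (Fin n) (Fin n) ℂ) p := by
      intro x
      have h1 := evalAt_exp_neg_mul_exp hT.closed he x hk
      rw [hFT]
      simp only [monomialPairing_evalAt]
      -- With x + e = Ad_{n_x} x, the endpoint exp(-x) exp(x + e) of the curve becomes t⁻¹ n_x t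
      -- n_x⁻¹ for t = exp x.
      rw [← h1, ← heSum, ← (hnx' x _).2 rfl]
      congr 1
      change _ = (((glExp (x.1 : Matrix (Fin n) (Fin n) ℂ))⁻¹ * (nx' x : GL (Fin n) ℂ) *
        glExp (x.1 : Matrix (Fin n) (Fin n) ℂ) * (nx' x : GL (Fin n) ℂ)⁻¹ : GL (Fin n) ℂ) :
          Matrix (Fin n) (Fin n) ℂ)
      rw [mul_assoc, mul_assoc, ← mul_assoc (nx' x : GL (Fin n) ℂ), ← glExp_Ad, ← glExp_neg,
        Units.val_mul, glExp_coe, glExp_coe]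
    refine ⟨(listsLT I k).finite_toSet.subset hsupp, ?_, ?_, fun s q hq x t => ?_⟩
    · exact hψS (regularSet G T × T) (regTorusRing G T) (fun y => ι y.1) (fun y => y.2)
        (fun i j => poly_mem_regularRing (hentry i j)) (inv_mem_regularRing hδ hreg)
        entry_mem_regularRing inv_entry_mem_regularRing _ hf
    · rw [funext hFT]
      exact exists_isRationalForm_sum_iterInt hTt hα.indep _ _
    -- The comparison is carried out on {δ ≠ 0} × T and then evaluated at a regular point.
    · exact eq_mul_of_isRationalForm hTt hδ (fun x => Iff.rfl)
        (F := fun y => evalAt ((ψ' y : GL (Fin n) ℂ) : Matrix (Fin n) (Fin n) ℂ) p)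
        (hψS ({x : lieAlg T | discriminant hbr x ≠ 0} × T) _ (fun y => y.1) (fun y => y.2)
          (fun i j => poly_mem_regularRing (hentry i j)) (inv_mem_regularRing hδ fun u hu => hu)
          entry_mem_regularRing inv_entry_mem_regularRing _ hf) hq hFT' (ι x) t
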